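/- **Setting.** Let $T>0$, and let $\|\cdot\|$ be the Euclidean norm. Let $\psi_i:[0,T]\times\mathbb R^n\to\mathbb R$ ($i=1,\dots,r$) be continuous, $C(t):=\{x:\psi_i(t,x)\le 0,\ i=1,\dots,r\}$, $h=(f,g)$ with $f:[0,T]\times\mathbb R^n\times\mathbb R^l\times\mathbb R^m\to\mathbb R^n$, $g:[0,T]\times\mathbb R^n\times\mathbb R^l\times\mathbb R^m\to\mathbb R^l$, and let $U:[0,T]\rightsquigarrow\mathbb R^m$ be a Lebesgue measurable set-valued map with nonempty closed values. $\mathcal U$ is the set of measurable $u:[0,T]\to\mathbb R^m$ with $u(t)\in U(t)$ a.e. $N_S$ denotes the Clarke normal cone to $S$ ($N_S(s)=\emptyset$ if $s\notin S$), and $\bar B_a(z)$, $B_a(z)$ the closed and open balls. Put $\bar{\mathscr N}_{(a,b)}(t):=[C(t)\cap\bar B_a(\bar x(t))]\times\bar B_b(\bar y(t))$. Assume: * (A2) for some $\rho>0$ and all $t\in[0,T]$, $C(t)$ is nonempty and $\rho$-prox-regular: $\langle\xi,z-s\rangle\le\frac1{2\rho}\|z-s\|^2$ for all $s,z\in C(t)$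 and $\xi\in N_{C(t)}(s)$ with $\|\xi\|=1$. * $(\bar x,\bar y):[0,T]\to\mathbb R^n\times\mathbb R^l$ is Lipschitz with constant $L_{(\bar x,\bar y)}\ge1$, $\bar x(t)\in C(t)$ for all $t$, and $\bar\delta>0$. * (A3.1) There are $\rho_o,L_\psi>0$ such that, for each $i\le r$, $\nabla_x\psi_i$ exists on $\{(t,x+b): t\in[0,T],\ x\in C(t)\cap\bar B_{\bar\delta}(\bar x(t)),\ \|b\|<\rho_o\}$, and on the analogous set with $\|b\|\le\rho_o/2$ both $\psi_i$ and $\nabla_x\psi_i$ satisfy $|\psi_i(t_1,x_1)-\psi_i(t_2,x_2)|,\ \|\nabla_x\psi_i(t_1,x_1)-\nabla_x\psi_i(t_2,x_2)\|\le L_\psi(|t_1-t_2|+\|x_1-x_2\|)$. * (A3.2) If $\bar x(t)\in\operatorname{bdry}C(t)$, then $\sum\lambda_i\nabla_x\psi_i(t,\bar x(t))=0$ with $\lambda_i\ge0$ (sum over the $i$ with $\psi_i(t,\bar x(t))=0$) implies that all these $\lambda_i$ vanish. * (A4.1) For $(x,y)\in\bigcup_t[C(t)\cap\bar B_{\bar\delta}(\bar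 x(t))]\times\bigcup_t\bar B_{\bar\delta}(\bar y(t))$, $h(\cdot,x,y,u)$ is Lebesgue measurable for every $u\in\bigcup_tU(t)$, and $h(\cdot,x,y,u(\cdot))$ is Lebesgue measurable for every $u(\cdot)\in\mathcal U$; for a.e. $t$, $h(t,\cdot,\cdot,\cdot)$ is continuous on $\bar{\mathscr N}_{(\bar\delta,\bar\delta)}(t)\times U(t)$; there are $M_h>0$ and $L_h\in L^2([0,T];\mathbb R^+)$ such that, for a.e. $t$, $\|h(t,x,y,u)\|\le M_h$ and $\|h(t,x,y,u)-h(t,x',y',u)\|\le L_h(t)\|(x,y)-(x',y')\|$ for all $(x,y),(x',y')\in\bar{\mathscr N}_{(\bar\delta,\bar\delta)}(t)$, $u\in U(t)$. Let $\psi_{r+1}(t,x):=\frac12(\|x-\bar x(t)\|^2-\bar\varepsilon^2)$, $\varphi(t,y):=\frac12(\|y-\bar y(t)\|^2-\bar\delta^2)$ and $\bar{\mathcal I}^0_{(t,x)}:=\{i\le r+1:\psi_i(t,x)=0\}$. The numbers $\bar\varepsilon,\bar\eta$ are chosen so that $0<\bar\varepsilon<\bar\delta$, $\bar\varepsilon<\rho$,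 $0<\bar\eta<\bar\varepsilon/2$, $L_\psi\ge4\bar\eta/\rho_o$, and $$\Big\|\sum_{i\in\bar{\mathcal I}^0_{(t,x)}}\lambda_i\nabla_x\psi_i(t,x)\Big\|>2\bar\eta$$ whenever $t\in[0,T]$, $x\in C(t)\cap\bar B_{\bar\varepsilon}(\bar x(t))$, $\bar{\mathcal I}^0_{(t,x)}\ne\emptyset$, $\lambda_i\ge0$, $\sum_{i\in\bar{\mathcal I}^0_{(t,x)}}\lambda_i=1$. Let $\bar L:=\max\{L_\psi,\bar\delta L_{(\bar x,\bar y)}\}$, $\bar\mu:=\bar L(1+M_h)$, let $\gamma_k>\frac{2\bar\mu}{\bar\eta^2}e$ with $\gamma_k\to\infty$, and put $\bar\alpha_k:=\frac1{\gamma_k}\ln\frac{\bar\eta^2\gamma_k}{2\bar\mu}$, $\bar\rho_k:=\sqrt{\bar\delta^2-2\bar\alpha_k}$ (defined for large $k$), and $$\bar C^{\gamma_k}(t,k):=\Big\{x:\sum_{i=1}^{r+1}e^{\gamma_k\psi_i(t,x)}\le\frac{2\bar\mu}{\bar\eta^2\gamma_k}\Big\}.$$ Consider, with $W^{1,1}$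 solutions on $[0,T]$ and equations holding for a.e. $t\in[0,T]$, the systems $$(\bar D_{\gamma_k})\quad \dot x=f(t,x,y,u)-\sum_{i=1}^{r+1}\gamma_ke^{\gamma_k\psi_i(t,x)}\nabla_x\psi_i(t,x),\qquad \dot y=g(t,x,y,u)-\gamma_ke^{\gamma_k\varphi(t,y)}\nabla_y\varphi(t,y),$$ $$(\bar D)\quad \dot x\in f(t,x,y,u)-N_{C(t)\cap\bar B_{\bar\varepsilon}(\bar x(t))}(x),\qquad \dot y\in g(t,x,y,u)-N_{\bar B_{\bar\delta}(\bar y(t))}(y).$$ **Theorem.** Let $(c_k,d_k)\in\bar C^{\gamma_k}(0,k)\times\bar B_{\bar\rho_k}(\bar y(0))$ for all large $k$, $(c_k,d_k)\to(x_0,y_0)\in\bar{\mathscr N}_{(\bar\varepsilon,\bar\delta)}(0)$, and let $u_k\in\mathcal U$. **(I)** For $k$ large, $(\bar D_{\gamma_k})$ with $u=u_k$ and $(x(0),y(0))=(c_k,d_k)$ has a unique solution $(x_k,y_k)$. It belongs to $W^{1,\infty}$ and satisfies $$(x_k(t),y_k(t))\in\bar C^{\gamma_k}(t,k)\times\bar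 B_{\bar\rho_k}(\bar y(t))\quad\forall t\in[0,T],$$ $$\max\{\|\xi_k\|_\infty,\|\zeta_k\|_\infty\}\le\frac{2\bar\mu}{\bar\eta^2},\qquad \max\{\|\dot x_k\|_\infty,\|\dot y_k\|_\infty\}\le M_h+\frac{2\bar\mu}{\bar\eta^2}\bar L,$$ where $\xi_k^i(t):=\gamma_ke^{\gamma_k\psi_i(t,x_k(t))}$ ($i\le r+1$), $\xi_k:=\sum_{i=1}^{r+1}\xi_k^i$ and $\zeta_k(t):=\gamma_ke^{\gamma_k\varphi(t,y_k(t))}$ are positive and continuous on $[0,T]$. **(II)** There are $(x,y)\in W^{1,\infty}([0,T];\mathbb R^n\times\mathbb R^l)$, $(\xi^1,\dots,\xi^{r+1},\zeta)\in L^\infty([0,T];\mathbb R_+^{r+2})$ and a subsequence along which $(x_k,y_k)\to(x,y)$ uniformly and $(\dot x_k,\dot y_k)\to(\dot x,\dot y)$, $\xi^i_k\to\xi^i$ ($i\le r+1$), $\zeta_k\to\zeta$, $\xi_k\to\xi:=\sum_{i=1}^{r+1}\xi^i$ weakly* in $L^\infty$. Moreover $(x(t),y(t))\in\bar{\mathscr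 N}_{(\bar\varepsilon,\bar\delta)}(t)$ for all $t$, $$\max\{\|\xi\|_\infty,\|\zeta\|_\infty\}\le\frac{2\bar\mu}{\bar\eta^2},\qquad \max\{\|\dot x\|_\infty,\|\dot y\|_\infty\}\le M_h+\frac{2\bar\mu}{\bar\eta^2}\bar L,$$ and, for $t\in[0,T]$: $\xi^i(t)=0$ whenever $x(t)\in\operatorname{int}\{\psi_i(t,\cdot)\le0\}$ ($i\le r+1$); $\xi(t)=0$ whenever $x(t)\in\operatorname{int}C(t)\cap B_{\bar\varepsilon}(\bar x(t))$; $\zeta(t)=0$ whenever $\varphi(t,y(t))<0$. If a subsequence of $(u_k)$ converges a.e. to an element of $\mathcal U$, or if (A1) all $U(t)$ are compact and (A4.2) for a.e. $t$ the sets $h(t,x,y,U(t))$ are convex for all $(x,y)\in\bar{\mathscr N}_{(\bar\delta,\bar\delta)}(t)$, then (with the above subsequence suitably chosen) there is $u\in\mathcal U$ such that $(x,y)$ is the unique solution of $(\bar D)$ corresponding to $((x_0,y_0),u)$, and for a.e. $t$ $$\dot x(t)=f(t,x(t),y(t),u(t))-\sum_{i=1}^{r+1}\xi^i(t)\nabla_x\psi_i(t,x(t))=f(t,x(t),y(t),u(t))-\sum_{i\in\bar{\mathcal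 I}^0_{(t,x(t))}}\xi^i(t)\nabla_x\psi_i(t,x(t)),$$ $$\dot y(t)=g(t,x(t),y(t),u(t))-\zeta(t)\nabla_y\varphi(t,y(t)).$$ In the first case $u$ can be taken to be the a.e. limit of $(u_k)$ along the above subsequence. -/

import Mathlib

open MeasureTheory Filter Topology Set Metric

namespace SweepingProcess

/-! ### Notions from nonsmooth analysis -/

/-- The Clarke tangent cone to `S` at `s` (lower limit of `(S - s') / τ` as `s' → s` in `S` and
`τ ↓ 0`). -/
def clarkeTangentCone {F : Type*} [NormedAddCommGroup F] [InnerProductSpace ℝ F]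
    (S : Set F) (s : F) : Set F :=
  {v | ∀ e > (0 : ℝ), ∃ d > (0 : ℝ), ∀ s' ∈ S, ‖s' - s‖ < d →
    ∀ τ : ℝ, 0 < τ → τ < d → ∃ w : F, ‖w - v‖ < e ∧ s' + τ • w ∈ S}

/-- The Clarke normal cone `N_S(s)`: the polar of the Clarke tangent cone if `s ∈ S`, and the
empty set if `s ∉ S`. -/
def clarkeNormalCone {F : Type*} [NormedAddCommGroup F] [InnerProductSpace ℝ F]
    (S : Set F) (s : F) : Set F :=
  {ξ | s ∈ S ∧ ∀ v ∈ clarkeTangentCone S s, inner ℝ ξ v ≤ 0}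

/-- `S` is `ρ`-prox-regular. -/
def IsProxRegular {F : Type*} [NormedAddCommGroup F] [InnerProductSpace ℝ F]
    (ρ : ℝ) (S : Set F) : Prop :=
  ∀ s ∈ S, ∀ ξ ∈ clarkeNormalCone S s, ‖ξ‖ = 1 →
    ∀ z ∈ S, inner ℝ ξ (z - s) ≤ 1 / (2 * ρ) * ‖z - s‖ ^ 2

/-! ### Function spaces on `[0,T]` -/

/-- Lebesgue measure on `[0,T]`. -/
noncomputable def leb (T : ℝ) : Measure ℝ := volume.restrict (Icc 0 T)

/-- `z ∈ W^{1,∞}([0,T]; F)`. -/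
def IsW1Inf {F : Type*} [NormedAddCommGroup F] [NormedSpace ℝ F] (T : ℝ) (z : ℝ → F) : Prop :=
  AbsolutelyContinuousOnInterval z 0 T ∧ MemLp (deriv z) ⊤ (leb T)

/-- `v k → w` in the weak* topology of `L^∞([0,T]; F)`, the dual of `L^1([0,T]; F)`. -/
def WeakStarTendsto {F : Type*} [NormedAddCommGroup F] [InnerProductSpace ℝ F]
    (T : ℝ) (v : ℕ → ℝ → F) (w : ℝ → F) : Prop :=
  ∀ p : ℝ → F, Integrable p (leb T) →
    Tendsto (fun k => ∫ t, inner ℝ (p t) (v k t) ∂(leb T)) atTop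
      (𝓝 (∫ t, inner ℝ (p t) (w t) ∂(leb T)))

/-! ### The data -/

/-- `ℝ^d` with the Euclidean norm. -/
abbrev Euc (d : ℕ) : Type := EuclideanSpace ℝ (Fin d)

/-- The data of the controlled sweeping process, the reference pair `(xbar, ybar)`, the truncation
radii and the constants. This structure carries no assumption: these are stated below. -/
structure Data (n l m r : ℕ) where
  /-- the final time -/
  T : ℝ
  /-- the generators of the sweeping set -/
  psi : Fin r → ℝ → Euc n → ℝ
  /-- the drift in the sweeping inclusion -/
  f : ℝ → Euc n → Euc l → Euc m → Euc n
  /-- the right-hand side of the differential equation -/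
  g : ℝ → Euc n → Euc l → Euc m → Euc l
  /-- the control sets -/
  U : ℝ → Set (Euc m)
  /-- first component of the reference pair -/
  xbar : ℝ → Euc n
  /-- second component of the reference pair -/
  ybar : ℝ → Euc l
  /-- the radius `δ̄` -/
  delta : ℝ
  /-- the radius `ε̄` -/
  eps : ℝ
  /-- the constant `η̄` of the uniform constraint qualification -/
  eta : ℝ
  /-- the prox-regularity constant `ρ` of the sets `C(t)` -/
  rho : ℝ
  /-- the constant `ρ_o` -/
  rho0 : ℝ
  /-- the Lipschitz constant `L_ψ` of the generators and of their gradients -/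
  Lpsi : ℝ
  /-- the Lipschitz constant of `(xbar, ybar)` -/
  Lxy : ℝ
  /-- the bound `M_h` of `h = (f,g)` -/
  Mh : ℝ
  /-- the Lipschitz modulus `L_h` of `h = (f,g)` -/
  Lh : ℝ → ℝ

namespace Data

variable {n l m r : ℕ} (S : Data n l m r)

/-! ### Sets -/

/-- The sweeping set `C(t)`. -/
def C (t : ℝ) : Set (Euc n) := {x | ∀ i, S.psi i t x ≤ 0}

/-- The truncated sweeping set `C(t) ∩ B̄_ε̄(x̄(t))`. -/
def CTrunc (t : ℝ) : Set (Euc n) := S.C t ∩ closedBall (S.xbar t) S.eps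

/-- `[C(t) ∩ B̄_a(x̄(t))] × B̄_b(ȳ(t))`. -/
def N (a b t : ℝ) : Set (Euc n × Euc l) :=
  (S.C t ∩ closedBall (S.xbar t) a) ×ˢ closedBall (S.ybar t) b

/-- The generators `ψ_1, …, ψ_r, ψ_{r+1}` of the truncated set; the last one is
`ψ_{r+1}(t,x) = (‖x - x̄(t)‖² - ε̄²) / 2`. -/
noncomputable def psiBar : Fin (r + 1) → ℝ → Euc n → ℝ :=
  Fin.snoc (α := fun _ => ℝ → Euc n → ℝ) S.psi
    (fun t x => (‖x - S.xbar t‖ ^ 2 - S.eps ^ 2) / 2)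

/-- `φ(t,y) = (‖y - ȳ(t)‖² - δ̄²) / 2`. -/
noncomputable def phi (t : ℝ) (y : Euc l) : ℝ := (‖y - S.ybar t‖ ^ 2 - S.delta ^ 2) / 2

/-- Indices of the generators of the truncated set that are active at `(t,x)`. -/
noncomputable def active (t : ℝ) (x : Euc n) : Finset (Fin (r + 1)) :=
  Finset.univ.filter (fun i => S.psiBar i t x = 0)

/-- The times `t ∈ [0,T]` at which `x(t)` is interior to `{ψ_i(t,·) ≤ 0}`, for `i = 1, …, r+1`. -/
def Iminus (i : Fin (r + 1)) (x : ℝ → Euc n) : Set ℝ :=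
  {t ∈ Icc 0 S.T | x t ∈ interior {z | S.psiBar i t z ≤ 0}}

/-- `u ∈ 𝒰`: `u` is a (Lebesgue measurable) control with `u(t) ∈ U(t)` for a.e. `t ∈ [0,T]`. -/
def IsControl (u : ℝ → Euc m) : Prop :=
  AEMeasurable u (leb S.T) ∧ ∀ᵐ t ∂(leb S.T), u t ∈ S.U t

/-! ### Assumptions -/

/-- `U(·)` has nonempty closed values and is Lebesgue measurable. -/
def HypU : Prop :=
  (∀ t ∈ Icc 0 S.T, (S.U t).Nonempty ∧ IsClosed (S.U t)) ∧
  ∀ O : Set (Euc m), IsOpen O → NullMeasurableSet {t ∈ Icc 0 S.T | (S.U t ∩ O).Nonempty} volume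

/-- (A1): the values of `U(·)` are compact. -/
def HypA1 : Prop := ∀ t ∈ Icc 0 S.T, IsCompact (S.U t)

/-- (A2): the generators are continuous, and the sets `C(t)` (closed by continuity) are nonempty and
uniformly `ρ`-prox-regular. -/
def HypA2 : Prop :=
  0 < S.rho ∧
  (∀ i, ContinuousOn (fun p : ℝ × Euc n => S.psi i p.1 p.2) (Icc 0 S.T ×ˢ univ)) ∧
  ∀ t ∈ Icc 0 S.T, (S.C t).Nonempty ∧ IsProxRegular S.rho (S.C t)

/-- `(x̄,ȳ)` is Lipschitz on `[0,T]` with constant `L_{(x̄,ȳ)} ≥ 1` and `x̄(t) ∈ C(t)`. -/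
def HypRef : Prop :=
  (∀ t ∈ Icc 0 S.T, S.xbar t ∈ S.C t) ∧
  1 ≤ S.Lxy ∧
  ∀ s ∈ Icc 0 S.T, ∀ t ∈ Icc 0 S.T,
    ‖WithLp.toLp 2 (S.xbar s - S.xbar t, S.ybar s - S.ybar t)‖ ≤ S.Lxy * |s - t|

/-- (A3.1): regularity of the generators near the graph of `C(·) ∩ B̄_δ̄(x̄(·))`. -/
def HypA31 : Prop :=
  0 < S.rho0 ∧ 0 < S.Lpsi ∧
  ∀ i,
    (∀ t ∈ Icc 0 S.T, ∀ x ∈ S.C t ∩ closedBall (S.xbar t) S.delta, ∀ z ∈ ball x S.rho0,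
      DifferentiableAt ℝ (S.psi i t) z) ∧
    (∀ t₁ ∈ Icc 0 S.T, ∀ x₁ ∈ S.C t₁ ∩ closedBall (S.xbar t₁) S.delta,
      ∀ z₁ ∈ closedBall x₁ (S.rho0 / 2),
      ∀ t₂ ∈ Icc 0 S.T, ∀ x₂ ∈ S.C t₂ ∩ closedBall (S.xbar t₂) S.delta,
      ∀ z₂ ∈ closedBall x₂ (S.rho0 / 2),
      |S.psi i t₁ z₁ - S.psi i t₂ z₂| ≤ S.Lpsi * (|t₁ - t₂| + ‖z₁ - z₂‖) ∧
      ‖gradient (S.psi i t₁) z₁ - gradient (S.psi i t₂) z₂‖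
        ≤ S.Lpsi * (|t₁ - t₂| + ‖z₁ - z₂‖))

/-- (A3.2): constraint qualification along `x̄`. -/
def HypA32 : Prop :=
  ∀ t ∈ Icc 0 S.T, S.xbar t ∈ frontier (S.C t) → ∀ lam : Fin r → ℝ, (∀ i, 0 ≤ lam i) →
    ∑ i with S.psi i t (S.xbar t) = 0, lam i • gradient (S.psi i t) (S.xbar t) = 0 →
    ∀ i, S.psi i t (S.xbar t) = 0 → lam i = 0

/-- (A4.1): measurability, continuity, boundedness and Lipschitz condition on `h = (f,g)`.
Measurability in `t` is required for fixed `u` and along controls; the latter is implied by the usual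
joint (Lebesgue × Borel) measurability in `(t,u)`. -/
def HypA41 : Prop :=
  (∀ x ∈ ⋃ t ∈ Icc 0 S.T, S.C t ∩ closedBall (S.xbar t) S.delta,
    ∀ y ∈ ⋃ t ∈ Icc 0 S.T, closedBall (S.ybar t) S.delta,
    (∀ u ∈ ⋃ t ∈ Icc 0 S.T, S.U t,
      AEMeasurable (fun t => S.f t x y u) (leb S.T) ∧
      AEMeasurable (fun t => S.g t x y u) (leb S.T)) ∧
    (∀ u, S.IsControl u →
      AEMeasurable (fun t => S.f t x y (u t)) (leb S.T) ∧
      AEMeasurable (fun t => S.g t x y (u t)) (leb S.T))) ∧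
  (∀ᵐ t ∂(leb S.T),
    ContinuousOn (fun p : (Euc n × Euc l) × Euc m => S.f t p.1.1 p.1.2 p.2)
      (S.N S.delta S.delta t ×ˢ S.U t) ∧
    ContinuousOn (fun p : (Euc n × Euc l) × Euc m => S.g t p.1.1 p.1.2 p.2)
      (S.N S.delta S.delta t ×ˢ S.U t)) ∧
  0 < S.Mh ∧ (∀ t ∈ Icc 0 S.T, 0 ≤ S.Lh t) ∧ MemLp S.Lh 2 (leb S.T) ∧
  (∀ᵐ t ∂(leb S.T), ∀ p ∈ S.N S.delta S.delta t, ∀ p' ∈ S.N S.delta S.delta t, ∀ u ∈ S.U t,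
    ‖WithLp.toLp 2 (S.f t p.1 p.2 u, S.g t p.1 p.2 u)‖ ≤ S.Mh ∧
    ‖WithLp.toLp 2 (S.f t p.1 p.2 u - S.f t p'.1 p'.2 u, S.g t p.1 p.2 u - S.g t p'.1 p'.2 u)‖
      ≤ S.Lh t * ‖WithLp.toLp 2 (p.1 - p'.1, p.2 - p'.2)‖)

/-- (A4.2): convexity of the sets `h(t,x,y,U(t))`. -/
def HypA42 : Prop :=
  ∀ᵐ t ∂(leb S.T), ∀ p ∈ S.N S.delta S.delta t,
    Convex ℝ ((fun u => (S.f t p.1 p.2 u, S.g t p.1 p.2 u)) '' S.U t)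

/-- The choice of the radius `ε̄` and of the constant `η̄`: `0 < ε̄ < δ̄`, `ε̄ < ρ`,
`0 < η̄ < ε̄ / 2`, `4 η̄ / ρ_o ≤ L_ψ`, and convex combinations of the active gradients of the
generators of the truncated sets have norm larger than `2 η̄`. -/
def HypParam : Prop :=
  0 < S.eps ∧ S.eps < S.delta ∧ S.eps < S.rho ∧
  0 < S.eta ∧ S.eta < S.eps / 2 ∧ 4 * S.eta / S.rho0 ≤ S.Lpsi ∧
  ∀ t ∈ Icc 0 S.T, ∀ x ∈ S.CTrunc t, (S.active t x).Nonempty →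
    ∀ lam : Fin (r + 1) → ℝ, (∀ i, 0 ≤ lam i) → ∑ i ∈ S.active t x, lam i = 1 →
      2 * S.eta < ‖∑ i ∈ S.active t x, lam i • gradient (S.psiBar i t) x‖

/-! ### The penalty approximation -/

/-- `L̄ = max {L_ψ, δ̄ L_{(x̄,ȳ)}}`. -/
noncomputable def LBar : ℝ := max S.Lpsi (S.delta * S.Lxy)

/-- `μ̄ = L̄ (1 + M_h)`. -/
noncomputable def muBar : ℝ := S.LBar * (1 + S.Mh)

/-- `ᾱ_k = γ_k⁻¹ ln (η̄² γ_k / (2 μ̄))` for `γ_k = γ`. -/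
noncomputable def alphaBar (γ : ℝ) : ℝ := 1 / γ * Real.log (S.eta ^ 2 * γ / (2 * S.muBar))

/-- `ρ̄_k = √(δ̄² - 2 ᾱ_k)` for `γ_k = γ`. -/
noncomputable def rhoBar (γ : ℝ) : ℝ := Real.sqrt (S.delta ^ 2 - 2 * S.alphaBar γ)

/-- The set `C̄^{γ_k}(t,k)` for `γ_k = γ`. -/
noncomputable def CPen (γ t : ℝ) : Set (Euc n) :=
  {x | ∑ i, Real.exp (γ * S.psiBar i t x) ≤ 2 * S.muBar / (S.eta ^ 2 * γ)}

/-- The multiplier `γ e^{γ ψ_i(t,x(t))}`, `i = 1, …, r+1`. -/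
noncomputable def xiPen (γ : ℝ) (x : ℝ → Euc n) (i : Fin (r + 1)) (t : ℝ) : ℝ :=
  γ * Real.exp (γ * S.psiBar i t (x t))

/-- The multiplier `γ e^{γ φ(t,y(t))}`. -/
noncomputable def zetaPen (γ : ℝ) (y : ℝ → Euc l) (t : ℝ) : ℝ :=
  γ * Real.exp (γ * S.phi t (y t))

/-- `(x,y)` is a (Carathéodory, i.e. `W^{1,1}`) solution on `[0,T]` of the penalized system `(D̄_γ)`
for the control `u` and the initial value `(c,d)`. -/
def IsPenSolution (γ : ℝ) (u : ℝ → Euc m) (c : Euc n) (d : Euc l)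
    (x : ℝ → Euc n) (y : ℝ → Euc l) : Prop :=
  AbsolutelyContinuousOnInterval x 0 S.T ∧ AbsolutelyContinuousOnInterval y 0 S.T ∧
  x 0 = c ∧ y 0 = d ∧
  ∀ᵐ t ∂(leb S.T),
    HasDerivAt x (S.f t (x t) (y t) (u t)
      - ∑ i, (γ * Real.exp (γ * S.psiBar i t (x t))) • gradient (S.psiBar i t) (x t)) t ∧
    HasDerivAt y (S.g t (x t) (y t) (u t)
      - (γ * Real.exp (γ * S.phi t (y t))) • gradient (S.phi t) (y t)) t

/-- `(x,y)` is a (`W^{1,1}`) solution on `[0,T]` of the truncated sweeping system `(D̄)` for the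
control `u` and the initial value `(x₀,y₀)`. -/
def IsTruncSolution (u : ℝ → Euc m) (x₀ : Euc n) (y₀ : Euc l)
    (x : ℝ → Euc n) (y : ℝ → Euc l) : Prop :=
  AbsolutelyContinuousOnInterval x 0 S.T ∧ AbsolutelyContinuousOnInterval y 0 S.T ∧
  x 0 = x₀ ∧ y 0 = y₀ ∧
  ∀ᵐ t ∂(leb S.T),
    (∃ v ∈ clarkeNormalCone (S.CTrunc t) (x t),
      HasDerivAt x (S.f t (x t) (y t) (u t) - v) t) ∧
    (∃ w ∈ clarkeNormalCone (closedBall (S.ybar t) S.delta) (y t),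
      HasDerivAt y (S.g t (x t) (y t) (u t) - w) t)

/-! ### The conclusions -/

/-- Existence, uniqueness (among all `W^{1,1}` solutions), invariance and bounds for one penalized
system. -/
def PenConclusion (γ : ℝ) (u : ℝ → Euc m) (c : Euc n) (d : Euc l)
    (x : ℝ → Euc n) (y : ℝ → Euc l) : Prop :=
  S.IsPenSolution γ u c d x y ∧ IsW1Inf S.T x ∧ IsW1Inf S.T y ∧
  (∀ x' y', S.IsPenSolution γ u c d x' y' → EqOn x' x (Icc 0 S.T) ∧ EqOn y' y (Icc 0 S.T)) ∧
  (∀ t ∈ Icc 0 S.T, x t ∈ S.CPen γ t ∧ y t ∈ closedBall (S.ybar t) (S.rhoBar γ)) ∧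
  (∀ i, ContinuousOn (S.xiPen γ x i) (Icc 0 S.T)) ∧ ContinuousOn (S.zetaPen γ y) (Icc 0 S.T) ∧
  (∀ t ∈ Icc 0 S.T, (∀ i, 0 < S.xiPen γ x i t) ∧ 0 < S.zetaPen γ y t) ∧
  (∀ t ∈ Icc 0 S.T, ∑ i, S.xiPen γ x i t ≤ 2 * S.muBar / S.eta ^ 2 ∧
    S.zetaPen γ y t ≤ 2 * S.muBar / S.eta ^ 2) ∧
  (∀ᵐ t ∂(leb S.T), ‖deriv x t‖ ≤ S.Mh + 2 * S.muBar / S.eta ^ 2 * S.LBar ∧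
    ‖deriv y t‖ ≤ S.Mh + 2 * S.muBar / S.eta ^ 2 * S.LBar)

/-- Convergence of the penalized trajectories `(X k, Y k)` (with parameters `γ k`) and of their
multipliers to `(x,y)`, `ξ`, `ζ`. -/
def LimitConvergence (γ : ℕ → ℝ) (X : ℕ → ℝ → Euc n) (Y : ℕ → ℝ → Euc l)
    (x : ℝ → Euc n) (y : ℝ → Euc l) (ξ : Fin (r + 1) → ℝ → ℝ) (ζ : ℝ → ℝ) : Prop :=
  TendstoUniformlyOn X x atTop (Icc 0 S.T) ∧ TendstoUniformlyOn Y y atTop (Icc 0 S.T) ∧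
  WeakStarTendsto S.T (fun k => deriv (X k)) (deriv x) ∧
  WeakStarTendsto S.T (fun k => deriv (Y k)) (deriv y) ∧
  (∀ i, WeakStarTendsto S.T (fun k => S.xiPen (γ k) (X k) i) (ξ i)) ∧
  WeakStarTendsto S.T (fun k => S.zetaPen (γ k) (Y k)) ζ ∧
  WeakStarTendsto S.T (fun k t => ∑ i, S.xiPen (γ k) (X k) i t) (fun t => ∑ i, ξ i t)

/-- Regularity, bounds and support conditions of the limit. -/
def LimitProperties (x : ℝ → Euc n) (y : ℝ → Euc l) (ξ : Fin (r + 1) → ℝ → ℝ) (ζ : ℝ → ℝ) :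
    Prop :=
  IsW1Inf S.T x ∧ IsW1Inf S.T y ∧
  (∀ i, MemLp (ξ i) ⊤ (leb S.T)) ∧ MemLp ζ ⊤ (leb S.T) ∧
  (∀ t ∈ Icc 0 S.T, (∀ i, 0 ≤ ξ i t) ∧ 0 ≤ ζ t) ∧
  (∀ t ∈ Icc 0 S.T, (x t, y t) ∈ S.N S.eps S.delta t) ∧
  (∀ᵐ t ∂(leb S.T), ∑ i, ξ i t ≤ 2 * S.muBar / S.eta ^ 2 ∧ ζ t ≤ 2 * S.muBar / S.eta ^ 2) ∧
  (∀ᵐ t ∂(leb S.T), ‖deriv x t‖ ≤ S.Mh + 2 * S.muBar / S.eta ^ 2 * S.LBar ∧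
    ‖deriv y t‖ ≤ S.Mh + 2 * S.muBar / S.eta ^ 2 * S.LBar) ∧
  (∀ i, ∀ t ∈ S.Iminus i x, ξ i t = 0) ∧
  (∀ t ∈ Icc 0 S.T, x t ∈ interior (S.C t) ∩ ball (S.xbar t) S.eps → ∑ i, ξ i t = 0) ∧
  (∀ t ∈ Icc 0 S.T, S.phi t (y t) < 0 → ζ t = 0)

/-- `(x,y)` is the unique solution of `(D̄)` for `((x₀,y₀),u)`, and `ξ`, `ζ` are multipliers for
it. -/
def IsUniqueTruncSolutionWith (u : ℝ → Euc m) (x₀ : Euc n) (y₀ : Euc l)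
    (x : ℝ → Euc n) (y : ℝ → Euc l) (ξ : Fin (r + 1) → ℝ → ℝ) (ζ : ℝ → ℝ) : Prop :=
  S.IsTruncSolution u x₀ y₀ x y ∧
  (∀ x' y', S.IsTruncSolution u x₀ y₀ x' y' → EqOn x' x (Icc 0 S.T) ∧ EqOn y' y (Icc 0 S.T)) ∧
  ∀ᵐ t ∂(leb S.T),
    HasDerivAt x (S.f t (x t) (y t) (u t)
      - ∑ i, ξ i t • gradient (S.psiBar i t) (x t)) t ∧
    HasDerivAt x (S.f t (x t) (y t) (u t)
      - ∑ i ∈ S.active t (x t), ξ i t • gradient (S.psiBar i t) (x t)) t ∧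
    HasDerivAt y (S.g t (x t) (y t) (u t) - ζ t • gradient (S.phi t) (y t)) t

end Data

end SweepingProcess

open SweepingProcess

/-! Everything rests on a bound for the total penalty that is uniform in the parameter. Along a
penalized trajectory let W be the sum of e^{γψ_i(t,x(t))} over i ≤ r+1, and V the sum of
e^{γψ_i}∇ψ_i. Each ψ_i(t,x(t)) grows at rate at most L̄ + ⟨∇ψ_i, ẋ⟩, which leads to W' ≤ γ(μ̄W −
γ‖V‖²). After division by W the weights form a convex combination. When W ≥ 2μ̄/(η̄²γ), an index
whose ψ_i stays below −c carries weight of order γe^{−cγ} at most. By compactness of the graph of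
the truncated set, the constraint qualification for active gradients therefore gives ‖V‖ ≥ η̄W once
γ is large (`exists_forall_le_norm_sum`). Hence W cannot increase above the level 2μ̄/(η̄²γ), so
C̄^γ is invariant, and γW ≤ 2μ̄/η̄² is the bound on the multipliers. The y-equation is the same
argument with a single generator (`invariant`).

For fixed γ the invariant sets lie uniformly inside the region where the data are bounded and
Lipschitz. Picard iteration can thus be repeated with one step length up to time T
(`exists_lipSolution_of_invariant`). Every W^{1,1} solution obeys the same invariance, so Gronwall's
inequality gives uniqueness among all of them.

For the limit, derivatives and multipliers are bounded in L^∞ and have weak* convergent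
subsequences, while the equi-Lipschitz trajectories converge uniformly. A product of a weak*
convergent multiplier and a boundedly a.e. convergent gradient passes to the limit, so ẋ + Σ ξ^i∇ψ_i
and ẏ + ζ∇φ are weak* limits of the drifts (`exists_weakStarTendsto_drift`). If the controls
converge a.e., continuity of h identifies these limits. If the velocity sets are compact and convex,
a Hahn–Banach argument in L² places the limits in h(t,x,y,U(t)), and Filippov's lemma supplies a
measurable control. Multipliers vanish where their constraint is strict, because γe^{γa} → 0 for a <
0. What remains is a nonnegative combination of active gradients, which is a Clarke normal.

Uniqueness for the limit system comes from hypomonotonicity of the normal cones of the truncated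
sets (`exists_inner_le_of_mem_clarkeNormalCone`). The qualification provides a common descent
direction d for the active generators. Since these are semiconvex, z − x corrected by a multiple of
‖z − x‖²d is a tangent vector, and a normal ξ satisfies ⟨ξ, z − x⟩ ≤ κ‖ξ‖‖z − x‖². -/

namespace SweepingProcess

/-! ### Absolutely continuous curves: monotonicity, Gronwall, chain rule -/

section AbsolutelyContinuous

/-- A function whose increments are dominated by those of two absolutely continuous functions is
absolutely continuous. -/
theorem absolutelyContinuousOnInterval_of_dist_le {X Y Z : Type*} [PseudoMetricSpace X]
    [PseudoMetricSpace Y] [PseudoMetricSpace Z] {g : ℝ → X} {f₁ : ℝ → Y} {f₂ : ℝ → Z} {a b C : ℝ}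
    (h₁ : AbsolutelyContinuousOnInterval f₁ a b) (h₂ : AbsolutelyContinuousOnInterval f₂ a b)
    (h : ∀ s ∈ uIcc a b, ∀ t ∈ uIcc a b,
      dist (g s) (g t) ≤ C * (dist (f₁ s) (f₁ t) + dist (f₂ s) (f₂ t))) :
    AbsolutelyContinuousOnInterval g a b := by
  have hlim := ((Tendsto.add h₁ h₂).const_mul C)
  rw [add_zero, mul_zero] at hlim
  refine squeeze_zero' (Eventually.of_forall fun E => Finset.sum_nonneg fun _ _ => dist_nonneg)
    ?_ hlim
  filter_upwards [mem_inf_of_right (mem_principal_self _)] with E hE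
  rw [← Finset.sum_add_distrib, Finset.mul_sum]
  exact Finset.sum_le_sum fun i hi => h _ (hE.1 i hi).1 _ (hE.1 i hi).2

theorem absolutelyContinuousOnInterval_id (a b : ℝ) :
    AbsolutelyContinuousOnInterval (fun t : ℝ => t) a b :=
  (LipschitzWith.id.lipschitzOnWith (s := uIcc a b)).absolutelyContinuousOnInterval

theorem absolutelyContinuousOnInterval_of_norm_sub_le {E : Type*} [NormedAddCommGroup E]
    {z : ℝ → E} {a b M : ℝ}
    (h : ∀ s ∈ uIcc a b, ∀ t ∈ uIcc a b, ‖z s - z t‖ ≤ M * |s - t|) :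
    AbsolutelyContinuousOnInterval z a b := by
  refine absolutelyContinuousOnInterval_of_dist_le (C := |M|)
    (absolutelyContinuousOnInterval_id a b) (absolutelyContinuousOnInterval_id a b) ?_
  intro s hs t ht
  rw [dist_eq_norm, Real.dist_eq]
  have := h s hs t ht
  nlinarith [abs_nonneg (s - t), le_abs_self M, abs_nonneg M,
    mul_nonneg (abs_nonneg M) (abs_nonneg (s - t)),
    mul_le_mul_of_nonneg_right (le_abs_self M) (abs_nonneg (s - t))]

/-- This is the fundamental theorem of calculus for absolutely continuous functions; all
differential inequalities below are integrated through it. -/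
theorem le_of_ae_deriv_nonpos {D : ℝ → ℝ} {a b : ℝ} (hab : a ≤ b)
    (hD : AbsolutelyContinuousOnInterval D a b)
    (h : ∀ᵐ t, t ∈ Ioo a b → deriv D t ≤ 0) : D b ≤ D a := by
  have h1 := hD.integral_deriv_eq_sub
  have h2 : ∫ t in a..b, deriv D t ≤ 0 := by
    rw [intervalIntegral.integral_of_le hab, integral_Ioc_eq_integral_Ioo]
    refine integral_nonpos_of_ae ?_
    filter_upwards [(ae_restrict_iff' measurableSet_Ioo).2 h] with t ht using ht
  linarith

theorem mono_uIcc {X : Type*} [PseudoMetricSpace X] {D : ℝ → X} {a b c d : ℝ}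
    (hD : AbsolutelyContinuousOnInterval D a b) (hac : a ≤ c) (hcd : c ≤ d) (hdb : d ≤ b) :
    AbsolutelyContinuousOnInterval D c d :=
  hD.mono (by
    rw [uIcc_of_le hcd, uIcc_of_le (hac.trans (hcd.trans hdb))]
    exact Icc_subset_Icc hac hdb)

/-- An absolutely continuous function that starts below `θ` and does not increase above `θ` stays
below `θ`. -/
theorem le_of_ae_deriv_nonpos_above {D : ℝ → ℝ} {a b θ : ℝ}
    (hD : AbsolutelyContinuousOnInterval D a b) (ha : D a ≤ θ)
    (h : ∀ᵐ t, t ∈ Ioo a b → θ < D t → deriv D t ≤ 0) : ∀ t ∈ Icc a b, D t ≤ θ := by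
  intro t ht
  by_contra! hlt
  have hab : a ≤ b := ht.1.trans ht.2
  have hc : ContinuousOn D (Icc a b) := by simpa [uIcc_of_le hab] using hD.continuousOn
  set B : Set ℝ := {s ∈ Icc a t | D s ≤ θ}
  have hBc : IsClosed B := by
    have : B = Icc a t ∩ D ⁻¹' Iic θ := by ext; simp [B]
    rw [this]
    exact (hc.mono (Icc_subset_Icc le_rfl ht.2)).preimage_isClosed_of_isClosed isClosed_Icc
      isClosed_Iic
  have hBn : B.Nonempty := ⟨a, ⟨le_rfl, ht.1⟩, ha⟩
  have hBb : BddAbove B := ⟨t, fun s hs => hs.1.2⟩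
  have hs := hBc.csSup_mem hBn hBb
  -- The last time before t at which D is at most θ. On the interval from s to t the function
  -- exceeds θ, hence does not increase, and D t ≤ D s ≤ θ contradicts the choice of t.
  set s := sSup B
  have hmono := le_of_ae_deriv_nonpos hs.1.2 (mono_uIcc hD hs.1.1 hs.1.2 ht.2) (by
    filter_upwards [h] with τ hτ hτI
    refine hτ ⟨hs.1.1.trans_lt hτI.1, hτI.2.trans_le ht.2⟩ ?_
    by_contra! hle
    exact absurd (le_csSup hBb ⟨⟨hs.1.1.trans hτI.1.le, hτI.2.le⟩, hle⟩) (not_le.2 hτI.1))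
  linarith [hs.2]

/-- Gronwall's inequality with an integrable coefficient. -/
theorem nonpos_of_ae_deriv_le_mul {D a : ℝ → ℝ} {T : ℝ} (hT : 0 ≤ T)
    (hD : AbsolutelyContinuousOnInterval D 0 T) (ha : IntervalIntegrable a volume 0 T)
    (h0 : D 0 ≤ 0) (h : ∀ᵐ t, t ∈ Ioo 0 T → deriv D t ≤ a t * D t) :
    ∀ t ∈ Icc 0 T, D t ≤ 0 := by
  -- Integrating factor: the derivative of D·exp(−A) is (D' − aD)·exp(−A) ≤ 0 almost everywhere. The
  -- exponential is Lipschitz only on bounded sets, so absolute continuity of exp(−A) uses the bound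
  -- on A.
  set A : ℝ → ℝ := fun t => ∫ s in (0 : ℝ)..t, a s
  have hA : AbsolutelyContinuousOnInterval A 0 T :=
    ha.absolutelyContinuousOnInterval_intervalIntegral (by simp)
  obtain ⟨R, hR⟩ := hA.exists_bound
  have hexp : AbsolutelyContinuousOnInterval (fun t => Real.exp (-A t)) 0 T := by
    have hconv : Convex ℝ (Icc (-R) R) := convex_Icc _ _
    obtain ⟨K, hK⟩ := (Real.contDiff_exp.contDiffOn (n := 1) (s := Icc (-R) R)
      |>.exists_lipschitzOnWith (by decide) hconv isCompact_Icc)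
    refine absolutelyContinuousOnInterval_of_dist_le (C := K) hA
      (absolutelyContinuousOnInterval_id 0 T) ?_
    intro s hs t ht
    have h1 : ∀ s ∈ uIcc 0 T, -A s ∈ Icc (-R) R := fun s hs => by
      have := abs_le.1 (by simpa using hR s hs)
      constructor <;> linarith
    have h2 := hK.dist_le_mul _ (h1 s hs) _ (h1 t ht)
    rw [dist_neg_neg] at h2
    exact h2.trans (mul_le_mul_of_nonneg_left (le_add_of_nonneg_right dist_nonneg) K.2)
  have hE := hD.fun_mul hexp
  have key : ∀ t ∈ Icc 0 T, D t * Real.exp (-A t) ≤ 0 := by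
    intro t ht
    have hm := le_of_ae_deriv_nonpos ht.1 (mono_uIcc hE le_rfl ht.1 ht.2) (by
      filter_upwards [h, hD.ae_differentiableAt, ha.ae_hasDerivAt_integral] with s h1 h2 h3 hs
      have hs' : s ∈ Ioo 0 T := ⟨hs.1, hs.2.trans_le ht.2⟩
      have hsu : s ∈ uIcc 0 T := by rw [uIcc_of_le hT]; exact Ioo_subset_Icc_self hs'
      have hd := ((h2 hsu).hasDerivAt.mul (h3 hsu 0 (by simp)).neg.exp).deriv
      have e : deriv (fun t => D t * Real.exp (-A t)) s = _ := hd
      rw [e]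
      have := h1 hs'
      have hp := Real.exp_pos (-A s)
      change deriv D s * Real.exp (-A s) + D s * (Real.exp (-A s) * -a s) ≤ 0
      nlinarith)
    have : D 0 * Real.exp (-A 0) ≤ 0 := mul_nonpos_of_nonpos_of_nonneg h0 (Real.exp_pos _).le
    linarith
  intro t ht
  exact nonpos_of_mul_nonpos_left (key t ht) (Real.exp_pos _)

/-- The derivative of an absolutely continuous curve in `ℝ^d` has integrable norm. -/
theorem intervalIntegrable_norm_deriv {d : ℕ} {x : ℝ → Euc d} {a b : ℝ}
    (hx : AbsolutelyContinuousOnInterval x a b) (hd : ∀ᵐ t, t ∈ uIcc a b → DifferentiableAt ℝ x t) :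
    IntervalIntegrable (fun t => ‖deriv x t‖) volume a b := by
  -- Integrability is known for derivatives of scalar absolutely continuous functions, so the norm
  -- is dominated by the sum over the coordinates.
  have hi : ∀ i, AbsolutelyContinuousOnInterval (fun t => x t i) a b := fun i =>
    absolutelyContinuousOnInterval_of_dist_le (C := 1) hx (absolutelyContinuousOnInterval_id a b)
      fun s _ t _ => by
        have := PiLp.norm_apply_le (x s - x t) i
        rw [dist_eq_norm, dist_eq_norm, one_mul]
        exact le_add_of_le_of_nonneg (by simpa using this) dist_nonneg
  have hsum : IntervalIntegrable (fun t => ∑ i, ‖deriv (fun s => x s i) t‖) volume a b := by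
    have := IntervalIntegrable.sum (μ := volume) (a := a) (b := b) Finset.univ
      (f := fun i t => ‖deriv (fun s => x s i) t‖)
      fun i _ => ((hi i).intervalIntegrable_deriv).norm
    simpa [Finset.sum_fn] using this
  refine hsum.mono_fun' ?_ ?_
  · exact (measurable_deriv x).norm.aestronglyMeasurable
  · filter_upwards [(ae_restrict_iff' measurableSet_uIoc).2
      (hd.mono fun t ht (h : t ∈ uIoc a b) => ht (uIoc_subset_uIcc h))] with t ht
    rw [norm_norm]
    have hv : deriv x t = ∑ i, (deriv x t i) • EuclideanSpace.single i (1 : ℝ) := by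
      have := (EuclideanSpace.basisFun (Fin d) ℝ).sum_repr (deriv x t)
      simpa using this.symm
    have hc : ∀ i, deriv (fun s => x s i) t = deriv x t i := fun i =>
      ((EuclideanSpace.proj (𝕜 := ℝ) i).hasFDerivAt.comp_hasDerivAt t ht.hasDerivAt).deriv
    calc ‖deriv x t‖ = ‖∑ i, (deriv x t i) • EuclideanSpace.single i (1 : ℝ)‖ := by rw [← hv]
      _ ≤ ∑ i, ‖(deriv x t i) • EuclideanSpace.single i (1 : ℝ)‖ := norm_sum_le _ _
      _ = _ := by simp [norm_smul, hc]

/-- An absolutely continuous curve whose derivative is a.e. bounded by `M` is `M`-Lipschitz. -/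
theorem norm_sub_le_of_ae_deriv_le {E : Type*} [NormedAddCommGroup E] [InnerProductSpace ℝ E]
    {x : ℝ → E} {a b M : ℝ} (hx : AbsolutelyContinuousOnInterval x a b)
    (hd : ∀ᵐ t, t ∈ Ioo a b → ∃ v, HasDerivAt x v t ∧ ‖v‖ ≤ M) :
    ∀ s ∈ Icc a b, ∀ t ∈ Icc a b, ‖x s - x t‖ ≤ M * |s - t| := by
  have key : ∀ s ∈ Icc a b, ∀ t ∈ Icc a b, s ≤ t → ‖x t - x s‖ ≤ M * (t - s) := by
    intro s hs t ht hst
    by_cases h0 : x t - x s = 0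
    · rcases hst.eq_or_lt with rfl | hlt
      · simp
      rw [h0, norm_zero]
      -- The sign of M is not assumed. It follows from any one point of the interval at which the
      -- derivative bound holds.
      have hM : 0 ≤ M := by
        have hpos : (0 : ENNReal) < volume (Ioo a b) := by
          rw [Real.volume_Ioo, ENNReal.ofReal_pos]; linarith [hs.1, ht.2]
        have := (ae_restrict_iff' measurableSet_Ioo).2 hd
        have hne : NeBot (ae (volume.restrict (Ioo a b))) := by
          rw [ae_neBot]; simpa [Measure.restrict_eq_zero] using hpos.ne'
        obtain ⟨τ, v, -, hv⟩ := (@Eventually.exists _ _ _ hne this)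
        exact (norm_nonneg v).trans hv
      exact mul_nonneg hM (by linarith)
    -- Testing against the increment itself reduces the claim to the scalar function τ ↦ ⟨e, x τ⟩ −
    -- M‖e‖τ, which is nonincreasing; division by ‖e‖ then gives the bound.
    set e := x t - x s
    have hD : AbsolutelyContinuousOnInterval (fun τ => inner ℝ e (x τ) - M * ‖e‖ * τ) s t := by
      refine absolutelyContinuousOnInterval_of_dist_le (C := ‖e‖ + |M| * ‖e‖)
        (mono_uIcc hx hs.1 hst ht.2) (absolutelyContinuousOnInterval_id s t) ?_
      intro p _ q _
      rw [Real.dist_eq, dist_eq_norm, Real.dist_eq]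
      have e1 : inner ℝ e (x p) - M * ‖e‖ * p - (inner ℝ e (x q) - M * ‖e‖ * q)
        = inner ℝ e (x p - x q) - M * ‖e‖ * (p - q) := by rw [inner_sub_right]; ring
      rw [e1]
      have h1 := abs_real_inner_le_norm e (x p - x q)
      have h2 : |M * ‖e‖ * (p - q)| = |M| * ‖e‖ * |p - q| := by
        rw [abs_mul, abs_mul, abs_norm]
      have h3 := abs_sub (inner ℝ e (x p - x q)) (M * ‖e‖ * (p - q))
      have h4 : 0 ≤ ‖e‖ * |p - q| := by positivity
      have h5 : 0 ≤ |M| * ‖e‖ * ‖x p - x q‖ := by positivity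
      nlinarith
    have hm := le_of_ae_deriv_nonpos hst hD (by
      filter_upwards [hd] with τ hτ hτI
      obtain ⟨v, hv, hvM⟩ := hτ ⟨hs.1.trans_lt hτI.1, hτI.2.trans_le ht.2⟩
      have h1 : HasDerivAt (fun τ => inner ℝ e (x τ) - M * ‖e‖ * τ)
          (inner ℝ e v - M * ‖e‖ * 1) τ := by
        have := ((innerSL ℝ e).hasFDerivAt (x := x τ)).comp_hasDerivAt τ hv
        exact HasDerivAt.sub this ((hasDerivAt_id τ).const_mul _)
      rw [h1.deriv]
      have := real_inner_le_norm e v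
      have : ‖e‖ * ‖v‖ ≤ ‖e‖ * M := by gcongr
      linarith)
    have h2 : inner ℝ e (x t) - inner ℝ e (x s) = ‖e‖ * ‖e‖ := by
      rw [← inner_sub_right, real_inner_self_eq_norm_mul_norm]
    have h3 : ‖e‖ * ‖e‖ ≤ ‖e‖ * (M * (t - s)) := by linarith
    exact le_of_mul_le_mul_left h3 (norm_pos_iff.2 h0)
  intro s hs t ht
  rcases le_total s t with h | h
  · rw [norm_sub_rev, abs_sub_comm, abs_of_nonneg (by linarith)]; exact key s hs t ht h
  · rw [abs_of_nonneg (by linarith)]; exact key t ht s hs h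

/-- The derivative along a curve of a function that is Lipschitz in time. -/
theorem deriv_comp_le_of_lipschitz_time {E : Type*} [NormedAddCommGroup E] [InnerProductSpace ℝ E]
    [CompleteSpace E] {ψ : ℝ → E → ℝ} {z : ℝ → E} {v : E} {t L : ℝ}
    (hL : ∀ᶠ s in 𝓝 t, |ψ s (z s) - ψ t (z s)| ≤ L * |s - t|) (hz : HasDerivAt z v t)
    (hψ : DifferentiableAt ℝ (ψ t) (z t)) (hd : DifferentiableAt ℝ (fun s => ψ s (z s)) t) :
    deriv (fun s => ψ s (z s)) t ≤ L + inner ℝ (gradient (ψ t) (z t)) v := by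
  have h1 : HasDerivAt (fun s => ψ t (z s)) (inner ℝ (gradient (ψ t) (z t)) v) t := by
    have := hψ.hasGradientAt.hasFDerivAt.comp_hasDerivAt t hz
    exact this
  -- No time derivative of ψ is available. The two known derivatives are subtracted, and the
  -- remainder, which vanishes at time t, is bounded through its right difference quotients.
  have h2 := (hd.hasDerivAt.sub h1)
  have h3 := h2.tendsto_slope_zero_right
  have h4 : deriv (fun s => ψ s (z s)) t - inner ℝ (gradient (ψ t) (z t)) v ≤ L := by
    refine le_of_tendsto h3 ?_
    have hL' : ∀ᶠ h in 𝓝[>] (0 : ℝ), |ψ (t + h) (z (t + h)) - ψ t (z (t + h))| ≤ L * |h| := by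
      have : Tendsto (fun h : ℝ => t + h) (𝓝[>] 0) (𝓝 t) := by
        have hc : ContinuousAt (fun h : ℝ => t + h) 0 := by fun_prop
        have h := hc.tendsto
        rw [add_zero] at h
        exact h.mono_left nhdsWithin_le_nhds
      filter_upwards [this.eventually hL] with h hh
      simpa using hh
    filter_upwards [hL', self_mem_nhdsWithin] with h hh hpos
    have hpos : 0 < h := hpos
    change h⁻¹ * (ψ (t + h) (z (t + h)) - ψ t (z (t + h)) - (ψ t (z t) - ψ t (z t))) ≤ L
    rw [sub_self, sub_zero, inv_mul_le_iff₀ hpos]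
    rw [abs_of_pos hpos] at hh
    linarith [le_abs_self (ψ (t + h) (z (t + h)) - ψ t (z (t + h)))]
  linarith

end AbsolutelyContinuous

end SweepingProcess

/-! ### Carathéodory differential equations -/

namespace SweepingProcess

section Caratheodory

variable {E : Type*} [NormedAddCommGroup E] [NormedSpace ℝ E]

/-- `z` is `M`-Lipschitz on `[a,b]` and solves `ż = F(t,z)` a.e. on `[a,b]`. -/
def IsLipSolution (F : ℝ → E → E) (M a b : ℝ) (z : ℝ → E) : Prop :=
  (∀ s ∈ Icc a b, ∀ t ∈ Icc a b, ‖z s - z t‖ ≤ M * |s - t|) ∧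
    ∀ᵐ t, t ∈ Ioo a b → HasDerivAt z (F t (z t)) t

theorem IsLipSolution.mono {F : ℝ → E → E} {M a b c d : ℝ} {z : ℝ → E}
    (h : IsLipSolution F M a b z) (hac : a ≤ c) (hdb : d ≤ b) : IsLipSolution F M c d z :=
  ⟨fun s hs t ht => h.1 s (Icc_subset_Icc hac hdb hs) t (Icc_subset_Icc hac hdb ht), by
    filter_upwards [h.2] with t ht hI using ht (Ioo_subset_Ioo hac hdb hI)⟩

theorem IsLipSolution.concat {F : ℝ → E → E} {M a b c : ℝ} {z₁ z₂ : ℝ → E}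
    (h₁ : IsLipSolution F M a b z₁) (h₂ : IsLipSolution F M b c z₂) (hb : z₁ b = z₂ b) :
    IsLipSolution F M a c (fun t => if t ≤ b then z₁ t else z₂ t) := by
  constructor
  · have key : ∀ s ∈ Icc a c, ∀ t ∈ Icc a c, s ≤ t →
        ‖(if s ≤ b then z₁ s else z₂ s) - (if t ≤ b then z₁ t else z₂ t)‖ ≤ M * |s - t| := by
      intro s hs t ht hst
      by_cases htb : t ≤ b
      · rw [if_pos htb, if_pos (hst.trans htb)]
        exact h₁.1 s ⟨hs.1, hst.trans htb⟩ t ⟨ht.1, htb⟩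
      · by_cases hsb : s ≤ b
        · rw [if_neg htb, if_pos hsb]
          push Not at htb
          have e1 := h₁.1 s ⟨hs.1, hsb⟩ b ⟨hs.1.trans hsb, le_rfl⟩
          have e2 := h₂.1 b ⟨le_rfl, htb.le.trans ht.2⟩ t ⟨htb.le, ht.2⟩
          rw [hb] at e1
          have := norm_sub_le_norm_sub_add_norm_sub (z₁ s) (z₂ b) (z₂ t)
          rw [abs_sub_comm, abs_of_nonneg (by linarith)] at e1 e2 ⊢
          nlinarith
        · rw [if_neg htb, if_neg hsb]
          push Not at htb hsb
          exact h₂.1 s ⟨hsb.le, hs.2⟩ t ⟨htb.le, ht.2⟩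
    intro s hs t ht
    rcases le_total s t with h | h
    · exact key s hs t ht h
    · rw [norm_sub_rev, abs_sub_comm]; exact key t ht s hs h
  · have hne : ∀ᵐ t : ℝ, t ≠ b := by simp [ae_iff, measure_singleton]
    filter_upwards [h₁.2, h₂.2, hne] with t ht1 ht2 htb hI
    rcases lt_or_gt_of_ne htb with h | h
    · rw [if_pos h.le]
      refine (ht1 ⟨hI.1, h⟩).congr_of_eventuallyEq ?_
      filter_upwards [Iio_mem_nhds h] with s hs
      rw [if_pos (le_of_lt hs)]
    · rw [if_neg (not_le.2 h)]
      refine (ht2 ⟨h, hI.2⟩).congr_of_eventuallyEq ?_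
      filter_upwards [Ioi_mem_nhds h] with s hs
      rw [if_neg (not_le.2 hs)]

variable [CompleteSpace E]

/-- Local existence for Carathéodory differential equations. -/
theorem exists_lipSolution_local {F : ℝ → E → E} {z₀ : E} {a b R M : ℝ} {ℓ : ℝ → ℝ}
    (hab : a ≤ b) (hM : 0 ≤ M) (hMR : M * (b - a) ≤ R)
    (hbd : ∀ᵐ t, t ∈ Icc a b → ∀ z ∈ closedBall z₀ R, ‖F t z‖ ≤ M)
    (hlip : ∀ᵐ t, t ∈ Icc a b → ∀ z ∈ closedBall z₀ R, ∀ z' ∈ closedBall z₀ R,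
      ‖F t z - F t z'‖ ≤ ℓ t * ‖z - z'‖)
    (hℓ : IntervalIntegrable ℓ volume a b) (hℓ2 : ∫ t in a..b, |ℓ t| ≤ 1 / 2)
    (hmeas : ∀ z : ℝ → E, Continuous z → (∀ t, z t ∈ closedBall z₀ R) →
      AEStronglyMeasurable (fun t => F t (z t)) (volume.restrict (Icc a b))) :
    ∃ z : ℝ → E, z a = z₀ ∧ IsLipSolution F M a b z := by
  have hR : 0 ≤ R := (mul_nonneg hM (by linarith)).trans hMR
  have hint : ∀ z : ℝ → E, Continuous z → (∀ t, z t ∈ closedBall z₀ R) →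
      IntervalIntegrable (fun t => F t (z t)) volume a b := by
    intro z hz hzm
    rw [intervalIntegrable_iff_integrableOn_Icc_of_le hab]
    refine Integrable.of_bound (hmeas z hz hzm) M ?_
    filter_upwards [(ae_restrict_iff' measurableSet_Icc).2 hbd] with t ht using ht _ (hzm t)
  have hsub : ∀ z : ℝ → E, Continuous z → (∀ t, z t ∈ closedBall z₀ R) → ∀ s ∈ Icc a b,
      ∀ t ∈ Icc a b, ‖(∫ τ in a..s, F τ (z τ)) - ∫ τ in a..t, F τ (z τ)‖ ≤ M * |s - t| := by
    intro z hz hzm s hs t ht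
    have hii : ∀ t ∈ Icc a b, IntervalIntegrable (fun t => F t (z t)) volume a t := fun t ht =>
      (hint z hz hzm).mono_set (by
        rw [uIcc_of_le ht.1, uIcc_of_le hab]; exact Icc_subset_Icc le_rfl ht.2)
    rw [intervalIntegral.integral_interval_sub_left (hii s hs) (hii t ht)]
    refine intervalIntegral.norm_integral_le_of_norm_le_const_ae ?_
    filter_upwards [hbd] with τ hτ hI
    refine hτ ?_ _ (hzm τ)
    have := uIoc_subset_uIcc hI
    rw [mem_uIcc] at this
    rcases this with h | h
    · exact ⟨ht.1.trans h.1, h.2.trans hs.2⟩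
    · exact ⟨hs.1.trans h.1, h.2.trans ht.2⟩
  -- Picard's operator acts on the continuous curves with values in the closed ball: the bound M(b −
  -- a) ≤ R makes it map this set to itself, and `hℓ2` gives the contraction factor 1/2.
  let K : Set C(Icc a b, E) := {z | ∀ t, z t ∈ closedBall z₀ R}
  have hKc : IsClosed K := by
    have : K = ⋂ t, (fun z : C(Icc a b, E) => z t) ⁻¹' closedBall z₀ R := by ext; simp [K]
    rw [this]
    exact isClosed_iInter fun t => isClosed_closedBall.preimage (by fun_prop)
  have hext : ∀ z : C(Icc a b, E), Continuous (IccExtend hab z) := fun z => z.continuous.Icc_extend'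
  have hextm : ∀ z ∈ K, ∀ t, IccExtend hab (z : Icc a b → E) t ∈ closedBall z₀ R :=
    fun z hz t => hz _
  have hcont : ∀ z ∈ K, Continuous (fun t : Icc a b =>
      z₀ + ∫ τ in a..(t : ℝ), F τ (IccExtend hab (z : Icc a b → E) τ)) := by
    intro z hz
    refine (LipschitzWith.of_dist_le_mul (K := ⟨M, hM⟩) fun s t => ?_).continuous
    rw [dist_add_left, dist_eq_norm]
    exact hsub _ (hext z) (hextm z hz) s s.2 t t.2
  classical
  -- Outside K the integrand need not be integrable; the value there is a default that plays no
  -- role.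
  let Φ : C(Icc a b, E) → C(Icc a b, E) := fun z =>
    if hz : z ∈ K then ⟨_, hcont z hz⟩ else z
  have hΦ : ∀ z (_ : z ∈ K) (t : Icc a b),
      Φ z t = z₀ + ∫ τ in a..(t : ℝ), F τ (IccExtend hab (z : Icc a b → E) τ) := by
    intro z hz t
    simp only [Φ, dif_pos hz]
    rfl
  have hmaps : MapsTo Φ K K := by
    intro z hz t
    rw [hΦ z hz, mem_closedBall, dist_eq_norm, add_sub_cancel_left]
    have := hsub _ (hext z) (hextm z hz) t t.2 a ⟨le_rfl, hab⟩
    rw [intervalIntegral.integral_same, sub_zero, abs_of_nonneg (by linarith [t.2.1])] at this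
    exact this.trans ((mul_le_mul_of_nonneg_left (by linarith [t.2.2]) hM).trans hMR)
  have hcontr : ContractingWith (1 / 2) (hmaps.restrict Φ K K) := by
    refine ⟨by norm_num, LipschitzWith.of_dist_le_mul fun z z' => ?_⟩
    rw [Subtype.dist_eq, Subtype.dist_eq]
    change dist (Φ z) (Φ z') ≤ _
    rw [ContinuousMap.dist_le (by positivity)]
    intro t
    rw [hΦ _ z.2, hΦ _ z'.2, dist_add_left, dist_eq_norm]
    have hii : ∀ z ∈ K, IntervalIntegrable (fun τ => F τ (IccExtend hab (z : Icc a b → E) τ))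
        volume a t := fun z hz =>
      (hint _ (hext z) (hextm z hz)).mono_set (by
        rw [uIcc_of_le t.2.1, uIcc_of_le hab]; exact Icc_subset_Icc le_rfl t.2.2)
    rw [← intervalIntegral.integral_sub (hii _ z.2) (hii _ z'.2)]
    have hℓi : IntervalIntegrable (fun τ => |ℓ τ| * dist (z : C(Icc a b, E)) z') volume a t :=
      ((hℓ.abs).mono_set (by
        rw [uIcc_of_le t.2.1, uIcc_of_le hab]; exact Icc_subset_Icc le_rfl t.2.2)).mul_const _
    refine (intervalIntegral.norm_integral_le_of_norm_le t.2.1 ?_ hℓi).trans ?_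
    · filter_upwards [hlip] with τ hτ hI
      have hτI : τ ∈ Icc a b := ⟨hI.1.le, hI.2.trans t.2.2⟩
      refine (hτ hτI _ (hextm _ z.2 τ) _ (hextm _ z'.2 τ)).trans ?_
      have h1 : ‖IccExtend hab (z.1 : Icc a b → E) τ - IccExtend hab (z'.1 : Icc a b → E) τ‖
          ≤ dist (z : C(Icc a b, E)) z' := by
        rw [← dist_eq_norm]; exact ContinuousMap.dist_apply_le_dist _
      exact mul_le_mul (le_abs_self _) h1 (norm_nonneg _) (abs_nonneg _)
    · rw [intervalIntegral.integral_mul_const]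
      refine mul_le_mul_of_nonneg_right ?_ dist_nonneg
      have h2 : ∫ τ in a..(t : ℝ), |ℓ τ| ≤ ∫ τ in a..b, |ℓ τ| := by
        refine intervalIntegral.integral_mono_interval le_rfl t.2.1 t.2.2 ?_ hℓ.abs
        exact Eventually.of_forall fun _ => abs_nonneg _
      calc _ ≤ _ := h2.trans hℓ2
        _ = _ := by norm_num
  have hx : ContinuousMap.const (Icc a b) z₀ ∈ K := fun t => mem_closedBall_self hR
  obtain ⟨z, hzK, hfix, -⟩ := hcontr.exists_fixedPoint' hKc.isComplete hmaps hx (edist_ne_top _ _)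
  have heq : ∀ t ∈ Icc a b, IccExtend hab (z : Icc a b → E) t
      = z₀ + ∫ τ in a..t, F τ (IccExtend hab (z : Icc a b → E) τ) := by
    intro t ht
    rw [IccExtend_of_mem hab _ ht, ← hΦ z hzK ⟨t, ht⟩, hfix.eq]
  refine ⟨IccExtend hab z, ?_, ?_, ?_⟩
  · rw [heq a ⟨le_rfl, hab⟩, intervalIntegral.integral_same, add_zero]
  · intro s hs t ht
    rw [heq s hs, heq t ht, add_sub_add_left_eq_sub]
    exact hsub _ (hext z) (hextm z hzK) s hs t ht
  · filter_upwards [(hint _ (hext z) (hextm z hzK)).ae_hasDerivAt_integral] with t ht hI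
    have h1 := (ht (by rw [uIcc_of_le hab]; exact Ioo_subset_Icc_self hI) a (by simp)).const_add z₀
    refine h1.congr_of_eventuallyEq ?_
    filter_upwards [Ioo_mem_nhds hI.1 hI.2] with s hs
    exact heq s (Ioo_subset_Icc_self hs)

/-- Global existence for Carathéodory differential equations: the right-hand side is controlled on
the sets `N t`, and trajectories starting in the sets `A t`, which lie uniformly inside the `N t`,
do not leave them. -/
theorem exists_lipSolution_of_invariant {F : ℝ → E → E} {T : ℝ} (hT : 0 ≤ T) {A N : ℝ → Set E}
    {κ τ M : ℝ} {ℓ : ℝ → ℝ} (hκ : 0 < κ) (hτ : 0 < τ) (hM : 0 ≤ M)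
    (hAN : ∀ t₀ ∈ Icc 0 T, ∀ z₀ ∈ A t₀, ∀ t ∈ Icc 0 T, |t - t₀| ≤ τ → closedBall z₀ κ ⊆ N t)
    (hbd : ∀ᵐ t, t ∈ Icc 0 T → ∀ z ∈ N t, ‖F t z‖ ≤ M)
    (hlip : ∀ᵐ t, t ∈ Icc 0 T → ∀ z ∈ N t, ∀ z' ∈ N t, ‖F t z - F t z'‖ ≤ ℓ t * ‖z - z'‖)
    (hℓ : IntervalIntegrable ℓ volume 0 T)
    (hmeas : ∀ a b, 0 ≤ a → a ≤ b → b ≤ T → ∀ z : ℝ → E, Continuous z →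
      (∀ t ∈ Icc a b, N t ∈ 𝓝 (z t)) →
      AEStronglyMeasurable (fun t => F t (z t)) (volume.restrict (Icc a b)))
    (hinv : ∀ a b, 0 ≤ a → a ≤ b → b ≤ T → ∀ z : ℝ → E, z a ∈ A a →
      IsLipSolution F M a b z → z b ∈ A b)
    {z₀ : E} (hz₀ : z₀ ∈ A 0) :
    ∃ z : ℝ → E, z 0 = z₀ ∧ IsLipSolution F M 0 T z ∧ ∀ t ∈ Icc 0 T, z t ∈ A t := by
  -- a uniform step size
  obtain ⟨η, hη, hηℓ⟩ : ∃ η > 0, ∀ a ∈ Icc 0 T, ∀ b ∈ Icc 0 T, a ≤ b → b - a < η →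
      ∫ t in a..b, |ℓ t| ≤ 1 / 2 := by
    have hu := (hℓ.abs.absolutelyContinuousOnInterval_intervalIntegral
      (c := 0) (by simp)).uniformContinuousOn
    rw [uIcc_of_le hT, Metric.uniformContinuousOn_iff] at hu
    obtain ⟨η, hη, h⟩ := hu (1 / 2) (by norm_num)
    refine ⟨η, hη, fun a ha b hb hab hlt => ?_⟩
    have h1 := h b hb a ha (by rw [Real.dist_eq, abs_of_nonneg (by linarith)]; exact hlt)
    have hii : ∀ t ∈ Icc 0 T, IntervalIntegrable (fun t => |ℓ t|) volume 0 t := fun t ht =>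
      hℓ.abs.mono_set (by rw [uIcc_of_le ht.1, uIcc_of_le hT]; exact Icc_subset_Icc le_rfl ht.2)
    rw [Real.dist_eq, intervalIntegral.integral_interval_sub_left (hii b hb) (hii a ha)] at h1
    exact ((le_abs_self _).trans_lt h1).le
  -- The step is below η, so the local contraction works; below τ, so the ball around the starting
  -- value stays in the sets N t; and small enough that M·h ≤ κ/2, so the local solution does not
  -- leave the half ball.
  set h : ℝ := min (η / 2) (min τ (κ / 2 / (M + 1)))
  have hh : 0 < h := by positivity
  have hhη : h < η := (min_le_left _ _).trans_lt (by linarith)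
  have hhτ : h ≤ τ := (min_le_right _ _).trans (min_le_left _ _)
  have hhM : M * h ≤ κ / 2 := by
    have : h ≤ κ / 2 / (M + 1) := (min_le_right _ _).trans (min_le_right _ _)
    rw [le_div_iff₀ (by linarith)] at this
    nlinarith
  have step : ∀ k : ℕ, ∃ z : ℝ → E, z 0 = z₀ ∧ IsLipSolution F M 0 (min (k * h) T) z := by
    intro k
    induction k with
    | zero =>
      refine ⟨fun _ => z₀, rfl, fun s hs t ht => ?_, ?_⟩
      · simp only [sub_self, norm_zero]; positivity
      · simp [hT]
    | succ k ih =>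
      obtain ⟨z₁, h10, hz1⟩ := ih
      set a := min (k * h) T
      set b := min (((k + 1 : ℕ) : ℝ) * h) T
      have ha0 : 0 ≤ a := le_min (by positivity) hT
      have hab : a ≤ b := min_le_min_right _ (by push_cast; nlinarith)
      have hbT : b ≤ T := min_le_right _ _
      have hba : b - a ≤ h := by
        simp only [a, b]; push_cast
        rcases le_total (k * h) T with h1 | h1
        · rw [min_eq_left h1]; linarith [min_le_left ((k + 1 : ℝ) * h) T]
        · rw [min_eq_right h1]; linarith [min_le_right ((k + 1 : ℝ) * h) T]
      -- Invariance returns the endpoint to A a, so the radius κ is available afresh and the step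
      -- length never shrinks.
      have hzA : z₁ a ∈ A a := hinv 0 a le_rfl ha0 (hab.trans hbT) z₁ (h10 ▸ hz₀) hz1
      have hN : ∀ t ∈ Icc a b, closedBall (z₁ a) κ ⊆ N t := fun t ht =>
        hAN a ⟨ha0, hab.trans hbT⟩ _ hzA t ⟨ha0.trans ht.1, ht.2.trans hbT⟩ (by
          rw [abs_of_nonneg (by linarith [ht.1])]; linarith [ht.2])
      -- The local solution lives in the half ball so that N t is a neighbourhood of its values, as
      -- the measurability hypothesis requires.
      have hN2 : ∀ t ∈ Icc a b, closedBall (z₁ a) (κ / 2) ⊆ N t := fun t ht =>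
        (closedBall_subset_closedBall (by linarith)).trans (hN t ht)
      have hI : ∀ t ∈ Icc a b, t ∈ Icc 0 T := fun t ht => ⟨ha0.trans ht.1, ht.2.trans hbT⟩
      obtain ⟨z₂, h20, hz2⟩ := exists_lipSolution_local (F := F) (z₀ := z₁ a) (R := κ / 2) (ℓ := ℓ)
        hab hM ((mul_le_mul_of_nonneg_left hba hM).trans hhM)
        (by filter_upwards [hbd] with t ht hti z hz using ht (hI t hti) z (hN2 t hti hz))
        (by
          filter_upwards [hlip] with t ht hti z hz z' hz'
          exact ht (hI t hti) z (hN2 t hti hz) z' (hN2 t hti hz'))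
        (hℓ.mono_set (by
          rw [uIcc_of_le hab, uIcc_of_le hT]; exact Icc_subset_Icc ha0 hbT))
        (hηℓ a ⟨ha0, hab.trans hbT⟩ b ⟨ha0.trans hab, hbT⟩ hab (by linarith))
        (fun z hz hzm => hmeas a b ha0 hab hbT z hz fun t ht =>
          mem_of_superset (closedBall_mem_nhds_of_mem (x := z t) (c := z₁ a) (ε := κ) (by
            have := hzm t; rw [mem_closedBall] at this; rw [mem_ball]; linarith)) (hN t ht))
      refine ⟨fun t => if t ≤ a then z₁ t else z₂ t, ?_, hz1.concat hz2 h20.symm⟩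
      simp only [if_pos ha0, h10]
  obtain ⟨k, hk⟩ := exists_nat_ge (T / h)
  obtain ⟨z, hz0, hz⟩ := step k
  rw [min_eq_right (by rwa [div_le_iff₀ hh] at hk)] at hz
  exact ⟨z, hz0, hz, fun t ht => hinv 0 t le_rfl ht.1 ht.2 z (hz0 ▸ hz₀) (hz.mono le_rfl ht.2)⟩

end Caratheodory

end SweepingProcess

/-! ### Measurable selections -/

namespace SweepingProcess

section MeasurableSelection

variable {Ω E : Type*} [MeasurableSpace Ω] {μ : Measure Ω} [MetricSpace E] [CompleteSpace E]
  [SecondCountableTopology E] [MeasurableSpace E] [BorelSpace E]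

/-- The Kuratowski–Ryll-Nardzewski selection theorem for everywhere nonempty closed values. -/
theorem exists_measurable_selection [Nonempty E] {G : Ω → Set E}
    (hne : ∀ t, (G t).Nonempty) (hcl : ∀ t, IsClosed (G t))
    (hm : ∀ O : Set E, IsOpen O → MeasurableSet {t | (G t ∩ O).Nonempty}) :
    ∃ v : Ω → E, Measurable v ∧ ∀ t, v t ∈ G t := by
  classical
  let a : ℕ → E := TopologicalSpace.denseSeq E
  let r : ℕ → ℝ := fun n => (1 / 2) ^ n
  have hr : ∀ n, 0 < r n := fun n => by positivity
  have hdense : ∀ (z : E) (ε : ℝ), 0 < ε → ∃ i, z ∈ ball (a i) ε := by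
    intro z ε hε
    obtain ⟨i, hi⟩ := (TopologicalSpace.denseRange_denseSeq E).exists_dist_lt z hε
    exact ⟨i, hi⟩
  -- successive approximations by points of the dense sequence
  have hstart : ∀ t, ∃ i, (G t ∩ ball (a i) (r 0)).Nonempty := by
    intro t
    obtain ⟨z, hz⟩ := hne t
    obtain ⟨i, hi⟩ := hdense z (r 0) (hr 0)
    exact ⟨i, z, hz, hi⟩
  have hstep : ∀ n t (j : {j : ℕ // (G t ∩ ball (a j) (r n)).Nonempty}),
      ∃ i, (G t ∩ (ball (a i) (r (n + 1)) ∩ ball (a j) (r n))).Nonempty := by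
    rintro n t ⟨j, z, hz, hzj⟩
    obtain ⟨i, hi⟩ := hdense z (r (n + 1)) (hr _)
    exact ⟨i, z, hz, hi, hzj⟩
  -- Taking the least admissible index makes the choice measurable. Successive balls are required to
  -- meet G t in a common point, so their centres form a Cauchy sequence with geometric error.
  let idx : ∀ n t, {j : ℕ // (G t ∩ ball (a j) (r n)).Nonempty} := fun n t =>
    Nat.rec (motive := fun n => {j : ℕ // (G t ∩ ball (a j) (r n)).Nonempty})
      ⟨Nat.find (hstart t), Nat.find_spec (hstart t)⟩
      (fun n j => ⟨Nat.find (hstep n t j),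
        (Nat.find_spec (hstep n t j)).mono fun _ hz => ⟨hz.1, hz.2.1⟩⟩) n
  have hidx : ∀ n t, (G t ∩ (ball (a (idx (n + 1) t).1) (r (n + 1)) ∩
      ball (a (idx n t).1) (r n))).Nonempty := by
    intro n t
    have h := Nat.find_spec (hstep n t (idx n t))
    exact h
  have hmeas : ∀ n, Measurable fun t => (idx n t).1 := by
    intro n
    induction n with
    | zero => exact measurable_find hstart fun k => hm _ isOpen_ball
    | succ n ih =>
      refine measurable_find (fun t => hstep n t (idx n t)) fun k => ?_
      -- The previous centre depends on t, but it takes countably many values on measurable sets,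
      -- which reduces the claim to fixed balls.
      have : {t | (G t ∩ (ball (a k) (r (n + 1)) ∩ ball (a (idx n t).1) (r n))).Nonempty}
          = ⋃ j, ({t | (idx n t).1 = j} ∩
            {t | (G t ∩ (ball (a k) (r (n + 1)) ∩ ball (a j) (r n))).Nonempty}) := by
        ext t; simp
      rw [this]
      exact MeasurableSet.iUnion fun j => (ih (measurableSet_singleton j)).inter
        (hm _ (isOpen_ball.inter isOpen_ball))
  let w : ℕ → Ω → E := fun n t => a (idx n t).1
  have hw : ∀ n, Measurable (w n) := fun n => (measurable_from_nat).comp (hmeas n)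
  have hdist : ∀ t n, dist (w n t) (w (n + 1) t) ≤ 2 * (1 / 2) ^ n := by
    intro t n
    obtain ⟨z, -, h1, h2⟩ := hidx n t
    rw [mem_ball] at h1 h2
    have h3 := dist_triangle_left (w n t) (w (n + 1) t) z
    have h4 : r (n + 1) ≤ r n := by simp only [r, pow_succ]; nlinarith [hr n]
    change _ ≤ 2 * r n
    change dist z (w (n + 1) t) < _ at h1
    change dist z (w n t) < _ at h2
    linarith
  have hlim : ∀ t, ∃ z, Tendsto (fun n => w n t) atTop (𝓝 z) := fun t =>
    cauchySeq_tendsto_of_complete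
      (cauchySeq_of_le_geometric (1 / 2) 2 (by norm_num) (hdist t))
  choose v hv using hlim
  refine ⟨v, measurable_of_tendsto_metrizable hw (tendsto_pi_nhds.2 hv), fun t => ?_⟩
  choose z hz hzb using fun n => (idx n t).2
  refine (hcl t).mem_of_tendsto (f := z) (b := atTop) ?_ (Eventually.of_forall hz)
  refine (hv t).congr_dist (squeeze_zero (fun _ => dist_nonneg)
    (fun n => (by rw [dist_comm]; exact le_of_lt (hzb n) : dist (w n t) (z n) ≤ r n)) ?_)
  exact tendsto_pow_atTop_nhds_zero_of_lt_one (by norm_num) (by norm_num)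

/-- The Kuratowski–Ryll-Nardzewski selection theorem, almost everywhere. -/
theorem exists_aemeasurable_selection [Nonempty E] {G : Ω → Set E}
    (hG : ∀ᵐ t ∂μ, (G t).Nonempty ∧ IsClosed (G t))
    (hm : ∀ O : Set E, IsOpen O → NullMeasurableSet {t | (G t ∩ O).Nonempty} μ) :
    ∃ v : Ω → E, AEMeasurable v μ ∧ ∀ᵐ t ∂μ, v t ∈ G t := by
  classical
  -- On the exceptional null set the values become the whole space, and the everywhere version is
  -- applied over the completed σ-algebra.
  let G' : Ω → Set E := fun t => if (G t).Nonempty ∧ IsClosed (G t) then G t else univ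
  have hGG : ∀ᵐ t ∂μ, G' t = G t := by
    filter_upwards [hG] with t ht
    simp only [G', if_pos ht]
  obtain ⟨v, hv, hvG⟩ := exists_measurable_selection (Ω := NullMeasurableSpace Ω μ) (G := G')
    (fun t => by
      simp only [G']; split_ifs with h
      · exact h.1
      · exact univ_nonempty)
    (fun t => by
      simp only [G']; split_ifs with h
      · exact h.2
      · exact isClosed_univ)
    (fun O hO => by
      change NullMeasurableSet {t : Ω | (G' t ∩ O).Nonempty} μ
      refine (hm O hO).congr ?_
      filter_upwards [hGG] with t ht
      exact propext (by
        change (G t ∩ O).Nonempty ↔ (G' t ∩ O).Nonempty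
        rw [ht]))
  have hv' : NullMeasurable (fun t : Ω => v t) μ := hv
  refine ⟨v, hv'.aemeasurable, ?_⟩
  filter_upwards [hGG] with t ht
  exact ht ▸ hvG t

/-- A Castaing representation: countably many measurable selections that are dense in the values. -/
theorem exists_dense_selections [Nonempty E] {U : Ω → Set E}
    (hU : ∀ᵐ t ∂μ, (U t).Nonempty ∧ IsClosed (U t))
    (hm : ∀ O : Set E, IsOpen O → NullMeasurableSet {t | (U t ∩ O).Nonempty} μ) :
    ∃ v : ℕ → Ω → E, (∀ j, AEMeasurable (v j) μ ∧ ∀ᵐ t ∂μ, v j t ∈ U t) ∧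
      ∀ᵐ t ∂μ, ∀ z ∈ U t, ∀ ε > 0, ∃ j, dist (v j t) z < ε := by
  classical
  let a : ℕ → E := TopologicalSpace.denseSeq E
  have key : ∀ p : ℕ × ℕ, ∃ v : Ω → E, AEMeasurable v μ ∧ (∀ᵐ t ∂μ, v t ∈ U t) ∧
      ∀ᵐ t ∂μ, (U t ∩ ball (a p.1) (1 / (p.2 + 1))).Nonempty →
        v t ∈ closedBall (a p.1) (1 / (p.2 + 1)) := by
    intro p
    set B := ball (a p.1) (1 / ((p.2 : ℝ) + 1))
    -- For each ball of a countable base, select from the part of U t in that ball when there is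
    -- one. Taking the closure keeps the values closed without changing which open sets they meet.
    let G : Ω → Set E := fun t => if (U t ∩ B).Nonempty then closure (U t ∩ B) else U t
    obtain ⟨v, hv, hvG⟩ := exists_aemeasurable_selection (μ := μ) (G := G)
      (by
        filter_upwards [hU] with t ht
        simp only [G]; split_ifs with h
        · exact ⟨h.closure, isClosed_closure⟩
        · exact ht)
      (fun O hO => by
        have : {t | (G t ∩ O).Nonempty} = {t | (U t ∩ (B ∩ O)).Nonempty} ∪
            ({t | (U t ∩ B).Nonempty}ᶜ ∩ {t | (U t ∩ O).Nonempty}) := by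
          ext t
          by_cases h : (U t ∩ B).Nonempty
          · simp only [mem_ofPred_eq, G, ↓reduceIte, mem_union, mem_inter_iff, mem_compl_iff, h,
              not_true_eq_false, false_and, or_false]
            rw [closure_inter_open_nonempty_iff hO, inter_assoc]
          · have h' : ¬ (U t ∩ (B ∩ O)).Nonempty := fun hh =>
              h (hh.mono fun z hz => ⟨hz.1, hz.2.1⟩)
            simp only [mem_ofPred_eq, G, ↓reduceIte, mem_union, mem_inter_iff, mem_compl_iff, h, h',
              not_false_eq_true, true_and, false_or]
        rw [this]
        exact (hm _ (isOpen_ball.inter hO)).union ((hm _ isOpen_ball).compl.inter (hm _ hO)))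
    refine ⟨v, hv, ?_, ?_⟩
    · filter_upwards [hvG, hU] with t ht hUt
      simp only [G] at ht
      split_ifs at ht with h
      · exact closure_minimal inter_subset_left hUt.2 ht
      · exact ht
    · filter_upwards [hvG] with t ht h
      simp only [G, if_pos h] at ht
      exact closure_minimal (inter_subset_right.trans ball_subset_closedBall) isClosed_closedBall ht
  choose v hv hvU hvB using key
  refine ⟨fun j => v (Nat.unpair j), fun j => ⟨hv _, hvU _⟩, ?_⟩
  filter_upwards [ae_all_iff.2 hvB] with t ht z hz ε hε
  obtain ⟨n, hn⟩ := exists_nat_one_div_lt (half_pos hε)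
  obtain ⟨i, hi⟩ := (TopologicalSpace.denseRange_denseSeq E).exists_dist_lt z
    (Nat.one_div_pos_of_nat (n := n) (α := ℝ))
  refine ⟨Nat.pair i n, ?_⟩
  rw [Nat.unpair_pair]
  have h1 : dist (v (i, n) t) (a i) ≤ 1 / (n + 1) := ht (i, n) ⟨z, hz, hi⟩
  have h2 : dist z (a i) < 1 / (n + 1) := hi
  have := dist_triangle_right (v (i, n) t) z (a i)
  linarith

/-- Filippov's implicit function lemma. -/
theorem exists_measurable_implicit_selection [Nonempty E] {F : Type*} [MetricSpace F]
    [SecondCountableTopology F] [MeasurableSpace F] [BorelSpace F]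
    {U : Ω → Set E} {H : Ω → E → F} {w : Ω → F}
    (hU : ∀ᵐ t ∂μ, (U t).Nonempty ∧ IsCompact (U t))
    (hm : ∀ O : Set E, IsOpen O → NullMeasurableSet {t | (U t ∩ O).Nonempty} μ)
    (hH : ∀ᵐ t ∂μ, ContinuousOn (H t) (U t))
    (hHm : ∀ v : Ω → E, AEMeasurable v μ → (∀ᵐ t ∂μ, v t ∈ U t) →
      AEMeasurable (fun t => H t (v t)) μ)
    (hw : AEMeasurable w μ) (hwH : ∀ᵐ t ∂μ, w t ∈ H t '' U t) :
    ∃ v : Ω → E, AEMeasurable v μ ∧ ∀ᵐ t ∂μ, v t ∈ U t ∧ H t (v t) = w t := by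
  obtain ⟨v, hv, hvd⟩ := exists_dense_selections
    (hU.mono fun t ht => ⟨ht.1, ht.2.isClosed⟩) hm
  let G : Ω → Set E := fun t => {z ∈ U t | H t z = w t}
  have hclosed : ∀ (c : E) (ρ : ℝ), NullMeasurableSet {t | (G t ∩ closedBall c ρ).Nonempty} μ := by
    intro c ρ
    have hset : NullMeasurableSet (⋂ n : ℕ, ⋃ j, {t | dist (v j t) c < ρ + 1 / (n + 1) ∧
        -- An exact solution in the ball exists if and only if the dense selections contain
        -- approximate solutions approximately in the ball, to every accuracy 1/(n+1). Compactness
        -- of U t turns approximate solutions into exact ones; continuity and density give the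
        -- converse.
        dist (H t (v j t)) (w t) < 1 / (n + 1)}) μ := by
      refine NullMeasurableSet.iInter fun n => NullMeasurableSet.iUnion fun j => ?_
      have h1 : AEMeasurable (fun t => dist (v j t) c) μ := (hv j).1.dist aemeasurable_const
      have h2 : AEMeasurable (fun t => dist (H t (v j t)) (w t)) μ :=
        (hHm _ (hv j).1 (hv j).2).dist hw
      exact (nullMeasurableSet_lt h1 aemeasurable_const).inter
        (nullMeasurableSet_lt h2 aemeasurable_const)
    refine hset.congr ?_
    filter_upwards [hU, hH, hvd, ae_all_iff.2 fun j => (hv j).2] with t hUt hHt hvt hvU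
    refine propext ?_
    change t ∈ (⋂ n : ℕ, ⋃ j, {t | dist (v j t) c < ρ + 1 / (n + 1) ∧
        dist (H t (v j t)) (w t) < 1 / (n + 1)}) ↔ (G t ∩ closedBall c ρ).Nonempty
    simp only [mem_iInter, mem_iUnion, mem_ofPred_eq]
    constructor
    · intro h
      choose j hj1 hj2 using h
      obtain ⟨z, hzU, φ, hφ, hz⟩ := hUt.2.tendsto_subseq fun n => hvU (j n)
      have h0 := (tendsto_one_div_add_atTop_nhds_zero_nat (𝕜 := ℝ)).comp hφ.tendsto_atTop
      have hHz : Tendsto (fun n => H t (v (j (φ n)) t)) atTop (𝓝 (H t z)) :=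
        (hHt z hzU).tendsto.comp (tendsto_nhdsWithin_iff.2
          ⟨hz, Eventually.of_forall fun n => hvU _⟩)
      refine ⟨z, ⟨hzU, ?_⟩, ?_⟩
      · have h1 := hHz.dist (tendsto_const_nhds (x := w t))
        have h2 : dist (H t z) (w t) ≤ 0 := le_of_tendsto_of_tendsto' h1 h0 fun n =>
          (hj2 (φ n)).le
        exact dist_le_zero.1 h2
      · have h1 := hz.dist (tendsto_const_nhds (x := c))
        have h2 : dist z c ≤ ρ + 0 := le_of_tendsto_of_tendsto' h1 (h0.const_add ρ) fun n =>
          (hj1 (φ n)).le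
        rwa [add_zero] at h2
    · rintro ⟨z, ⟨hzU, hzw⟩, hzc⟩ n
      have hpos : (0 : ℝ) < 1 / (n + 1) := Nat.one_div_pos_of_nat
      obtain ⟨ε, hε, hHε⟩ := Metric.continuousWithinAt_iff.1 (hHt z hzU) _ hpos
      obtain ⟨j, hj⟩ := hvt z hzU (min ε (1 / (n + 1))) (lt_min hε hpos)
      refine ⟨j, ?_, ?_⟩
      · have := dist_triangle (v j t) z c
        have h2 := hj.trans_le (min_le_right _ _)
        rw [mem_closedBall] at hzc
        linarith
      · rw [← hzw]
        exact hHε (hvU j) (hj.trans_le (min_le_left _ _))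
  obtain ⟨u, hu, huG⟩ := exists_aemeasurable_selection (μ := μ) (G := G)
    (by
      filter_upwards [hU, hH, hwH] with t hUt hHt hwt
      obtain ⟨z, hz, hzw⟩ := hwt
      exact ⟨⟨z, hz, hzw⟩, hHt.preimage_isClosed_of_isClosed hUt.2.isClosed isClosed_singleton⟩)
    (fun O hO => by
      let a : ℕ → E := TopologicalSpace.denseSeq E
      let I : Set (ℕ × ℕ) := {p | closedBall (a p.1) (1 / ((p.2 : ℝ) + 1)) ⊆ O}
      -- An open set is a countable union of closed balls with centres in a dense sequence and radii
      -- 1/(n+1).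
      have : {t | (G t ∩ O).Nonempty} = ⋃ p ∈ I,
          {t | (G t ∩ closedBall (a p.1) (1 / ((p.2 : ℝ) + 1))).Nonempty} := by
        ext t
        simp only [mem_ofPred_eq, mem_iUnion, exists_prop]
        constructor
        · rintro ⟨z, hzG, hzO⟩
          obtain ⟨ε, hε, hb⟩ := Metric.isOpen_iff.1 hO z hzO
          obtain ⟨n, hn⟩ := exists_nat_one_div_lt (half_pos hε)
          obtain ⟨i, hi⟩ := (TopologicalSpace.denseRange_denseSeq E).exists_dist_lt z
            (Nat.one_div_pos_of_nat (n := n) (α := ℝ))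
          refine ⟨(i, n), fun y hy => hb ?_, z, hzG, hi.le⟩
          have h1 : dist y (a i) ≤ 1 / (n + 1) := hy
          have := dist_triangle_right y z (a i)
          have h2 : dist z (a i) < 1 / (n + 1) := hi
          rw [mem_ball]; linarith
        · rintro ⟨p, hp, hne⟩
          exact hne.mono fun z hz => ⟨hz.1, hp hz.2⟩
      rw [this]
      exact NullMeasurableSet.biUnion (to_countable I) fun p _ => hclosed _ _)
  exact ⟨u, hu, huG⟩

end MeasurableSelection

end SweepingProcess

/-! ### Weak* convergence in L^∞ -/

namespace SweepingProcess

section WeakStar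

variable {F : Type*} [NormedAddCommGroup F] [InnerProductSpace ℝ F] {T M : ℝ}

instance isFiniteMeasure_leb (T : ℝ) : IsFiniteMeasure (leb T) := by
  unfold leb; infer_instance

/-- `v` is measurable and a.e. bounded by `M` on `[0,T]`. -/
def EssBdd (T M : ℝ) (v : ℝ → F) : Prop :=
  AEStronglyMeasurable v (leb T) ∧ ∀ᵐ t ∂(leb T), ‖v t‖ ≤ M

theorem EssBdd.mono {v : ℝ → F} {M' : ℝ} (h : EssBdd T M v) (hM : M ≤ M') : EssBdd T M' v :=
  ⟨h.1, h.2.mono fun _ ht => ht.trans hM⟩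

theorem EssBdd.memLp {v : ℝ → F} (h : EssBdd T M v) (p : ENNReal) : MemLp v p (leb T) :=
  MemLp.of_bound h.1 M h.2

theorem EssBdd.integrable_inner {v p : ℝ → F} (h : EssBdd T M v) (hp : Integrable p (leb T)) :
    Integrable (fun t => inner ℝ (p t) (v t)) (leb T) := by
  refine (hp.norm.mul_const M).mono' (hp.1.inner h.1) ?_
  filter_upwards [h.2] with t ht
  exact (norm_inner_le_norm _ _).trans (mul_le_mul_of_nonneg_left ht (norm_nonneg _))

theorem EssBdd.add {v w : ℝ → F} {M' : ℝ} (hv : EssBdd T M v) (hw : EssBdd T M' w) :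
    EssBdd T (M + M') (fun t => v t + w t) :=
  ⟨hv.1.add hw.1, by filter_upwards [hv.2, hw.2] with t h1 h2 using norm_add_le_of_le h1 h2⟩

theorem EssBdd.sub {v w : ℝ → F} {M' : ℝ} (hv : EssBdd T M v) (hw : EssBdd T M' w) :
    EssBdd T (M + M') (fun t => v t - w t) :=
  ⟨hv.1.sub hw.1, by filter_upwards [hv.2, hw.2] with t h1 h2 using norm_sub_le_of_le h1 h2⟩

theorem EssBdd.smul {v : ℝ → F} {a : ℝ → ℝ} {M' : ℝ} (hM' : 0 ≤ M') (ha : EssBdd T M' a)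
    (hv : EssBdd T M v) : EssBdd T (M' * M) (fun t => a t • v t) :=
  ⟨ha.1.smul hv.1, by
    filter_upwards [ha.2, hv.2] with t h1 h2
    rw [norm_smul]; exact mul_le_mul h1 h2 (norm_nonneg _) hM'⟩

theorem EssBdd.sum {ι : Type*} {v : ι → ℝ → F} (s : Finset ι)
    (hv : ∀ i ∈ s, EssBdd T M (v i)) : EssBdd T (s.card * M) (fun t => ∑ i ∈ s, v i t) := by
  constructor
  · have := Finset.aestronglyMeasurable_sum s fun i hi => (hv i hi).1
    simpa [Finset.sum_fn] using this
  · have : ∀ᵐ t ∂(leb T), ∀ i ∈ s, ‖v i t‖ ≤ M := by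
      rw [Filter.eventually_all_finset]; exact fun i hi => (hv i hi).2
    filter_upwards [this] with t ht
    calc ‖∑ i ∈ s, v i t‖ ≤ ∑ i ∈ s, ‖v i t‖ := norm_sum_le _ _
      _ ≤ ∑ _i ∈ s, M := Finset.sum_le_sum ht
      _ = _ := by simp

theorem WeakStarTendsto.comp {v : ℕ → ℝ → F} {w : ℝ → F} (h : WeakStarTendsto T v w)
    {σ : ℕ → ℕ} (hσ : StrictMono σ) : WeakStarTendsto T (fun k => v (σ k)) w :=
  fun p hp => (h p hp).comp hσ.tendsto_atTop

theorem WeakStarTendsto.congr {v v' : ℕ → ℝ → F} {w w' : ℝ → F} (h : WeakStarTendsto T v w)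
    (hv : ∀ᶠ k in atTop, v k =ᵐ[leb T] v' k) (hw : w =ᵐ[leb T] w') : WeakStarTendsto T v' w' := by
  intro p hp
  have h1 : ∫ t, inner ℝ (p t) (w t) ∂(leb T) = ∫ t, inner ℝ (p t) (w' t) ∂(leb T) :=
    integral_congr_ae (by filter_upwards [hw] with t ht; rw [ht])
  rw [← h1]
  refine (h p hp).congr' ?_
  filter_upwards [hv] with k hk
  exact integral_congr_ae (by filter_upwards [hk] with t ht; rw [ht])

/-- Weak* limits are not affected by perturbations that converge to zero boundedly a.e. -/
theorem WeakStarTendsto.perturb {v v' : ℕ → ℝ → F} {w : ℝ → F} (h : WeakStarTendsto T v w)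
    (hv : ∀ k, EssBdd T M (v k)) (hv' : ∀ k, EssBdd T M (v' k))
    (hlim : ∀ᵐ t ∂(leb T), Tendsto (fun k => v' k t - v k t) atTop (𝓝 0)) :
    WeakStarTendsto T v' w := by
  intro p hp
  have h1 : Tendsto (fun k => ∫ t, inner ℝ (p t) (v' k t - v k t) ∂(leb T)) atTop
      (𝓝 (∫ _t, (0 : ℝ) ∂(leb T))) := by
    refine tendsto_integral_of_dominated_convergence (fun t => ‖p t‖ * (M + M)) ?_ ?_ ?_ ?_
    · exact fun k => (((hv' k).sub (hv k)).integrable_inner hp).1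
    · exact hp.norm.mul_const _
    · intro k
      filter_upwards [((hv' k).sub (hv k)).2] with t ht
      exact (norm_inner_le_norm _ _).trans (mul_le_mul_of_nonneg_left ht (norm_nonneg _))
    · filter_upwards [hlim] with t ht
      have := (tendsto_const_nhds (x := p t)).inner (𝕜 := ℝ) ht
      rwa [inner_zero_right] at this
  have h2 := (h p hp).add h1
  rw [integral_zero, add_zero] at h2
  refine h2.congr fun k => ?_
  rw [← integral_add ((hv k).integrable_inner hp)
    (((hv' k).sub (hv k)).integrable_inner hp)]
  refine integral_congr_ae (Eventually.of_forall fun t => ?_)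
  simp only [inner_sub_right]
  ring

theorem weakStarTendsto_const (w : ℝ → F) : WeakStarTendsto T (fun _ => w) w :=
  fun _ _ => tendsto_const_nhds

theorem WeakStarTendsto.add {v v' : ℕ → ℝ → F} {w w' : ℝ → F} {M' : ℝ}
    (h : WeakStarTendsto T v w) (h' : WeakStarTendsto T v' w')
    (hv : ∀ k, EssBdd T M (v k)) (hv' : ∀ k, EssBdd T M (v' k))
    (hw : EssBdd T M' w) (hw' : EssBdd T M' w') :
    WeakStarTendsto T (fun k t => v k t + v' k t) (fun t => w t + w' t) := by
  intro p hp
  have := (h p hp).add (h' p hp)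
  simp only [inner_add_right]
  rw [integral_add (hw.integrable_inner hp) (hw'.integrable_inner hp)]
  refine this.congr fun k => ?_
  rw [integral_add ((hv k).integrable_inner hp) ((hv' k).integrable_inner hp)]

theorem WeakStarTendsto.sum {ι : Type*} {v : ι → ℕ → ℝ → F} {w : ι → ℝ → F} {M' : ℝ}
    (s : Finset ι) (h : ∀ i, WeakStarTendsto T (v i) (w i))
    (hv : ∀ i k, EssBdd T M (v i k)) (hw : ∀ i, EssBdd T M' (w i)) :
    WeakStarTendsto T (fun k t => ∑ i ∈ s, v i k t) (fun t => ∑ i ∈ s, w i t) := by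
  intro p hp
  simp only [inner_sum]
  rw [integral_finsetSum _ fun i _ => (hw i).integrable_inner hp]
  refine (tendsto_finsetSum s fun i _ => h i p hp).congr fun k => ?_
  rw [integral_finsetSum _ fun i _ => (hv i k).integrable_inner hp]

/-- The product of a weak* convergent sequence and a boundedly convergent one. -/
theorem WeakStarTendsto.smul {ξ : ℕ → ℝ → ℝ} {ξ' : ℝ → ℝ} {G : ℕ → ℝ → F} {G' : ℝ → F} {M' : ℝ}
    (hM : 0 ≤ M) (h : WeakStarTendsto T ξ ξ') (hξ : ∀ k, EssBdd T M (ξ k))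
    (hG : ∀ k, EssBdd T M' (G k)) (hG' : EssBdd T M' G')
    (hlim : ∀ᵐ t ∂(leb T), Tendsto (fun k => G k t) atTop (𝓝 (G' t))) :
    WeakStarTendsto T (fun k t => ξ k t • G k t) (fun t => ξ' t • G' t) := by
  -- With the limit factor G' frozen, it can be moved onto the test function; replacing G' by G k is
  -- then a perturbation tending to zero boundedly a.e.
  have h1 : WeakStarTendsto T (fun k t => ξ k t • G' t) (fun t => ξ' t • G' t) := by
    intro p hp
    have := h (fun t => inner ℝ (p t) (G' t)) (hG'.integrable_inner hp)
    simpa [inner_smul_right, mul_comm] using this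
  refine h1.perturb (fun k => (hξ k).smul hM hG') (fun k => (hξ k).smul hM (hG k)) ?_
  filter_upwards [hlim, ae_all_iff.2 fun k => (hξ k).2] with t ht hb
  rw [← tendsto_sub_nhds_zero_iff, tendsto_zero_iff_norm_tendsto_zero] at ht
  refine squeeze_zero_norm (a := fun k => M * ‖G k t - G' t‖) (fun k => ?_) ?_
  · rw [← smul_sub, norm_smul]
    exact mul_le_mul_of_nonneg_right (hb k) (norm_nonneg _)
  · simpa using ht.const_mul M

/-- Uniqueness of weak* limits. -/
theorem WeakStarTendsto.unique {v : ℕ → ℝ → F} {w w' : ℝ → F} {M' : ℝ}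
    (h : WeakStarTendsto T v w) (h' : WeakStarTendsto T v w') (hw : EssBdd T M w)
    (hw' : EssBdd T M' w') : w =ᵐ[leb T] w' := by
  have hd := hw.sub hw'
  -- The difference of the two limits is bounded, hence an admissible test function against itself.
  have hp : Integrable (fun t => w t - w' t) (leb T) := (hd.memLp 1).integrable le_rfl
  have e := tendsto_nhds_unique (h _ hp) (h' _ hp)
  have e2 : ∫ t, inner ℝ (w t - w' t) (w t - w' t) ∂(leb T) = 0 := by
    simp_rw [inner_sub_right]
    have := integral_sub (hw.integrable_inner hp) (hw'.integrable_inner hp)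
    rw [e, sub_self] at this
    simpa only [inner_sub_right] using this
  rw [integral_eq_zero_iff_of_nonneg (fun t => real_inner_self_nonneg)
    (hd.integrable_inner hp)] at e2
  filter_upwards [e2] with t ht
  exact sub_eq_zero.1 (inner_self_eq_zero.1 ht)

/-- Truncation at height j and dominated convergence; bounded functions are also in L², which links
L¹ tests to the Hilbert space setting. -/
theorem exists_essBdd_approx {p : ℝ → F} (hp : Integrable p (leb T)) :
    ∃ q : ℕ → ℝ → F, (∀ j : ℕ, EssBdd T j (q j)) ∧
      Tendsto (fun j => ∫ t, ‖p t - q j t‖ ∂(leb T)) atTop (𝓝 0) := by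
  obtain ⟨p', hp', hpp'⟩ := hp.1
  let S : ℕ → Set ℝ := fun j => {t | ‖p' t‖ ≤ j}
  have hS : ∀ j, MeasurableSet (S j) := fun j =>
    measurableSet_le hp'.norm.measurable measurable_const
  refine ⟨fun j => (S j).indicator p', fun j => ⟨(hp'.indicator (hS j)).aestronglyMeasurable,
    Eventually.of_forall fun t => ?_⟩, ?_⟩
  · change ‖(S j).indicator p' t‖ ≤ j
    by_cases h : t ∈ S j
    · rw [indicator_of_mem h]; exact h
    · rw [indicator_of_notMem h, norm_zero]; positivity
  · have h0 : Tendsto (fun j => ∫ t, ‖p t - (S j).indicator p' t‖ ∂(leb T)) atTop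
        (𝓝 (∫ _t, (0 : ℝ) ∂(leb T))) := by
      refine tendsto_integral_of_dominated_convergence (fun t => ‖p t‖) ?_ hp.norm ?_ ?_
      · exact fun j => (hp.1.sub (hp'.indicator (hS j)).aestronglyMeasurable).norm
      · intro j
        filter_upwards [hpp'] with t ht
        rw [norm_norm, ht]
        by_cases h : t ∈ S j
        · rw [indicator_of_mem h, sub_self, norm_zero]; exact norm_nonneg _
        · rw [indicator_of_notMem h, sub_zero]
      · filter_upwards [hpp'] with t ht
        obtain ⟨n, hn⟩ := exists_nat_ge ‖p' t‖
        refine tendsto_const_nhds.congr' ?_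
        filter_upwards [eventually_ge_atTop n] with j hj
        have : t ∈ S j := hn.trans (by exact_mod_cast hj)
        rw [indicator_of_mem this, ht, sub_self, norm_zero]
    simpa using h0

/-- For bounded sequences it suffices to test weak* convergence against `L²` functions. -/
theorem weakStarTendsto_of_memLp_two {v : ℕ → ℝ → F} {w : ℝ → F}
    (hv : ∀ k, EssBdd T M (v k)) (hw : EssBdd T M w)
    (h : ∀ p : ℝ → F, MemLp p 2 (leb T) →
      Tendsto (fun k => ∫ t, inner ℝ (p t) (v k t) ∂(leb T)) atTop
        (𝓝 (∫ t, inner ℝ (p t) (w t) ∂(leb T)))) : WeakStarTendsto T v w := by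
  intro p hp
  obtain ⟨q, hq, hlim⟩ := exists_essBdd_approx hp
  have hqi : ∀ j, Integrable (q j) (leb T) := fun j => ((hq j).memLp 1).integrable le_rfl
  -- The error of replacing p by its truncation is uniform over all functions bounded by M, so j can
  -- be fixed before k.
  have hest : ∀ (z : ℝ → F), EssBdd T M z → ∀ j,
      ‖(∫ t, inner ℝ (p t) (z t) ∂(leb T)) - ∫ t, inner ℝ (q j t) (z t) ∂(leb T)‖
        ≤ |M| * ∫ t, ‖p t - q j t‖ ∂(leb T) := by
    intro z hz j
    rw [← integral_sub (hz.integrable_inner hp) (hz.integrable_inner (hqi j)),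
      ← integral_const_mul]
    refine norm_integral_le_of_norm_le ((hp.sub (hqi j)).norm.const_mul _) ?_
    filter_upwards [hz.2] with t ht
    rw [← inner_sub_left, mul_comm]
    exact (norm_inner_le_norm _ _).trans
      (mul_le_mul_of_nonneg_left (ht.trans (le_abs_self M)) (norm_nonneg _))
  rw [Metric.tendsto_atTop]
  intro ε hε
  have hlim' := hlim.const_mul |M|
  rw [mul_zero] at hlim'
  obtain ⟨j, hj⟩ := (hlim'.eventually (gt_mem_nhds (show (0 : ℝ) < ε / 3 by positivity))).exists
  obtain ⟨n, hn⟩ := Metric.tendsto_atTop.1 (h (q j) ((hq j).memLp 2)) (ε / 3) (by positivity)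
  refine ⟨n, fun k hk => ?_⟩
  have h1 := hest (v k) (hv k) j
  have h2 := hest w hw j
  have h3 := hn k hk
  rw [Real.dist_eq] at h3 ⊢
  rw [Real.norm_eq_abs, abs_le] at h1 h2
  rw [abs_lt] at h3 ⊢
  constructor <;> linarith [h1.1, h1.2, h2.1, h2.2, h3.1, h3.2]

variable [CompleteSpace F]

/-- Pointwise constraints with closed convex values pass to weak limits. -/
theorem mem_of_weak_limit {v : ℕ → ℝ → F} {w : ℝ → F} {Q : ℝ → Set F}
    (hv : ∀ k, MemLp (v k) 2 (leb T)) (hw : MemLp w 2 (leb T))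
    (h : ∀ p : ℝ → F, MemLp p 2 (leb T) →
      Tendsto (fun k => ∫ t, inner ℝ (p t) (v k t) ∂(leb T)) atTop
        (𝓝 (∫ t, inner ℝ (p t) (w t) ∂(leb T))))
    (hQ : ∀ᵐ t ∂(leb T), Convex ℝ (Q t) ∧ IsClosed (Q t))
    (hvQ : ∀ k, ∀ᵐ t ∂(leb T), v k t ∈ Q t) : ∀ᵐ t ∂(leb T), w t ∈ Q t := by
  -- The functions satisfying the constraint form a convex set, closed in L² because norm
  -- convergence yields an a.e. convergent subsequence. A point outside would be strictly separated
  -- from it by an L² function, against the weak convergence.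
  let K : Set (Lp F 2 (leb T)) := {z | ∀ᵐ t ∂(leb T), z t ∈ Q t}
  have hKconv : Convex ℝ K := by
    intro z hz z' hz' a b ha hb hab
    change ∀ᵐ t ∂(leb T), _ ∈ Q t
    filter_upwards [hz, hz', hQ, Lp.coeFn_add (a • z) (b • z'), Lp.coeFn_smul a z,
      Lp.coeFn_smul b z'] with t h1 h2 h3 h4 h5 h6
    rw [h4, Pi.add_apply, h5, h6]
    exact h3.1 h1 h2 ha hb hab
  have hKcl : IsClosed K := by
    refine isSeqClosed_iff_isClosed.1 fun z z' hz hlim => ?_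
    obtain ⟨ns, -, hns⟩ := (tendstoInMeasure_of_tendsto_Lp hlim).exists_seq_tendsto_ae
    change ∀ᵐ t ∂(leb T), _ ∈ Q t
    filter_upwards [hns, hQ, ae_all_iff.2 hz] with t h1 h2 h3
    exact h2.2.mem_of_tendsto h1 (Eventually.of_forall fun n => h3 _)
  have hwK : hw.toLp w ∈ K := by
    by_contra hcon
    obtain ⟨φ, c, hc, hφ⟩ := geometric_hahn_banach_point_closed hKconv hKcl hcon
    obtain ⟨p, rfl⟩ := (InnerProductSpace.toDual ℝ (Lp F 2 (leb T))).surjective φ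
    have hin : ∀ {z : ℝ → F} (hz : MemLp z 2 (leb T)),
        InnerProductSpace.toDual ℝ (Lp F 2 (leb T)) p (hz.toLp z)
          = ∫ t, inner ℝ (p t) (z t) ∂(leb T) := by
      intro z hz
      rw [InnerProductSpace.toDual_apply_apply, L2.inner_def]
      refine integral_congr_ae ?_
      filter_upwards [hz.coeFn_toLp] with t ht
      rw [ht]
    rw [hin hw] at hc
    have hge : c ≤ ∫ t, inner ℝ (p t) (w t) ∂(leb T) := by
      refine ge_of_tendsto' (h p (Lp.memLp p)) fun k => ?_
      rw [← hin (hv k)]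
      refine (hφ _ ?_).le
      change ∀ᵐ t ∂(leb T), _ ∈ Q t
      filter_upwards [(hv k).coeFn_toLp, hvQ k] with t h1 h2
      rwa [h1]
    exact absurd hc (not_lt.2 hge)
  filter_upwards [hw.coeFn_toLp, hwK] with t h1 h2
  rwa [← h1]

theorem WeakStarTendsto.mem_convex {v : ℕ → ℝ → F} {w : ℝ → F} {Q : ℝ → Set F} {M' : ℝ}
    (h : WeakStarTendsto T v w) (hv : ∀ k, EssBdd T M (v k)) (hw : EssBdd T M' w)
    (hQ : ∀ᵐ t ∂(leb T), Convex ℝ (Q t) ∧ IsClosed (Q t))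
    (hvQ : ∀ k, ∀ᵐ t ∂(leb T), v k t ∈ Q t) : ∀ᵐ t ∂(leb T), w t ∈ Q t :=
  mem_of_weak_limit (fun k => (hv k).memLp 2) (hw.memLp 2)
    (fun p hp => h p (hp.integrable (by norm_num))) hQ hvQ

/-- Bounded sequences in `L^∞([0,T])` have weak* convergent subsequences. -/
theorem exists_weakStarTendsto_subseq [SecondCountableTopology F] {v : ℕ → ℝ → F}
    (hM : 0 ≤ M) (hv : ∀ k, EssBdd T M (v k)) :
    ∃ (σ : ℕ → ℕ) (w : ℝ → F), StrictMono σ ∧ EssBdd T M w ∧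
      WeakStarTendsto T (fun k => v (σ k)) w := by
  have hv2 := fun k => (hv k).memLp 2
  let V : ℕ → Lp F 2 (leb T) := fun k => (hv2 k).toLp (v k)
  obtain ⟨R, hR⟩ : ∃ R, ∀ k, ‖V k‖ ≤ R := by
    refine ⟨_, fun k => Lp.norm_le_of_ae_bound hM ?_⟩
    filter_upwards [(hv2 k).coeFn_toLp, (hv k).2] with t h1 h2
    rwa [h1]
  -- A bounded sequence in L^∞ is bounded in the separable Hilbert space L², where the sequential
  -- Banach–Alaoglu theorem applies. The L^∞ bound of the limit is recovered as a closed convex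
  -- pointwise constraint.
  let φ : ℕ → WeakDual ℝ (Lp F 2 (leb T)) := fun k =>
    StrongDual.toWeakDual (InnerProductSpace.toDual ℝ (Lp F 2 (leb T)) (V k))
  have : Fact ((2 : ENNReal) ≠ ⊤) := ⟨by norm_num⟩
  obtain ⟨φ₀, -, σ, hσ, hlim⟩ := WeakDual.isSeqCompact_closedBall ℝ (Lp F 2 (leb T)) 0 R
    (x := φ) (fun k => by
      change InnerProductSpace.toDual ℝ (Lp F 2 (leb T)) (V k) ∈ closedBall 0 R
      rw [mem_closedBall_zero_iff, LinearIsometryEquiv.norm_map]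
      exact hR k)
  obtain ⟨w, hw⟩ := (InnerProductSpace.toDual ℝ (Lp F 2 (leb T))).surjective
    (WeakDual.toStrongDual φ₀)
  have hw2 : MemLp w 2 (leb T) := Lp.memLp w
  have htest : ∀ p : ℝ → F, MemLp p 2 (leb T) →
      Tendsto (fun k => ∫ t, inner ℝ (p t) (v (σ k) t) ∂(leb T)) atTop
        (𝓝 (∫ t, inner ℝ (p t) (w t) ∂(leb T))) := by
    intro p hp
    have h1 : Tendsto (fun k => (φ (σ k)) (hp.toLp p)) atTop (𝓝 (φ₀ (hp.toLp p))) :=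
      ((WeakDual.eval_continuous (𝕜 := ℝ) (hp.toLp p)).tendsto φ₀).comp hlim
    have h2 : φ₀ (hp.toLp p) = ∫ t, inner ℝ (p t) (w t) ∂(leb T) := by
      change (WeakDual.toStrongDual φ₀) (hp.toLp p) = _
      rw [← hw, InnerProductSpace.toDual_apply_apply, L2.inner_def]
      refine integral_congr_ae ?_
      filter_upwards [hp.coeFn_toLp] with t ht
      rw [ht, real_inner_comm]
    rw [← h2]
    refine h1.congr fun k => ?_
    change InnerProductSpace.toDual ℝ (Lp F 2 (leb T)) (V (σ k)) (hp.toLp p) = _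
    rw [InnerProductSpace.toDual_apply_apply, L2.inner_def]
    refine integral_congr_ae ?_
    filter_upwards [hp.coeFn_toLp, (hv2 (σ k)).coeFn_toLp] with t ht ht2
    rw [ht, ht2, real_inner_comm]
  have hwb : EssBdd T M (w : ℝ → F) := by
    refine ⟨hw2.1, ?_⟩
    have := mem_of_weak_limit (Q := fun _ => closedBall (0 : F) M) (fun k => hv2 (σ k)) hw2 htest
      (Eventually.of_forall fun _ => ⟨convex_closedBall _ _, isClosed_closedBall⟩)
      (fun k => by filter_upwards [(hv (σ k)).2] with t ht using by simpa using ht)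
    filter_upwards [this] with t ht using by simpa using ht
  exact ⟨σ, w, hσ, hwb, weakStarTendsto_of_memLp_two (fun k => hv (σ k)) hwb htest⟩

end WeakStar

end SweepingProcess

/-! ### The generators of the truncated set and the constraint qualification -/

namespace SweepingProcess

theorem hasGradientAt_half_norm_sq {E : Type*} [NormedAddCommGroup E] [InnerProductSpace ℝ E]
    [CompleteSpace E] (a x : E) (c : ℝ) :
    HasGradientAt (fun z : E => (‖z - a‖ ^ 2 - c) / 2) (x - a) x := by
  rw [hasGradientAt_iff_hasFDerivAt]
  have h1 : HasFDerivAt (fun z : E => z - a) (ContinuousLinearMap.id ℝ E) x :=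
    (hasFDerivAt_id x).sub_const a
  have h2 := ((h1.norm_sq).sub_const c).mul_const (1 / 2 : ℝ)
  have e : (fun z : E => (‖z - a‖ ^ 2 - c) / 2) = fun z => (‖z - a‖ ^ 2 - c) * (1 / 2) := by
    ext z; ring
  rw [e]
  refine h2.congr_fderiv ?_
  ext v
  simp

theorem abs_half_norm_sq_sub_le {E : Type*} [NormedAddCommGroup E] {a b : E} {c R : ℝ}
    (ha : ‖a‖ ≤ R) (hb : ‖b‖ ≤ R) :
    |(‖a‖ ^ 2 - c) / 2 - (‖b‖ ^ 2 - c) / 2| ≤ R * ‖a - b‖ := by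
  have h1 := abs_norm_sub_norm_le a b
  have e : (‖a‖ ^ 2 - c) / 2 - (‖b‖ ^ 2 - c) / 2 = (‖a‖ + ‖b‖) / 2 * (‖a‖ - ‖b‖) := by ring
  rw [e, abs_mul, abs_of_nonneg (by positivity)]
  exact mul_le_mul (by linarith) h1 (abs_nonneg _) ((norm_nonneg a).trans ha)

namespace Data

variable {n l m r : ℕ} {S : Data n l m r}

/-- The standing assumptions that are used throughout. -/
structure StandingHyp (S : Data n l m r) : Prop where
  T_pos : 0 < S.T
  ref : S.HypRef
  delta_pos : 0 < S.delta
  a2 : S.HypA2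
  a31 : S.HypA31
  a41 : S.HypA41
  param : S.HypParam

theorem psiBar_castSucc (i : Fin r) : S.psiBar i.castSucc = S.psi i := by
  simp [psiBar]

theorem psiBar_last :
    S.psiBar (Fin.last r) = fun t x => (‖x - S.xbar t‖ ^ 2 - S.eps ^ 2) / 2 := by
  simp [psiBar]

namespace StandingHyp

theorem eps_pos (H : S.StandingHyp) : 0 < S.eps := H.param.1
theorem eps_lt_delta (H : S.StandingHyp) : S.eps < S.delta := H.param.2.1
theorem eta_pos (H : S.StandingHyp) : 0 < S.eta := H.param.2.2.2.1
theorem eta_lt (H : S.StandingHyp) : S.eta < S.eps / 2 := H.param.2.2.2.2.1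
theorem rho0_pos (H : S.StandingHyp) : 0 < S.rho0 := H.a31.1
theorem Lpsi_pos (H : S.StandingHyp) : 0 < S.Lpsi := H.a31.2.1
theorem Mh_pos (H : S.StandingHyp) : 0 < S.Mh := H.a41.2.2.1
theorem one_le_Lxy (H : S.StandingHyp) : 1 ≤ S.Lxy := H.ref.2.1

theorem LBar_pos (H : S.StandingHyp) : 0 < S.LBar := H.Lpsi_pos.trans_le (le_max_left _ _)

theorem delta_mul_Lxy_le : S.delta * S.Lxy ≤ S.LBar := le_max_right _ _

theorem delta_le (H : S.StandingHyp) : S.delta ≤ S.LBar :=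
  (le_mul_of_one_le_right H.delta_pos.le H.one_le_Lxy).trans delta_mul_Lxy_le

theorem muBar_pos (H : S.StandingHyp) : 0 < S.muBar :=
  mul_pos H.LBar_pos (by linarith [H.Mh_pos])

theorem norm_xbar_sub_le (H : S.StandingHyp) {s t : ℝ} (hs : s ∈ Icc 0 S.T) (ht : t ∈ Icc 0 S.T) :
    ‖S.xbar s - S.xbar t‖ ≤ S.Lxy * |s - t| :=
  (WithLp.norm_fst_le _ _).trans (H.ref.2.2 s hs t ht)

theorem norm_ybar_sub_le (H : S.StandingHyp) {s t : ℝ} (hs : s ∈ Icc 0 S.T) (ht : t ∈ Icc 0 S.T) :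
    ‖S.ybar s - S.ybar t‖ ≤ S.Lxy * |s - t| :=
  (WithLp.norm_snd_le _ _).trans (H.ref.2.2 s hs t ht)

theorem continuousOn_of_lip {E : Type*} [NormedAddCommGroup E] {z : ℝ → E} {L : ℝ} {I : Set ℝ}
    (h : ∀ s ∈ I, ∀ t ∈ I, ‖z s - z t‖ ≤ L * |s - t|) : ContinuousOn z I := by
  refine LipschitzOnWith.continuousOn (K := ⟨|L|, abs_nonneg L⟩)
    (LipschitzOnWith.of_dist_le_mul fun s hs t ht => ?_)
  rw [dist_eq_norm, Real.dist_eq]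
  exact (h s hs t ht).trans (mul_le_mul_of_nonneg_right (le_abs_self L) (abs_nonneg _))

theorem continuousOn_xbar (H : S.StandingHyp) : ContinuousOn S.xbar (Icc 0 S.T) :=
  continuousOn_of_lip fun _ hs _ ht => H.norm_xbar_sub_le hs ht

theorem continuousOn_ybar (H : S.StandingHyp) : ContinuousOn S.ybar (Icc 0 S.T) :=
  continuousOn_of_lip fun _ hs _ ht => H.norm_ybar_sub_le hs ht

theorem continuousOn_psiBar (H : S.StandingHyp) (i : Fin (r + 1)) :
    ContinuousOn (fun p : ℝ × Euc n => S.psiBar i p.1 p.2) (Icc 0 S.T ×ˢ univ) := by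
  refine Fin.lastCases ?_ (fun i => ?_) i
  · rw [psiBar_last]
    have h1 : ContinuousOn (fun p : ℝ × Euc n => S.xbar p.1) (Icc 0 S.T ×ˢ univ) :=
      H.continuousOn_xbar.comp continuousOn_fst fun p hp => hp.1
    exact (((continuousOn_snd.sub h1).norm.pow 2).sub continuousOn_const).div_const 2
  · rw [psiBar_castSucc]; exact H.a2.2.1 i

theorem continuous_psiBar (H : S.StandingHyp) (i : Fin (r + 1)) {t : ℝ} (ht : t ∈ Icc 0 S.T) :
    Continuous (S.psiBar i t) := by
  have h := (H.continuousOn_psiBar i).comp (f := fun x : Euc n => (t, x)) (s := univ)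
    (by fun_prop) fun x _ => ⟨ht, mem_univ _⟩
  exact continuousOn_univ.1 h

theorem continuousOn_psiBar_comp (H : S.StandingHyp) (i : Fin (r + 1)) {x : ℝ → Euc n} {I : Set ℝ}
    (hI : I ⊆ Icc 0 S.T) (hx : ContinuousOn x I) : ContinuousOn (fun t => S.psiBar i t (x t)) I :=
  (H.continuousOn_psiBar i).comp (f := fun t => (t, x t)) (continuousOn_id.prodMk hx)
    fun _ ht => ⟨hI ht, mem_univ _⟩

theorem psiBar_last_le_iff (H : S.StandingHyp) {t : ℝ} {x : Euc n} :
    S.psiBar (Fin.last r) t x ≤ 0 ↔ x ∈ closedBall (S.xbar t) S.eps := by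
  rw [psiBar_last, mem_closedBall, dist_eq_norm]
  change (‖x - S.xbar t‖ ^ 2 - S.eps ^ 2) / 2 ≤ 0 ↔ _
  rw [← pow_le_pow_iff_left₀ (norm_nonneg _) H.eps_pos.le two_ne_zero]
  constructor <;> intro h <;> linarith

theorem mem_CTrunc_iff (H : S.StandingHyp) {t : ℝ} {x : Euc n} :
    x ∈ S.CTrunc t ↔ ∀ i, S.psiBar i t x ≤ 0 := by
  constructor
  · rintro ⟨h1, h2⟩ i
    refine Fin.lastCases (H.psiBar_last_le_iff.2 h2) (fun i => ?_) i
    rw [psiBar_castSucc]; exact h1 i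
  · intro h
    refine ⟨fun i => ?_, H.psiBar_last_le_iff.1 (h _)⟩
    rw [← psiBar_castSucc]; exact h _

theorem CTrunc_subset (H : S.StandingHyp) (t : ℝ) :
    S.CTrunc t ⊆ S.C t ∩ closedBall (S.xbar t) S.delta :=
  inter_subset_inter_right _ (closedBall_subset_closedBall H.eps_lt_delta.le)

theorem CTrunc_mem_nhds (H : S.StandingHyp) {t : ℝ} (ht : t ∈ Icc 0 S.T) {x : Euc n}
    (hx : ∀ i, S.psiBar i t x < 0) : S.CTrunc t ∈ 𝓝 x := by
  have : ∀ᶠ z in 𝓝 x, ∀ i, S.psiBar i t z < 0 :=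
    eventually_all.2 fun i => (H.continuous_psiBar i ht).continuousAt.eventually_lt
      continuousAt_const (hx i)
  filter_upwards [this] with z hz using H.mem_CTrunc_iff.2 fun i => (hz i).le

theorem isClosed_CTrunc (H : S.StandingHyp) {t : ℝ} (ht : t ∈ Icc 0 S.T) :
    IsClosed (S.CTrunc t) := by
  have : S.CTrunc t = ⋂ i, {x | S.psiBar i t x ≤ 0} := by
    ext x; simp [H.mem_CTrunc_iff]
  rw [this]
  exact isClosed_iInter fun i => isClosed_le (H.continuous_psiBar i ht) continuous_const

theorem norm_sub_xbar_le {t : ℝ} {x : Euc n} (hx : x ∈ S.CTrunc t) : ‖x - S.xbar t‖ ≤ S.eps := by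
  have := hx.2; rwa [mem_closedBall, dist_eq_norm] at this

theorem gradient_psiBar_last (t : ℝ) (x : Euc n) :
    gradient (S.psiBar (Fin.last r) t) x = x - S.xbar t := by
  rw [psiBar_last]; exact (hasGradientAt_half_norm_sq _ _ _).gradient

theorem gradient_phi (t : ℝ) (y : Euc l) : gradient (S.phi t) y = y - S.ybar t :=
  (hasGradientAt_half_norm_sq _ _ _).gradient

theorem differentiableAt_phi (t : ℝ) (y : Euc l) : DifferentiableAt ℝ (S.phi t) y :=
  (hasGradientAt_half_norm_sq _ _ _).differentiableAt

theorem differentiableAt_psiBar (H : S.StandingHyp) (i : Fin (r + 1)) {t : ℝ}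
    (ht : t ∈ Icc 0 S.T) {x z : Euc n} (hx : x ∈ S.CTrunc t) (hz : z ∈ ball x S.rho0) :
    DifferentiableAt ℝ (S.psiBar i t) z := by
  refine Fin.lastCases ?_ (fun i => ?_) i
  · rw [psiBar_last]; exact (hasGradientAt_half_norm_sq _ _ _).differentiableAt
  · rw [psiBar_castSucc]
    exact (H.a31.2.2 i).1 t ht x (H.CTrunc_subset t hx) z hz

theorem differentiableAt_psiBar_self (H : S.StandingHyp) (i : Fin (r + 1)) {t : ℝ}
    (ht : t ∈ Icc 0 S.T) {x : Euc n} (hx : x ∈ S.CTrunc t) :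
    DifferentiableAt ℝ (S.psiBar i t) x :=
  H.differentiableAt_psiBar i ht hx (mem_ball_self H.rho0_pos)

/-- The form of L̄ comes from here: the added generator has space slope at most ε̄ < δ̄, and its
centre moves with speed L_{(x̄,ȳ)} ≥ 1, whence the constant δ̄L_{(x̄,ȳ)}. -/
theorem abs_psiBar_sub_le (H : S.StandingHyp) (i : Fin (r + 1)) {t₁ t₂ : ℝ}
    (ht₁ : t₁ ∈ Icc 0 S.T) (ht₂ : t₂ ∈ Icc 0 S.T) {x₁ x₂ : Euc n} (hx₁ : x₁ ∈ S.CTrunc t₁)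
    (hx₂ : x₂ ∈ S.CTrunc t₂) :
    |S.psiBar i t₁ x₁ - S.psiBar i t₂ x₂| ≤ S.LBar * (|t₁ - t₂| + ‖x₁ - x₂‖) := by
  refine Fin.lastCases ?_ (fun i => ?_) i
  · rw [psiBar_last]
    refine (abs_half_norm_sq_sub_le (norm_sub_xbar_le hx₁) (norm_sub_xbar_le hx₂)).trans ?_
    have h1 : ‖(x₁ - S.xbar t₁) - (x₂ - S.xbar t₂)‖ ≤ ‖x₁ - x₂‖ + S.Lxy * |t₁ - t₂| := by
      rw [show (x₁ - S.xbar t₁) - (x₂ - S.xbar t₂) = (x₁ - x₂) - (S.xbar t₁ - S.xbar t₂) by abel]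
      exact norm_sub_le_of_le le_rfl (H.norm_xbar_sub_le ht₁ ht₂)
    have h2 : ‖x₁ - x₂‖ + S.Lxy * |t₁ - t₂| ≤ S.Lxy * (|t₁ - t₂| + ‖x₁ - x₂‖) := by
      nlinarith [H.one_le_Lxy, norm_nonneg (x₁ - x₂)]
    have h3 : 0 ≤ |t₁ - t₂| + ‖x₁ - x₂‖ := by positivity
    calc S.eps * _ ≤ S.delta * (S.Lxy * (|t₁ - t₂| + ‖x₁ - x₂‖)) :=
          mul_le_mul H.eps_lt_delta.le (h1.trans h2) (norm_nonneg _) H.delta_pos.le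
      _ = S.delta * S.Lxy * (|t₁ - t₂| + ‖x₁ - x₂‖) := by ring
      _ ≤ _ := mul_le_mul_of_nonneg_right delta_mul_Lxy_le h3
  · rw [psiBar_castSucc]
    have hρ : 0 ≤ S.rho0 / 2 := by linarith [H.rho0_pos]
    refine ((H.a31.2.2 i).2 t₁ ht₁ x₁ (H.CTrunc_subset _ hx₁) x₁ (mem_closedBall_self hρ) t₂ ht₂ x₂
      (H.CTrunc_subset _ hx₂) x₂ (mem_closedBall_self hρ)).1.trans ?_
    exact mul_le_mul_of_nonneg_right (le_max_left _ _) (by positivity)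

/-- Lipschitz constant of the gradients of the generators. -/
theorem exists_gradient_lip (H : S.StandingHyp) : ∃ G, 0 < G ∧ ∀ i : Fin (r + 1),
    ∀ t₁ ∈ Icc 0 S.T, ∀ t₂ ∈ Icc 0 S.T, ∀ x₁ ∈ S.CTrunc t₁, ∀ x₂ ∈ S.CTrunc t₂,
    ∀ z₁ ∈ closedBall x₁ (S.rho0 / 2), ∀ z₂ ∈ closedBall x₂ (S.rho0 / 2),
    ‖gradient (S.psiBar i t₁) z₁ - gradient (S.psiBar i t₂) z₂‖ ≤ G * (|t₁ - t₂| + ‖z₁ - z₂‖) := by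
  refine ⟨max S.Lpsi S.Lxy, lt_max_of_lt_left H.Lpsi_pos, fun i => ?_⟩
  intro t₁ ht₁ t₂ ht₂ x₁ hx₁ x₂ hx₂ z₁ hz₁ z₂ hz₂
  have h3 : 0 ≤ |t₁ - t₂| + ‖z₁ - z₂‖ := by positivity
  refine Fin.lastCases ?_ (fun i => ?_) i
  · rw [gradient_psiBar_last, gradient_psiBar_last,
      show (z₁ - S.xbar t₁) - (z₂ - S.xbar t₂) = (z₁ - z₂) - (S.xbar t₁ - S.xbar t₂) by abel]
    refine (norm_sub_le_of_le le_rfl (H.norm_xbar_sub_le ht₁ ht₂)).trans ?_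
    refine le_trans ?_ (mul_le_mul_of_nonneg_right (le_max_right _ _) h3)
    nlinarith [H.one_le_Lxy, norm_nonneg (z₁ - z₂)]
  · rw [psiBar_castSucc]
    exact ((H.a31.2.2 i).2 t₁ ht₁ x₁ (H.CTrunc_subset _ hx₁) z₁ hz₁ t₂ ht₂ x₂
      (H.CTrunc_subset _ hx₂) z₂ hz₂).2.trans (mul_le_mul_of_nonneg_right (le_max_left _ _) h3)

/-- The generators are Lipschitz on a full ball around x, not only along C(t), and this bounds their
derivative at x; for the last generator ε̄ < δ̄ ≤ L̄. -/
theorem norm_gradient_le (H : S.StandingHyp) (i : Fin (r + 1)) {t : ℝ} (ht : t ∈ Icc 0 S.T)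
    {x : Euc n} (hx : x ∈ S.CTrunc t) : ‖gradient (S.psiBar i t) x‖ ≤ S.LBar := by
  refine Fin.lastCases ?_ (fun i => ?_) i
  · rw [gradient_psiBar_last]
    exact (norm_sub_xbar_le hx).trans (H.eps_lt_delta.le.trans H.delta_le)
  · rw [psiBar_castSucc]
    have hρ : 0 < S.rho0 / 2 := by linarith [H.rho0_pos]
    refine le_trans ?_ (le_max_left _ _)
    rw [gradient, LinearIsometryEquiv.norm_map]
    refine norm_fderiv_le_of_lip' ℝ H.Lpsi_pos.le ?_
    filter_upwards [closedBall_mem_nhds x hρ] with z hz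
    have := ((H.a31.2.2 i).2 t ht x (H.CTrunc_subset _ hx) z hz t ht x (H.CTrunc_subset _ hx) x
      (mem_closedBall_self hρ.le)).1
    simpa using this

/-- The graph of the truncated sweeping set. -/
theorem isCompact_graph (H : S.StandingHyp) :
    IsCompact {p : ℝ × Euc n | p.1 ∈ Icc 0 S.T ∧ p.2 ∈ S.CTrunc p.1} := by
  obtain ⟨R, hR⟩ := (isCompact_Icc.image_of_continuousOn H.continuousOn_xbar).isBounded.subset_closedBall 0
  have hK : IsCompact (Icc 0 S.T ×ˢ closedBall (0 : Euc n) (R + S.eps)) :=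
    isCompact_Icc.prod (isCompact_closedBall _ _)
  refine hK.of_isClosed_subset ?_ ?_
  · have : {p : ℝ × Euc n | p.1 ∈ Icc 0 S.T ∧ p.2 ∈ S.CTrunc p.1}
        = ⋂ i, ((Icc 0 S.T ×ˢ univ) ∩ (fun p : ℝ × Euc n => S.psiBar i p.1 p.2) ⁻¹' Iic 0) := by
      ext p
      simp only [mem_ofPred_eq, H.mem_CTrunc_iff, mem_iInter, mem_inter_iff, mem_prod, mem_univ,
        and_true, mem_preimage, mem_Iic]
      exact ⟨fun h i => ⟨h.1, h.2 i⟩, fun h => ⟨(h 0).1, fun i => (h i).2⟩⟩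
    rw [this]
    exact isClosed_iInter fun i => (H.continuousOn_psiBar i).preimage_isClosed_of_isClosed
      (isClosed_Icc.prod isClosed_univ) isClosed_Iic
  · rintro ⟨t, x⟩ ⟨ht, hx⟩
    refine ⟨ht, ?_⟩
    rw [mem_closedBall_zero_iff]
    have h1 : ‖S.xbar t‖ ≤ R := by simpa using hR ⟨t, ht, rfl⟩
    have h2 := norm_sub_xbar_le hx
    calc ‖x‖ = ‖S.xbar t + (x - S.xbar t)‖ := by congr 1; abel
      _ ≤ _ := norm_add_le_of_le h1 h2

theorem continuousOn_gradient (H : S.StandingHyp) (i : Fin (r + 1)) :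
    ContinuousOn (fun p : ℝ × Euc n => gradient (S.psiBar i p.1) p.2)
      {p : ℝ × Euc n | p.1 ∈ Icc 0 S.T ∧ p.2 ∈ S.CTrunc p.1} := by
  obtain ⟨G, hG, h⟩ := H.exists_gradient_lip
  have hρ : 0 ≤ S.rho0 / 2 := by linarith [H.rho0_pos]
  refine LipschitzOnWith.continuousOn (K := ⟨2 * G, by positivity⟩)
    (LipschitzOnWith.of_dist_le_mul fun p hp q hq => ?_)
  rw [dist_eq_norm]
  refine (h i p.1 hp.1 q.1 hq.1 p.2 hp.2 q.2 hq.2 p.2 (mem_closedBall_self hρ) q.2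
    (mem_closedBall_self hρ)).trans ?_
  have h1 : |p.1 - q.1| ≤ dist p q := by rw [← Real.dist_eq]; exact le_max_left _ _
  have h2 : ‖p.2 - q.2‖ ≤ dist p q := by rw [← dist_eq_norm]; exact le_max_right _ _
  change _ ≤ 2 * G * dist p q
  nlinarith

theorem continuousOn_gradient_comp (H : S.StandingHyp) (i : Fin (r + 1)) {x : ℝ → Euc n}
    {I : Set ℝ} (hI : I ⊆ Icc 0 S.T) (hx : ContinuousOn x I) (hxC : ∀ t ∈ I, x t ∈ S.CTrunc t) :
    ContinuousOn (fun t => gradient (S.psiBar i t) (x t)) I :=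
  (H.continuousOn_gradient i).comp (f := fun t => (t, x t)) (continuousOn_id.prodMk hx)
    fun _ ht => ⟨hI ht, hxC _ ht⟩

/-- The constraint qualification, extended from the active generators to the exponential weights
of the penalty approximation. -/
theorem exists_forall_le_norm_sum (H : S.StandingHyp) : ∃ Γ, ∀ γ ≥ Γ, ∀ t ∈ Icc 0 S.T,
    ∀ x ∈ S.CTrunc t, 2 * S.muBar / (S.eta ^ 2 * γ) ≤ ∑ i, Real.exp (γ * S.psiBar i t x) →
    S.eta * ∑ i, Real.exp (γ * S.psiBar i t x)
      ≤ ‖∑ i, Real.exp (γ * S.psiBar i t x) • gradient (S.psiBar i t) x‖ := by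
  -- Compactness: counterexamples with parameters tending to infinity are collected, and points and
  -- normalised weights converge along a subsequence to a point of the graph and a convex
  -- combination.
  by_contra! hcon
  choose g hg t ht x hx hW hlt using fun k : ℕ => hcon (k + 1)
  have hgt : Tendsto g atTop atTop :=
    tendsto_atTop_mono hg (tendsto_atTop_add_const_right _ _ tendsto_natCast_atTop_atTop)
  have hgpos : ∀ k, 0 < g k := fun k => lt_of_lt_of_le (by positivity) (hg k)
  let W : ℕ → ℝ := fun k => ∑ i, Real.exp (g k * S.psiBar i (t k) (x k))
  have hWpos : ∀ k, 0 < W k := fun k =>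
    Finset.sum_pos (fun i _ => Real.exp_pos _) Finset.univ_nonempty
  let lam : ℕ → Fin (r + 1) → ℝ := fun k i => Real.exp (g k * S.psiBar i (t k) (x k)) / W k
  have hlam : ∀ k, lam k ∈ stdSimplex ℝ (Fin (r + 1)) := fun k =>
    ⟨fun i => div_nonneg (Real.exp_pos _).le (hWpos k).le, by
      simp only [lam, ← Finset.sum_div]; exact div_self (hWpos k).ne'⟩
  obtain ⟨⟨⟨t₀, x₀⟩, lam₀⟩, ⟨⟨ht₀, hx₀⟩, hlam₀⟩, φ, hφ, hlim⟩ :=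
    (H.isCompact_graph.prod (isCompact_stdSimplex ℝ (Fin (r + 1)))).tendsto_subseq
      (x := fun k => ((t k, x k), lam k)) fun k => ⟨⟨ht k, hx k⟩, hlam k⟩
  simp only at ht₀ hx₀ hlam₀
  have hlim1 : Tendsto (fun k => (t (φ k), x (φ k))) atTop (𝓝 (t₀, x₀)) :=
    (continuous_fst.tendsto _).comp hlim
  have hlim2 : ∀ i, Tendsto (fun k => lam (φ k) i) atTop (𝓝 (lam₀ i)) := fun i =>
    ((continuous_apply i).tendsto _).comp ((continuous_snd.tendsto _).comp hlim)
  -- the limit weights are carried by the active indices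
  have hsupp : ∀ i, i ∉ S.active t₀ x₀ → lam₀ i = 0 := by
    intro i hi
    have hneg : S.psiBar i t₀ x₀ < 0 :=
      lt_of_le_of_ne (H.mem_CTrunc_iff.1 hx₀ i) (by simpa [active] using hi)
    set c := -S.psiBar i t₀ x₀ / 2
    have hc : 0 < c := by simp only [c]; linarith
    have hψ : Tendsto (fun k => S.psiBar i (t (φ k)) (x (φ k))) atTop (𝓝 (S.psiBar i t₀ x₀)) :=
      ((H.continuousOn_psiBar i) (t₀, x₀) ⟨ht₀, mem_univ _⟩).tendsto.comp
        (tendsto_nhdsWithin_iff.2 ⟨hlim1, Eventually.of_forall fun k => ⟨ht _, mem_univ _⟩⟩)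
    have hev : ∀ᶠ k in atTop, S.psiBar i (t (φ k)) (x (φ k)) < -c :=
      hψ.eventually (gt_mem_nhds (by simp only [c]; linarith))
    -- The lower bound on the sum of exponentials enters here: dividing e^{−cg} by 2μ̄/(η̄²g) leaves
    -- a constant times g·e^{−cg}, which tends to zero.
    have hdecay : Tendsto (fun k => S.eta ^ 2 / (2 * S.muBar) / c *
        (c * g (φ k) * Real.exp (-(c * g (φ k))))) atTop (𝓝 0) := by
      have h1 := (Real.tendsto_pow_mul_exp_neg_atTop_nhds_zero 1).comp
        ((hgt.comp hφ.tendsto_atTop).const_mul_atTop hc)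
      have h2 := h1.const_mul (S.eta ^ 2 / (2 * S.muBar) / c)
      rw [mul_zero] at h2
      refine h2.congr fun k => ?_
      simp only [Function.comp, pow_one]
    refine tendsto_nhds_unique (hlim2 i) (squeeze_zero'
      (Eventually.of_forall fun k => (hlam (φ k)).1 i) ?_ hdecay)
    filter_upwards [hev] with k hk
    have hη := H.eta_pos
    have hμ := H.muBar_pos
    have hgk := hgpos (φ k)
    have h1 : Real.exp (g (φ k) * S.psiBar i (t (φ k)) (x (φ k))) ≤ Real.exp (-(c * g (φ k))) :=
      Real.exp_le_exp.2 (by nlinarith)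
    have h2 : 2 * S.muBar / (S.eta ^ 2 * g (φ k)) ≤ W (φ k) := hW (φ k)
    calc lam (φ k) i ≤ Real.exp (-(c * g (φ k))) / (2 * S.muBar / (S.eta ^ 2 * g (φ k))) :=
          div_le_div₀ (Real.exp_pos _).le h1 (by positivity) h2
      _ = _ := by
        generalize Real.exp (-(c * g (φ k))) = E
        clear_value c
        field_simp
  have hgrad : Tendsto (fun k => ∑ i, lam (φ k) i • gradient (S.psiBar i (t (φ k))) (x (φ k)))
      atTop (𝓝 (∑ i, lam₀ i • gradient (S.psiBar i t₀) x₀)) := by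
    refine tendsto_finsetSum _ fun i _ => ?_
    have h1 : Tendsto (fun p : ℝ × Euc n => gradient (S.psiBar i p.1) p.2)
        (𝓝[{p : ℝ × Euc n | p.1 ∈ Icc 0 S.T ∧ p.2 ∈ S.CTrunc p.1}] (t₀, x₀))
        (𝓝 (gradient (S.psiBar i t₀) x₀)) := (H.continuousOn_gradient i) (t₀, x₀) ⟨ht₀, hx₀⟩
    have h2 : Tendsto (fun k => (t (φ k), x (φ k))) atTop
        (𝓝[{p : ℝ × Euc n | p.1 ∈ Icc 0 S.T ∧ p.2 ∈ S.CTrunc p.1}] (t₀, x₀)) :=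
      tendsto_nhdsWithin_iff.2 ⟨hlim1, Eventually.of_forall fun k => ⟨ht _, hx _⟩⟩
    have h3 := h1.comp h2
    simp only [Function.comp_def] at h3
    exact (hlim2 i).smul h3
  -- The assumed failure survives in the limit as a convex combination of active gradients of norm
  -- at most η̄, whereas the qualification requires more than 2η̄.
  have hle : ‖∑ i, lam₀ i • gradient (S.psiBar i t₀) x₀‖ ≤ S.eta := by
    refine le_of_tendsto' hgrad.norm fun k => ?_
    have e : ∑ i, lam (φ k) i • gradient (S.psiBar i (t (φ k))) (x (φ k))
        = (W (φ k))⁻¹ • ∑ i, Real.exp (g (φ k) * S.psiBar i (t (φ k)) (x (φ k))) •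
          gradient (S.psiBar i (t (φ k))) (x (φ k)) := by
      rw [Finset.smul_sum]
      refine Finset.sum_congr rfl fun i _ => ?_
      rw [smul_smul]; congr 1; simp only [lam]; ring
    rw [e, norm_smul, norm_inv, Real.norm_of_nonneg (hWpos _).le,
      inv_mul_le_iff₀ (hWpos _), mul_comm]
    exact (hlt (φ k)).le
  have hsum1 : ∑ i ∈ S.active t₀ x₀, lam₀ i = 1 := by
    rw [← hlam₀.2]
    exact Finset.sum_subset (Finset.subset_univ _) fun i _ hi => hsupp i hi
  have hsum2 : ∑ i ∈ S.active t₀ x₀, lam₀ i • gradient (S.psiBar i t₀) x₀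
      = ∑ i, lam₀ i • gradient (S.psiBar i t₀) x₀ :=
    Finset.sum_subset (Finset.subset_univ _) fun i _ hi => by rw [hsupp i hi, zero_smul]
  have hne : (S.active t₀ x₀).Nonempty := by
    rw [Finset.nonempty_iff_ne_empty]; rintro h
    rw [h, Finset.sum_empty] at hsum1; exact zero_ne_one hsum1
  have := H.param.2.2.2.2.2.2 t₀ ht₀ x₀ hx₀ hne lam₀ hlam₀.1 hsum1
  rw [hsum2] at this
  linarith [H.eta_pos]

end StandingHyp
end Data
end SweepingProcess

/-! ### Clarke cones of the truncated sets and hypomonotonicity -/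

namespace SweepingProcess

/-- Finitely many vectors whose convex combinations have norm larger than `c` admit a common
direction of descent. -/
theorem exists_descent_direction {E ι : Type*} [NormedAddCommGroup E] [InnerProductSpace ℝ E]
    [FiniteDimensional ℝ E] (A : Finset ι) (g : ι → E) {c : ℝ} (hc : 0 ≤ c)
    (h : A.Nonempty → ∀ lam : ι → ℝ, (∀ i, 0 ≤ lam i) → ∑ i ∈ A, lam i = 1 →
      c < ‖∑ i ∈ A, lam i • g i‖) :
    ∃ d : E, ‖d‖ ≤ 1 ∧ ∀ i ∈ A, inner ℝ (g i) d ≤ -c := by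
  classical
  rcases A.eq_empty_or_nonempty with rfl | hA
  · exact ⟨0, by simp, by simp⟩
  let K : Set E := convexHull ℝ (g '' A)
  have hfin : (g '' (A : Set ι)).Finite := A.finite_toSet.image g
  have hKc : IsComplete K := (hfin.isCompact_convexHull ℝ).isComplete
  have hKn : K.Nonempty := (convexHull_nonempty_iff.2 ((Finset.coe_nonempty.2 hA).image g))
  -- The point p of least norm in the convex hull satisfies ⟨p, g i⟩ ≥ ‖p‖² for every i, so the
  -- direction −p/‖p‖ descends at rate ‖p‖ > c.
  obtain ⟨p, hpK, hp⟩ := exists_norm_eq_iInf_of_complete_convex hKn hKc (convex_convexHull ℝ _) 0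
  have hpi := (norm_eq_iInf_iff_real_inner_le_zero (convex_convexHull ℝ _) hpK).1 hp
  have hpc : c < ‖p‖ := by
    have hpK' : p ∈ convexHull ℝ (g '' (A : Set ι)) := hpK
    rw [← Finset.coe_image, Finset.mem_convexHull'] at hpK'
    obtain ⟨w, hw0, hw1, hwp⟩ := hpK'
    -- choose one preimage for each point of the image
    have : Nonempty ι := ⟨hA.choose⟩
    choose! j hjA hj using fun y (hy : y ∈ A.image g) => Finset.mem_image.1 hy
    let lam : ι → ℝ := fun i => if i ∈ (A.image g).image j then w (g i) else 0
    have hinj : Set.InjOn j (A.image g) := fun y hy y' hy' hyy => by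
      rw [← hj y hy, ← hj y' hy', hyy]
    have hsub : (A.image g).image j ⊆ A := by
      intro i hi
      obtain ⟨y, hy, rfl⟩ := Finset.mem_image.1 hi
      exact hjA y hy
    have hzero : ∀ i ∈ A, i ∉ (A.image g).image j → lam i = 0 := fun i _ hi => by
      simp only [lam, if_neg hi]
    have hlamj : ∀ y ∈ A.image g, lam (j y) = w y := fun y hy => by
      simp only [lam, if_pos (Finset.mem_image_of_mem j hy), hj y hy]
    have := h hA lam (fun i => by
        simp only [lam]; split_ifs with hi
        · obtain ⟨y, hy, rfl⟩ := Finset.mem_image.1 hi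
          rw [hj y hy]; exact hw0 y hy
        · exact le_rfl)
      (by
        rw [← Finset.sum_subset hsub hzero, Finset.sum_image hinj, ← hw1]
        exact Finset.sum_congr rfl hlamj)
    rw [← Finset.sum_subset hsub fun i hi hi' => by rw [hzero i hi hi', zero_smul],
      Finset.sum_image hinj] at this
    rwa [Finset.sum_congr rfl fun y hy => by rw [hlamj y hy, hj y hy], hwp] at this
  have hp0 : 0 < ‖p‖ := hc.trans_lt hpc
  refine ⟨-(‖p‖⁻¹ • p), ?_, fun i hi => ?_⟩
  · rw [norm_neg, norm_smul, norm_inv, norm_norm, inv_mul_cancel₀ hp0.ne']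
  · have h1 := hpi (g i) (subset_convexHull ℝ _ ⟨i, hi, rfl⟩)
    rw [zero_sub, inner_neg_left, inner_sub_right, real_inner_self_eq_norm_sq] at h1
    rw [inner_neg_right, inner_smul_right, real_inner_comm]
    have h2 : ‖p‖ ≤ ‖p‖⁻¹ * inner ℝ p (g i) := by
      rw [le_inv_mul_iff₀ hp0]; nlinarith
    linarith

/-- Normal vectors to a convex set in the sense of Clarke are normal in the sense of convex
analysis. -/
theorem inner_le_zero_of_mem_clarkeNormalCone_of_convex {E : Type*} [NormedAddCommGroup E]
    [InnerProductSpace ℝ E] {K : Set E} (hK : Convex ℝ K) {s ξ z : E}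
    (hξ : ξ ∈ clarkeNormalCone K s) (hz : z ∈ K) : inner ℝ ξ (z - s) ≤ 0 := by
  -- The vector z − s is tangent: from a nearby base point s' the witness is z − s', which points to
  -- z and stays in K for τ < 1.
  refine hξ.2 _ fun e he => ⟨min e 1, lt_min he one_pos, fun s' hs' hd τ hτ hτ1 => ⟨z - s', ?_, ?_⟩⟩
  · rw [sub_sub_sub_cancel_left, norm_sub_rev]
    exact hd.trans_le (min_le_left _ _)
  · have := hK hs' hz (a := 1 - τ) (b := τ)
      (by linarith [hτ1.trans_le (min_le_right e 1)]) hτ.le (by ring)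
    rwa [show s' + τ • (z - s') = (1 - τ) • s' + τ • z by rw [smul_sub, sub_smul, one_smul]; abel]

/-- Clarke tangent vectors to a set on which `ψ ≤ 0 = ψ(s)` make no acute angle with `∇ψ(s)`. -/
theorem inner_gradient_le_zero_of_mem_clarkeTangentCone {E : Type*} [NormedAddCommGroup E]
    [InnerProductSpace ℝ E] [CompleteSpace E] {K : Set E} {ψ : E → ℝ} {s v : E} (hs : s ∈ K)
    (hψK : ∀ z ∈ K, ψ z ≤ 0) (hψs : ψ s = 0) (hψ : DifferentiableAt ℝ ψ s)
    (hv : v ∈ clarkeTangentCone K s) : inner ℝ (gradient ψ s) v ≤ 0 := by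
  by_contra! hpos
  set a := inner ℝ (gradient ψ s) v
  set g := gradient ψ s
  have hg0 : 0 < ‖g‖ := by
    by_contra! h0
    have : g = 0 := norm_le_zero_iff.1 h0
    simp only [a, g] at hpos this
    rw [this, inner_zero_left] at hpos
    exact lt_irrefl _ hpos
  set e := a / (2 * ‖g‖)
  have he : 0 < e := by positivity
  -- vectors close to `v` are uniformly ascending
  have hw : ∀ w, ‖w - v‖ < e → a / 2 ≤ inner ℝ g w := by
    intro w hw
    have h1 := neg_le_of_abs_le (abs_real_inner_le_norm g (w - v))
    rw [inner_sub_right] at h1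
    have h2 : ‖g‖ * ‖w - v‖ ≤ ‖g‖ * e := mul_le_mul_of_nonneg_left hw.le hg0.le
    have h3 : ‖g‖ * e = a / 2 := by simp only [e]; field_simp
    change -(‖g‖ * ‖w - v‖) ≤ inner ℝ g w - a at h1
    linarith
  set R := ‖v‖ + e
  have hR : 0 < R := by positivity
  -- With relative error a/(4R) and ‖w‖ ≤ R, the first-order expansion gives ψ(s + τw) ≥ τa/2 − τa/4
  -- > 0, although s + τw lies in K.
  have hlo := (hasGradientAt_iff_isLittleO.1 hψ.hasGradientAt).def
    (show (0 : ℝ) < a / (4 * R) by positivity)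
  obtain ⟨ρ, hρ, hb⟩ := Metric.eventually_nhds_iff.1 hlo
  obtain ⟨d, hd, hT⟩ := hv e he
  set τ := min (d / 2) (ρ / (2 * R))
  have hτ : 0 < τ := by positivity
  obtain ⟨w, hwv, hwK⟩ := hT s hs (by simpa using hd) τ hτ
    ((min_le_left _ _).trans_lt (by linarith))
  have hwR : ‖w‖ ≤ R := by
    calc ‖w‖ = ‖v + (w - v)‖ := by congr 1; abel
      _ ≤ _ := norm_add_le_of_le le_rfl hwv.le
  have hτw : ‖τ • w‖ ≤ τ * R := by
    rw [norm_smul, Real.norm_of_nonneg hτ.le]; exact mul_le_mul_of_nonneg_left hwR hτ.le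
  have hτR : τ * R ≤ ρ / 2 := by
    have : τ ≤ ρ / (2 * R) := min_le_right _ _
    calc τ * R ≤ ρ / (2 * R) * R := mul_le_mul_of_nonneg_right this hR.le
      _ = ρ / 2 := by field_simp
  have h1 := hb (y := s + τ • w) (by
    rw [dist_eq_norm, add_sub_cancel_left]; linarith)
  simp only [add_sub_cancel_left, hψs, sub_zero] at h1
  have h2 := hψK _ hwK
  have h3 : inner ℝ g (τ • w) = τ * inner ℝ g w := inner_smul_right _ _ _
  have h4 := neg_le_of_abs_le h1
  change -(a / (4 * R) * ‖τ • w‖) ≤ ψ (s + τ • w) - inner ℝ g (τ • w) at h4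
  have h5 : a / (4 * R) * ‖τ • w‖ ≤ a / 4 * τ := by
    calc a / (4 * R) * ‖τ • w‖ ≤ a / (4 * R) * (τ * R) :=
          mul_le_mul_of_nonneg_left hτw (by positivity)
      _ = a / 4 * τ := by field_simp
  have h6 := mul_le_mul_of_nonneg_left (hw w hwv) hτ.le
  have h7 : 0 < τ * a := mul_pos hτ hpos
  nlinarith

namespace Data
namespace StandingHyp

variable {n l m r : ℕ} {S : Data n l m r}

theorem mem_active {t : ℝ} {x : Euc n} {i : Fin (r + 1)} :
    i ∈ S.active t x ↔ S.psiBar i t x = 0 := by simp [active]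

/-- Nonnegative combinations of active gradients are normal to the truncated set. -/
theorem sum_smul_gradient_mem_clarkeNormalCone (H : S.StandingHyp) {t : ℝ} (ht : t ∈ Icc 0 S.T)
    {x : Euc n} (hx : x ∈ S.CTrunc t) {lam : Fin (r + 1) → ℝ} (hlam : ∀ i, 0 ≤ lam i) :
    ∑ i ∈ S.active t x, lam i • gradient (S.psiBar i t) x ∈ clarkeNormalCone (S.CTrunc t) x := by
  refine ⟨hx, fun v hv => ?_⟩
  rw [sum_inner]
  refine Finset.sum_nonpos fun i hi => ?_
  rw [inner_smul_left]
  refine mul_nonpos_of_nonneg_of_nonpos (hlam i) ?_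
  exact inner_gradient_le_zero_of_mem_clarkeTangentCone hx
    (fun z hz => H.mem_CTrunc_iff.1 hz i) (mem_active.1 hi)
    (H.differentiableAt_psiBar_self i ht hx) hv

/-- The gradient is Lipschitz near x, so differentiability is strict. Strictness is what the Clarke
tangent cone needs, since its base points vary. -/
theorem hasStrictFDerivAt_psiBar (H : S.StandingHyp) (i : Fin (r + 1)) {t : ℝ}
    (ht : t ∈ Icc 0 S.T) {x : Euc n} (hx : x ∈ S.CTrunc t) :
    HasStrictFDerivAt (S.psiBar i t)
      (InnerProductSpace.toDual ℝ (Euc n) (gradient (S.psiBar i t) x)) x := by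
  refine hasStrictFDerivAt_of_hasFDerivAt_of_continuousAt
    (f' := fun z => InnerProductSpace.toDual ℝ (Euc n) (gradient (S.psiBar i t) z)) ?_ ?_
  · filter_upwards [ball_mem_nhds x H.rho0_pos] with z hz
    exact (H.differentiableAt_psiBar i ht hx hz).hasGradientAt.hasFDerivAt
  · refine ((InnerProductSpace.toDual ℝ (Euc n)).continuous.continuousAt).comp ?_
    obtain ⟨G, hG, hlip⟩ := H.exists_gradient_lip
    have hρ : 0 < S.rho0 / 2 := by linarith [H.rho0_pos]
    refine continuousAt_of_locally_lipschitz hρ G fun z hz => ?_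
    rw [dist_eq_norm, dist_eq_norm]
    have := hlip i t ht t ht x hx x hx z (le_of_lt hz) x (mem_closedBall_self hρ.le)
    simpa using this

/-- Strict descent directions of the active generators are tangent to the truncated set. -/
theorem mem_clarkeTangentCone_CTrunc (H : S.StandingHyp) {t : ℝ} (ht : t ∈ Icc 0 S.T)
    {x : Euc n} (hx : x ∈ S.CTrunc t) {v : Euc n}
    (hv : ∀ i ∈ S.active t x, inner ℝ (gradient (S.psiBar i t) x) v < 0) :
    v ∈ clarkeTangentCone (S.CTrunc t) x := by
  -- The direction v itself serves as witness for all nearby base points. For active indices the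
  -- linear decrease dominates the strict-derivative error; inactive ones stay negative by
  -- continuity.
  have key : ∀ᶠ p : Euc n × ℝ in 𝓝 (x, 0), ∀ i, S.psiBar i t p.1 ≤ 0 → 0 < p.2 →
      S.psiBar i t (p.1 + p.2 • v) ≤ 0 := by
    refine eventually_all.2 fun i => ?_
    have hcont : Tendsto (fun p : Euc n × ℝ => p.1 + p.2 • v) (𝓝 (x, 0)) (𝓝 x) := by
      have : Continuous fun p : Euc n × ℝ => p.1 + p.2 • v := by fun_prop
      simpa using this.tendsto (x, 0)
    by_cases hi : i ∈ S.active t x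
    · set b := -inner ℝ (gradient (S.psiBar i t) x) v
      have hb : 0 < b := by have := hv i hi; simp only [b]; linarith
      have hc : 0 < b / (‖v‖ + 1) := by positivity
      have hst := (H.hasStrictFDerivAt_psiBar i ht hx).isLittleO.def hc
      have hpair : Tendsto (fun p : Euc n × ℝ => (p.1 + p.2 • v, p.1)) (𝓝 (x, 0)) (𝓝 (x, x)) :=
        hcont.prodMk_nhds (continuous_fst.tendsto (x, (0 : ℝ)))
      filter_upwards [hpair.eventually hst] with p hp hp1 hp2
      simp only [add_sub_cancel_left, InnerProductSpace.toDual_apply_apply, inner_smul_right,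
        norm_smul, Real.norm_of_nonneg hp2.le] at hp
      have h1 := le_of_abs_le hp
      have h2 : b / (‖v‖ + 1) * (p.2 * ‖v‖) ≤ b * p.2 := by
        rw [div_mul_eq_mul_div, div_le_iff₀ (by positivity)]
        nlinarith [norm_nonneg v, mul_pos hb hp2]
      have h3 : p.2 * inner ℝ (gradient (S.psiBar i t) x) v = -(b * p.2) := by
        simp only [b]; ring
      linarith
    · have hneg : S.psiBar i t x < 0 :=
        lt_of_le_of_ne (H.mem_CTrunc_iff.1 hx i) fun h => hi (mem_active.2 h)
      filter_upwards [hcont.eventually ((H.continuous_psiBar i ht).continuousAt.eventually_lt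
        continuousAt_const hneg)] with p hp _ _ using hp.le
  intro e he
  obtain ⟨d, hd, h⟩ := Metric.eventually_nhds_iff.1 key
  refine ⟨d, hd, fun s' hs' hsd τ hτ hτd => ⟨v, by simpa using he, ?_⟩⟩
  refine H.mem_CTrunc_iff.2 fun i => h (y := (s', τ)) ?_ i (H.mem_CTrunc_iff.1 hs' i) hτ
  rw [Prod.dist_eq]
  refine max_lt (by rwa [dist_eq_norm]) ?_
  rw [Real.dist_eq, sub_zero, abs_of_pos hτ]; exact hτd

/-- The active generators are uniformly semiconvex along the truncated set. -/
theorem exists_inner_gradient_le (H : S.StandingHyp) : ∃ c, 0 < c ∧ ∀ t ∈ Icc 0 S.T,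
    ∀ x ∈ S.CTrunc t, ∀ z ∈ S.CTrunc t, ∀ i ∈ S.active t x,
    inner ℝ (gradient (S.psiBar i t) x) (z - x) ≤ c * ‖z - x‖ ^ 2 := by
  obtain ⟨G, hG, hlip⟩ := H.exists_gradient_lip
  have hρ : 0 < S.rho0 / 2 := by linarith [H.rho0_pos]
  have hL := H.LBar_pos
  refine ⟨max G (S.LBar / (S.rho0 / 2)), lt_max_of_lt_left hG, fun t ht x hx z hz i hi => ?_⟩
  -- Near x, the mean value theorem with ψ_i(z) ≤ 0 = ψ_i(x) gives a point w of the segment where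
  -- the slope along z − x is nonpositive, and the gradient at w differs by O(‖z − x‖). The segment
  -- may leave C(t), but it stays in the ball where the gradient is Lipschitz. Far from x, a linear
  -- bound is a quadratic one.
  by_cases hzx : ‖z - x‖ ≤ S.rho0 / 2
  · refine le_trans ?_ (mul_le_mul_of_nonneg_right (le_max_left _ _) (sq_nonneg _))
    have hxb : x ∈ closedBall x (S.rho0 / 2) := mem_closedBall_self hρ.le
    have hzb : z ∈ closedBall x (S.rho0 / 2) := by rwa [mem_closedBall, dist_eq_norm]
    obtain ⟨w, hw, heq⟩ := domain_mvt (f := S.psiBar i t) (s := closedBall x (S.rho0 / 2))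
      (f' := fun z => InnerProductSpace.toDual ℝ (Euc n) (gradient (S.psiBar i t) z))
      (fun y hy => ((H.differentiableAt_psiBar i ht hx (by
        rw [mem_closedBall] at hy; rw [mem_ball]; linarith)).hasGradientAt.hasFDerivAt
        ).hasFDerivWithinAt) (convex_closedBall _ _) hxb hzb
    have hwb := (convex_closedBall x (S.rho0 / 2)).segment_subset hxb hzb hw
    have hwz : ‖x - w‖ ≤ ‖z - x‖ := by
      obtain ⟨a, b, ha, hb, hab, rfl⟩ := hw
      have e : x - (a • x + b • z) = -(b • (z - x)) := by
        rw [show a = 1 - b by linarith, sub_smul, one_smul, smul_sub]; abel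
      rw [e, norm_neg, norm_smul, Real.norm_of_nonneg hb]
      exact mul_le_of_le_one_left (norm_nonneg _) (by linarith)
    rw [InnerProductSpace.toDual_apply_apply, mem_active.1 hi, sub_zero] at heq
    have h1 : inner ℝ (gradient (S.psiBar i t) w) (z - x) ≤ 0 :=
      heq ▸ H.mem_CTrunc_iff.1 hz i
    have h2 := hlip i t ht t ht x hx x hx x hxb w hwb
    rw [sub_self, abs_zero, zero_add] at h2
    have h3 := real_inner_le_norm (gradient (S.psiBar i t) x - gradient (S.psiBar i t) w) (z - x)
    rw [inner_sub_left] at h3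
    have h4 : ‖gradient (S.psiBar i t) x - gradient (S.psiBar i t) w‖ * ‖z - x‖
        ≤ G * ‖z - x‖ * ‖z - x‖ :=
      mul_le_mul_of_nonneg_right (h2.trans (mul_le_mul_of_nonneg_left hwz hG.le)) (norm_nonneg _)
    nlinarith
  · push Not at hzx
    refine le_trans ?_ (mul_le_mul_of_nonneg_right (le_max_right _ _) (sq_nonneg _))
    have h1 := real_inner_le_norm (gradient (S.psiBar i t) x) (z - x)
    have h2 := mul_le_mul_of_nonneg_right (H.norm_gradient_le i ht hx) (norm_nonneg (z - x))
    have h3 : S.LBar * ‖z - x‖ ≤ S.LBar / (S.rho0 / 2) * ‖z - x‖ ^ 2 := by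
      rw [div_mul_eq_mul_div, le_div_iff₀ hρ]
      have : 0 ≤ S.LBar * ‖z - x‖ := by positivity
      nlinarith
    linarith

/-- The normal cones of the truncated sets are uniformly hypomonotone. -/
theorem exists_inner_le_of_mem_clarkeNormalCone (H : S.StandingHyp) : ∃ κ, 0 ≤ κ ∧
    ∀ t ∈ Icc 0 S.T, ∀ x ∈ S.CTrunc t, ∀ z ∈ S.CTrunc t, ∀ ξ ∈ clarkeNormalCone (S.CTrunc t) x,
    inner ℝ ξ (z - x) ≤ κ * ‖ξ‖ * ‖z - x‖ ^ 2 := by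
  obtain ⟨c, hc, hcb⟩ := H.exists_inner_gradient_le
  have hη := H.eta_pos
  refine ⟨c / S.eta, by positivity, fun t ht x hx z hz ξ hξ => ?_⟩
  rcases eq_or_ne z x with rfl | hne
  · simp
  have hpos : 0 < ‖z - x‖ := norm_pos_iff.2 (sub_ne_zero.2 hne)
  obtain ⟨d, hd1, hd⟩ := exists_descent_direction (S.active t x)
    (fun i => gradient (S.psiBar i t) x) (c := 2 * S.eta) (by positivity)
    (H.param.2.2.2.2.2.2 t ht x hx)
  -- The correction has slope at most −2c‖z − x‖² against each active gradient, twice the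
  -- semiconvexity error, so the corrected vector is a strict descent direction. Testing ξ against
  -- it gives the estimate.
  have htan := H.mem_clarkeTangentCone_CTrunc ht hx
    (v := (z - x) + (c / S.eta * ‖z - x‖ ^ 2) • d) (fun i hi => by
      rw [inner_add_right, inner_smul_right]
      have h1 := hcb t ht x hx z hz i hi
      have h2 : c / S.eta * ‖z - x‖ ^ 2 * inner ℝ (gradient (S.psiBar i t) x) d
          ≤ c / S.eta * ‖z - x‖ ^ 2 * -(2 * S.eta) :=
        mul_le_mul_of_nonneg_left (hd i hi) (by positivity)
      have h3 : c / S.eta * ‖z - x‖ ^ 2 * -(2 * S.eta) = -(2 * (c * ‖z - x‖ ^ 2)) := by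
        field_simp
      have h4 : 0 < c * ‖z - x‖ ^ 2 := by positivity
      linarith)
  have h1 := hξ.2 _ htan
  rw [inner_add_right, inner_smul_right] at h1
  have h2 := neg_le_of_abs_le (abs_real_inner_le_norm ξ d)
  have h3 : ‖ξ‖ * ‖d‖ ≤ ‖ξ‖ := mul_le_of_le_one_right (norm_nonneg _) hd1
  have h4 : c / S.eta * ‖z - x‖ ^ 2 * -‖ξ‖ ≤ c / S.eta * ‖z - x‖ ^ 2 * inner ℝ ξ d :=
    mul_le_mul_of_nonneg_left (by linarith) (by positivity)
  linarith

end StandingHyp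
end Data
end SweepingProcess

/-! ### Invariant sets of the penalized system -/

namespace SweepingProcess

theorem abs_exp_sub_exp_le {a b : ℝ} (ha : a ≤ 0) (hb : b ≤ 0) :
    |Real.exp a - Real.exp b| ≤ |a - b| := by
  have key : ∀ {a b : ℝ}, a ≤ b → b ≤ 0 → |Real.exp a - Real.exp b| ≤ |a - b| := by
    intro a b hab hb
    rw [abs_sub_comm, abs_sub_comm a b, abs_of_nonneg (by linarith [Real.exp_le_exp.2 hab]),
      abs_of_nonneg (by linarith)]
    have h1 := Real.add_one_le_exp (a - b)
    have h2 : Real.exp a = Real.exp b * Real.exp (a - b) := by rw [← Real.exp_add]; ring_nf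
    have h3 : Real.exp b ≤ 1 := Real.exp_le_one_iff.2 hb
    have h4 := Real.exp_pos b
    nlinarith
  rcases le_total a b with h | h
  · exact key h hb
  · rw [abs_sub_comm, abs_sub_comm a b]; exact key h ha

namespace Data

variable {n l m r : ℕ} {S : Data n l m r}

/-- Right-hand side of the `x`-equation of the penalized system. -/
noncomputable def penRhsX (S : Data n l m r) (γ : ℝ) (u : ℝ → Euc m) (t : ℝ) (x : Euc n)
    (y : Euc l) : Euc n :=
  S.f t x y (u t) - ∑ i, (γ * Real.exp (γ * S.psiBar i t x)) • gradient (S.psiBar i t) x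

/-- Right-hand side of the `y`-equation of the penalized system. -/
noncomputable def penRhsY (S : Data n l m r) (γ : ℝ) (u : ℝ → Euc m) (t : ℝ) (x : Euc n)
    (y : Euc l) : Euc l :=
  S.g t x y (u t) - (γ * Real.exp (γ * S.phi t y)) • gradient (S.phi t) y

/-- The sum of the exponentials that defines `C̄^γ(t)`. -/
noncomputable def expSum (S : Data n l m r) (γ t : ℝ) (x : Euc n) : ℝ :=
  ∑ i, Real.exp (γ * S.psiBar i t x)

/-- The level `2 μ̄ / (η̄² γ)`. -/
noncomputable def level (S : Data n l m r) (γ : ℝ) : ℝ := 2 * S.muBar / (S.eta ^ 2 * γ)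

/-- The parameter `γ` is large enough. -/
structure Admissible (S : Data n l m r) (γ : ℝ) : Prop where
  pos : 0 < γ
  level_lt : S.level γ < 1
  eta_sq_le : S.eta ^ 2 ≤ S.delta ^ 2 - 2 * S.alphaBar γ
  cq : ∀ t ∈ Icc 0 S.T, ∀ x ∈ S.CTrunc t, S.level γ ≤ S.expSum γ t x →
    S.eta * S.expSum γ t x
      ≤ ‖∑ i, Real.exp (γ * S.psiBar i t x) • gradient (S.psiBar i t) x‖

namespace StandingHyp

theorem level_pos (H : S.StandingHyp) {γ : ℝ} (hγ : 0 < γ) : 0 < S.level γ := by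
  have := H.muBar_pos; have := H.eta_pos
  unfold level; positivity

/-- The role of ᾱ: a single exponential reaches the level exactly where its generator equals −ᾱ.
This translates the bound on the sum into ψ_i ≤ −ᾱ, and matches the ball of radius ρ̄ with φ ≤ −ᾱ.
-/
theorem exp_neg_alphaBar (H : S.StandingHyp) {γ : ℝ} (hγ : 0 < γ) :
    Real.exp (γ * -S.alphaBar γ) = S.level γ := by
  have h1 := H.muBar_pos; have h2 := H.eta_pos
  have e : γ * -S.alphaBar γ = Real.log (S.level γ) := by
    have : S.level γ = (S.eta ^ 2 * γ / (2 * S.muBar))⁻¹ := by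
      unfold level; rw [inv_div]
    rw [this, Real.log_inv, alphaBar]; field_simp
  rw [e, Real.exp_log (H.level_pos hγ)]

theorem alphaBar_pos (H : S.StandingHyp) {γ : ℝ} (hγ : S.Admissible γ) : 0 < S.alphaBar γ := by
  have h := hγ.level_lt
  rw [← H.exp_neg_alphaBar hγ.pos, Real.exp_lt_one_iff] at h
  nlinarith [hγ.pos]

theorem phi_le_iff {γ : ℝ} (hγ : S.Admissible γ) {t : ℝ} {y : Euc l} :
    y ∈ closedBall (S.ybar t) (S.rhoBar γ) ↔ S.phi t y ≤ -S.alphaBar γ := by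
  rw [mem_closedBall, dist_eq_norm, rhoBar, phi, Real.le_sqrt (norm_nonneg _)
    ((sq_nonneg _).trans hγ.eta_sq_le)]
  constructor <;> intro h <;> linarith

theorem psiBar_neg_of_expSum_lt {γ : ℝ} (hγ : 0 < γ) {t : ℝ} {x : Euc n}
    (h : S.expSum γ t x < 1) (i : Fin (r + 1)) : S.psiBar i t x < 0 := by
  have h1 : Real.exp (γ * S.psiBar i t x) ≤ S.expSum γ t x :=
    Finset.single_le_sum (f := fun i => Real.exp (γ * S.psiBar i t x))
      (fun i _ => (Real.exp_pos _).le) (Finset.mem_univ i)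
  have h2 := Real.exp_lt_one_iff.1 (h1.trans_lt h)
  exact neg_of_mul_neg_right h2 hγ.le

theorem psiBar_le_of_mem_CPen (H : S.StandingHyp) {γ : ℝ} (hγ : S.Admissible γ) {t : ℝ}
    {x : Euc n} (h : x ∈ S.CPen γ t) (i : Fin (r + 1)) : S.psiBar i t x ≤ -S.alphaBar γ := by
  have h1 : Real.exp (γ * S.psiBar i t x) ≤ S.expSum γ t x :=
    Finset.single_le_sum (f := fun i => Real.exp (γ * S.psiBar i t x))
      (fun i _ => (Real.exp_pos _).le) (Finset.mem_univ i)
  have h2 : S.expSum γ t x ≤ S.level γ := h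
  have h3 := h1.trans h2
  rw [← H.exp_neg_alphaBar hγ.pos, Real.exp_le_exp] at h3
  exact le_of_mul_le_mul_left h3 hγ.pos

theorem CPen_subset (H : S.StandingHyp) {γ : ℝ} (hγ : S.Admissible γ) (t : ℝ) :
    S.CPen γ t ⊆ S.CTrunc t := fun _ hx =>
  H.mem_CTrunc_iff.2 fun i => (H.psiBar_le_of_mem_CPen hγ hx i).trans
    (by linarith [H.alphaBar_pos hγ])

theorem mem_closedBall_of_phi_le (H : S.StandingHyp) {t : ℝ} {y : Euc l} (h : S.phi t y ≤ 0) :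
    y ∈ closedBall (S.ybar t) S.delta := by
  rw [mem_closedBall, dist_eq_norm, ← pow_le_pow_iff_left₀ (norm_nonneg _) H.delta_pos.le
    two_ne_zero]
  unfold phi at h; linarith

theorem norm_sub_ybar_lt (H : S.StandingHyp) {t : ℝ} {y : Euc l} (h : S.phi t y < 0) :
    ‖y - S.ybar t‖ < S.delta := by
  rw [← pow_lt_pow_iff_left₀ (norm_nonneg _) H.delta_pos.le two_ne_zero]
  unfold phi at h; linarith

theorem CTrunc_prod_subset (H : S.StandingHyp) {t : ℝ} {x : Euc n} {y : Euc l}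
    (hx : x ∈ S.CTrunc t) (hy : y ∈ closedBall (S.ybar t) S.delta) : (x, y) ∈ S.N S.delta S.delta t :=
  ⟨H.CTrunc_subset t hx, hy⟩

/-- Bounds on the data, separately for `f` and `g`. -/
theorem ae_bounds (H : S.StandingHyp) : ∀ᵐ t, t ∈ Icc 0 S.T →
    (∀ x y, (x, y) ∈ S.N S.delta S.delta t → ∀ u ∈ S.U t,
      ‖S.f t x y u‖ ≤ S.Mh ∧ ‖S.g t x y u‖ ≤ S.Mh) ∧
    (∀ x y x' y', (x, y) ∈ S.N S.delta S.delta t → (x', y') ∈ S.N S.delta S.delta t →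
      ∀ u ∈ S.U t,
      ‖S.f t x y u - S.f t x' y' u‖ ≤ S.Lh t * (‖x - x'‖ + ‖y - y'‖) ∧
      ‖S.g t x y u - S.g t x' y' u‖ ≤ S.Lh t * (‖x - x'‖ + ‖y - y'‖)) := by
  have h := (ae_restrict_iff' measurableSet_Icc).1 H.a41.2.2.2.2.2
  filter_upwards [h] with t ht htI
  refine ⟨fun x y hp u hu => ?_, fun x y x' y' hp hp' u hu => ?_⟩
  · have := (ht htI _ hp _ hp u hu).1
    exact ⟨(WithLp.norm_fst_le _ _).trans this, (WithLp.norm_snd_le _ _).trans this⟩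
  · have h1 := (ht htI _ hp _ hp' u hu).2
    have h2 : ‖WithLp.toLp 2 (x - x', y - y')‖ ≤ ‖x - x'‖ + ‖y - y'‖ := by
      rw [← pow_le_pow_iff_left₀ (norm_nonneg _) (by positivity) two_ne_zero,
        WithLp.prod_norm_sq_eq_of_L2]
      have := mul_nonneg (norm_nonneg (x - x')) (norm_nonneg (y - y'))
      change ‖x - x'‖ ^ 2 + ‖y - y'‖ ^ 2 ≤ _
      nlinarith
    have h3 := h1.trans (mul_le_mul_of_nonneg_left h2 (H.a41.2.2.2.1 t htI))
    exact ⟨(WithLp.norm_fst_le _ _).trans h3, (WithLp.norm_snd_le _ _).trans h3⟩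

theorem ae_mem_of_isControl {u : ℝ → Euc m} (hu : S.IsControl u) :
    ∀ᵐ t, t ∈ Icc 0 S.T → u t ∈ S.U t := (ae_restrict_iff' measurableSet_Icc).1 hu.2

/-- The dissipation inequality behind the invariance of `C̄^γ(t)`. -/
theorem sum_dissipation_nonpos (H : S.StandingHyp) {γ : ℝ} (hγ : S.Admissible γ) {t : ℝ}
    (ht : t ∈ Icc 0 S.T) {x v : Euc n} (hx : x ∈ S.CTrunc t) (hv : ‖v‖ ≤ S.Mh)
    (hW : S.level γ ≤ S.expSum γ t x) :
    ∑ i, Real.exp (γ * S.psiBar i t x) * (γ * (S.LBar + inner ℝ (gradient (S.psiBar i t) x)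
      (v - ∑ j, (γ * Real.exp (γ * S.psiBar j t x)) • gradient (S.psiBar j t) x))) ≤ 0 := by
  have hγ0 := hγ.pos
  have hμ := H.muBar_pos
  have hη := H.eta_pos
  set e : Fin (r + 1) → ℝ := fun i => Real.exp (γ * S.psiBar i t x) with he
  set g : Fin (r + 1) → Euc n := fun i => gradient (S.psiBar i t) x with hg
  set W := S.expSum γ t x
  have hWe : ∑ i, e i = W := rfl
  set V := ∑ i, e i • g i with hV
  have he0 : ∀ i, 0 ≤ e i := fun i => (Real.exp_pos _).le
  have hcq : S.eta * W ≤ ‖V‖ := hγ.cq t ht x hx hW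
  have hWpos : 0 < W := (H.level_pos hγ0).trans_le hW
  have hsum : ∑ j, (γ * Real.exp (γ * S.psiBar j t x)) • gradient (S.psiBar j t) x = γ • V := by
    rw [hV, Finset.smul_sum]; exact Finset.sum_congr rfl fun i _ => by rw [mul_smul]
  rw [hsum]
  -- Time dependence and drift together contribute at most L̄ + L̄M_h = μ̄; the penalty contributes
  -- a term that sums to −γ‖V‖².
  have hterm : ∀ i, e i * (γ * (S.LBar + inner ℝ (g i) (v - γ • V)))
      ≤ γ * (e i * S.muBar) - γ * (γ * inner ℝ (e i • g i) V) := by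
    intro i
    rw [inner_sub_right, inner_smul_right, real_inner_smul_left]
    have h1 : inner ℝ (g i) v ≤ S.LBar * S.Mh := (real_inner_le_norm _ _).trans
      (mul_le_mul (H.norm_gradient_le i ht hx) hv (norm_nonneg _) H.LBar_pos.le)
    have h2 : S.muBar = S.LBar + S.LBar * S.Mh := by unfold muBar; ring
    have h3 : 0 ≤ γ * e i := mul_nonneg hγ0.le (he0 i)
    rw [h2]
    nlinarith [mul_le_mul_of_nonneg_left h1 h3]
  have htot : ∑ i, e i * (γ * (S.LBar + inner ℝ (g i) (v - γ • V)))
      ≤ γ * (W * S.muBar) - γ * (γ * ‖V‖ ^ 2) := by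
    refine (Finset.sum_le_sum fun i _ => hterm i).trans (le_of_eq ?_)
    rw [Finset.sum_sub_distrib, ← Finset.mul_sum, ← Finset.mul_sum, ← Finset.mul_sum,
      ← Finset.sum_mul, hWe, ← sum_inner, ← hV, real_inner_self_eq_norm_sq]
  refine htot.trans ?_
  have h1 : (S.eta * W) ^ 2 ≤ ‖V‖ ^ 2 := pow_le_pow_left₀ (by positivity) hcq 2
  have h2 : 2 * S.muBar ≤ S.eta ^ 2 * γ * W := by
    have := hW; unfold level at this
    rw [div_le_iff₀ (by positivity)] at this; linarith
  -- From ‖V‖ ≥ η̄W and γη̄²W ≥ 2μ̄ the dissipation is at least 2μ̄W, twice what is needed.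
  have h3 : W * S.muBar ≤ γ * ‖V‖ ^ 2 := by
    have : W * S.muBar ≤ W * (S.eta ^ 2 * γ * W) := by
      refine mul_le_mul_of_nonneg_left ?_ hWpos.le; linarith
    nlinarith
  nlinarith

theorem abs_expSum_sub_le (H : S.StandingHyp) {γ : ℝ} (hγ : 0 < γ) {s t : ℝ}
    (hs : s ∈ Icc 0 S.T) (ht : t ∈ Icc 0 S.T) {x z : Euc n} (hx : x ∈ S.CTrunc s)
    (hz : z ∈ S.CTrunc t) :
    |S.expSum γ s x - S.expSum γ t z| ≤ (r + 1) * γ * S.LBar * (|s - t| + ‖x - z‖) := by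
  unfold expSum
  rw [← Finset.sum_sub_distrib]
  refine (Finset.abs_sum_le_sum_abs _ _).trans ?_
  have : ∀ i ∈ (Finset.univ : Finset (Fin (r + 1))),
      |Real.exp (γ * S.psiBar i s x) - Real.exp (γ * S.psiBar i t z)|
        ≤ γ * (S.LBar * (|s - t| + ‖x - z‖)) := fun i _ => by
    have h1 := H.mem_CTrunc_iff.1 hx i
    have h2 := H.mem_CTrunc_iff.1 hz i
    refine (abs_exp_sub_exp_le (by nlinarith) (by nlinarith)).trans ?_
    rw [← mul_sub, abs_mul, abs_of_pos hγ]
    exact mul_le_mul_of_nonneg_left (H.abs_psiBar_sub_le i hs ht hx hz) hγ.le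
  refine (Finset.sum_le_sum this).trans (le_of_eq ?_)
  simp; ring

theorem abs_phi_sub_le {s t : ℝ} {y z : Euc l} (hy : ‖y - S.ybar s‖ ≤ S.delta)
    (hz : ‖z - S.ybar t‖ ≤ S.delta) (H : S.StandingHyp) (hs : s ∈ Icc 0 S.T)
    (ht : t ∈ Icc 0 S.T) :
    |S.phi s y - S.phi t z| ≤ S.LBar * (|s - t| + ‖y - z‖) := by
  refine (abs_half_norm_sq_sub_le hy hz).trans ?_
  have h1 : ‖(y - S.ybar s) - (z - S.ybar t)‖ ≤ ‖y - z‖ + S.Lxy * |s - t| := by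
    rw [show (y - S.ybar s) - (z - S.ybar t) = (y - z) - (S.ybar s - S.ybar t) by abel]
    exact norm_sub_le_of_le le_rfl (H.norm_ybar_sub_le hs ht)
  have h2 : ‖y - z‖ + S.Lxy * |s - t| ≤ S.Lxy * (|s - t| + ‖y - z‖) := by
    nlinarith [H.one_le_Lxy, norm_nonneg (y - z)]
  have h3 : 0 ≤ |s - t| + ‖y - z‖ := by positivity
  calc S.delta * _ ≤ S.delta * (S.Lxy * (|s - t| + ‖y - z‖)) :=
        mul_le_mul_of_nonneg_left (h1.trans h2) H.delta_pos.le
    _ = S.delta * S.Lxy * (|s - t| + ‖y - z‖) := by ring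
    _ ≤ _ := mul_le_mul_of_nonneg_right delta_mul_Lxy_le h3

/-- Short-time invariance: as long as the trajectory stays in the region where the penalty is
controlled, it does not leave the sublevel sets. -/
theorem invariant_step (H : S.StandingHyp) {γ : ℝ} (hγ : S.Admissible γ) {u : ℝ → Euc m}
    (hu : S.IsControl u) {a b : ℝ} (ha : 0 ≤ a) (hab : a ≤ b) (hb : b ≤ S.T)
    {x : ℝ → Euc n} {y : ℝ → Euc l} (hx : AbsolutelyContinuousOnInterval x a b)
    (hy : AbsolutelyContinuousOnInterval y a b)
    (hode : ∀ᵐ t, t ∈ Ioo a b → HasDerivAt x (S.penRhsX γ u t (x t) (y t)) t ∧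
      HasDerivAt y (S.penRhsY γ u t (x t) (y t)) t)
    (hxr : ∀ t ∈ Icc a b, S.expSum γ t (x t) < 1) (hyr : ∀ t ∈ Icc a b, S.phi t (y t) < 0)
    (hxa : S.expSum γ a (x a) ≤ S.level γ) (hya : S.phi a (y a) ≤ -S.alphaBar γ) :
    ∀ t ∈ Icc a b, S.expSum γ t (x t) ≤ S.level γ ∧ S.phi t (y t) ≤ -S.alphaBar γ := by
  have hγ0 := hγ.pos
  have hI : ∀ t ∈ Icc a b, t ∈ Icc 0 S.T := fun t ht => ⟨ha.trans ht.1, ht.2.trans hb⟩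
  have hxneg : ∀ t ∈ Icc a b, ∀ i, S.psiBar i t (x t) < 0 := fun t ht =>
    psiBar_neg_of_expSum_lt hγ0 (hxr t ht)
  have hxC : ∀ t ∈ Icc a b, x t ∈ S.CTrunc t := fun t ht =>
    H.mem_CTrunc_iff.2 fun i => (hxneg t ht i).le
  have hyB : ∀ t ∈ Icc a b, ‖y t - S.ybar t‖ < S.delta := fun t ht => H.norm_sub_ybar_lt (hyr t ht)
  have huIcc : uIcc a b = Icc a b := uIcc_of_le hab
  have hψac : ∀ i, AbsolutelyContinuousOnInterval (fun t => S.psiBar i t (x t)) a b := fun i =>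
    absolutelyContinuousOnInterval_of_dist_le (C := S.LBar)
      (absolutelyContinuousOnInterval_id a b) hx fun s hs t ht => by
        rw [huIcc] at hs ht
        rw [Real.dist_eq, Real.dist_eq, dist_eq_norm]
        exact H.abs_psiBar_sub_le i (hI s hs) (hI t ht) (hxC s hs) (hxC t ht)
  have hWac : AbsolutelyContinuousOnInterval (fun t => S.expSum γ t (x t)) a b :=
    absolutelyContinuousOnInterval_of_dist_le (C := (r + 1) * γ * S.LBar)
      (absolutelyContinuousOnInterval_id a b) hx fun s hs t ht => by
        rw [huIcc] at hs ht
        rw [Real.dist_eq, Real.dist_eq, dist_eq_norm]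
        exact H.abs_expSum_sub_le hγ0 (hI s hs) (hI t ht) (hxC s hs) (hxC t ht)
  have hφac : AbsolutelyContinuousOnInterval (fun t => S.phi t (y t)) a b :=
    absolutelyContinuousOnInterval_of_dist_le (C := S.LBar)
      (absolutelyContinuousOnInterval_id a b) hy fun s hs t ht => by
        rw [huIcc] at hs ht
        rw [Real.dist_eq, Real.dist_eq, dist_eq_norm]
        exact abs_phi_sub_le (hyB s hs).le (hyB t ht).le H (hI s hs) (hI t ht)
  -- The sign of the derivative matters only at times when the sum exceeds the level, which is where
  -- the qualification is available.
  have hxW := le_of_ae_deriv_nonpos_above hWac hxa (by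
    filter_upwards [hode, H.ae_bounds, ae_mem_of_isControl hu,
      ae_all_iff.2 fun i => (hψac i).ae_differentiableAt] with t h1 h2 h3 h4 htI hlt
    have htc : t ∈ Icc a b := Ioo_subset_Icc_self htI
    have htT := hI t htc
    obtain ⟨hdx, -⟩ := h1 htI
    have hf := ((h2 htT).1 (x t) (y t) (H.CTrunc_prod_subset (hxC t htc)
      (H.mem_closedBall_of_phi_le (hyr t htc).le)) _ (h3 htT)).1
    have hdi : ∀ i, DifferentiableAt ℝ (fun s => S.psiBar i s (x s)) t := fun i =>
      h4 i (by rw [huIcc]; exact htc)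
    have hle : ∀ i, deriv (fun s => S.psiBar i s (x s)) t
        ≤ S.LBar + inner ℝ (gradient (S.psiBar i t) (x t)) (S.penRhsX γ u t (x t) (y t)) := by
      intro i
      -- The values at (s, x s) and (t, x s) are compared, so x s must also lie in the truncated set
      -- at time t. Strict negativity at (t, x t) ensures this for s near t.
      refine deriv_comp_le_of_lipschitz_time ?_ hdx
        (H.differentiableAt_psiBar_self i htT (hxC t htc)) (hdi i)
      filter_upwards [Ioo_mem_nhds htI.1 htI.2,
        hdx.continuousAt.eventually (H.CTrunc_mem_nhds htT (hxneg t htc))] with s hs hs2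
      have hsc := Ioo_subset_Icc_self hs
      simpa using H.abs_psiBar_sub_le i (hI s hsc) htT (hxC s hsc) hs2
    have hder : HasDerivAt (fun s => S.expSum γ s (x s))
        (∑ i, Real.exp (γ * S.psiBar i t (x t)) * (γ * deriv (fun s => S.psiBar i s (x s)) t)) t :=
      HasDerivAt.fun_sum fun i _ => ((hdi i).hasDerivAt.const_mul γ).exp
    rw [hder.deriv]
    refine le_trans (Finset.sum_le_sum fun i _ => ?_)
      (H.sum_dissipation_nonpos hγ htT (hxC t htc) hf hlt.le)
    exact mul_le_mul_of_nonneg_left (mul_le_mul_of_nonneg_left (hle i) hγ0.le) (Real.exp_pos _).le)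
  have hyW := le_of_ae_deriv_nonpos_above hφac hya (by
    filter_upwards [hode, H.ae_bounds, ae_mem_of_isControl hu, hφac.ae_differentiableAt]
      with t h1 h2 h3 h4 htI hlt
    have htc : t ∈ Icc a b := Ioo_subset_Icc_self htI
    have htT := hI t htc
    obtain ⟨-, hdy⟩ := h1 htI
    have hg := ((h2 htT).1 (x t) (y t) (H.CTrunc_prod_subset (hxC t htc)
      (H.mem_closedBall_of_phi_le (hyr t htc).le)) _ (h3 htT)).2
    have hle := deriv_comp_le_of_lipschitz_time (ψ := S.phi) (L := S.LBar) (by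
      have hev : ∀ᶠ s in 𝓝 t, ‖y s - S.ybar t‖ < S.delta :=
        (hdy.continuousAt.sub continuousAt_const).norm.eventually_lt continuousAt_const (hyB t htc)
      filter_upwards [Ioo_mem_nhds htI.1 htI.2, hev] with s hs hs2
      have hsc := Ioo_subset_Icc_self hs
      simpa using abs_phi_sub_le (hyB s hsc).le hs2.le H (hI s hsc) htT) hdy
      (differentiableAt_phi t (y t)) (h4 (by rw [huIcc]; exact htc))
    refine hle.trans ?_
    rw [gradient_phi, penRhsY, gradient_phi, inner_sub_right, inner_smul_right,
      real_inner_self_eq_norm_sq]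
    have h5 : inner ℝ (y t - S.ybar t) (S.g t (x t) (y t) (u t)) ≤ S.LBar * S.Mh :=
      (real_inner_le_norm _ _).trans (mul_le_mul ((hyB t htc).le.trans H.delta_le) hg
        (norm_nonneg _) H.LBar_pos.le)
    -- Above the level −ᾱ the distance to ȳ exceeds ρ̄ ≥ η̄. The inward term is then at least
    -- γ·level·η̄² = 2μ̄, against an outward growth of at most μ̄.
    have h6 : S.eta ^ 2 ≤ ‖y t - S.ybar t‖ ^ 2 := by
      have := hγ.eta_sq_le
      have e : S.phi t (y t) = (‖y t - S.ybar t‖ ^ 2 - S.delta ^ 2) / 2 := rfl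
      linarith
    have h7 : S.level γ ≤ Real.exp (γ * S.phi t (y t)) := by
      rw [← H.exp_neg_alphaBar hγ0, Real.exp_le_exp]
      exact mul_le_mul_of_nonneg_left hlt.le hγ0.le
    have h8 : γ * S.level γ * S.eta ^ 2 = 2 * S.muBar := by
      have := H.eta_pos.ne'; unfold level; field_simp
    have h9 : γ * S.level γ * S.eta ^ 2
        ≤ γ * Real.exp (γ * S.phi t (y t)) * ‖y t - S.ybar t‖ ^ 2 :=
      mul_le_mul (mul_le_mul_of_nonneg_left h7 hγ0.le) h6 (sq_nonneg _)
        (mul_nonneg hγ0.le (Real.exp_pos _).le)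
    have h10 : S.muBar = S.LBar + S.LBar * S.Mh := by unfold muBar; ring
    have := H.muBar_pos
    linarith)
  exact fun t ht => ⟨hxW t ht, hyW t ht⟩

/-- Invariance of the sets `C̄^γ(t)` and of the balls of radius `ρ̄` around `ȳ(t)` under the penalized
system. -/
theorem invariant (H : S.StandingHyp) {γ : ℝ} (hγ : S.Admissible γ) {u : ℝ → Euc m}
    (hu : S.IsControl u) {a b : ℝ} (ha : 0 ≤ a) (hab : a ≤ b) (hb : b ≤ S.T)
    {x : ℝ → Euc n} {y : ℝ → Euc l} (hx : AbsolutelyContinuousOnInterval x a b)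
    (hy : AbsolutelyContinuousOnInterval y a b)
    (hode : ∀ᵐ t, t ∈ Ioo a b → HasDerivAt x (S.penRhsX γ u t (x t) (y t)) t ∧
      HasDerivAt y (S.penRhsY γ u t (x t) (y t)) t)
    (hxa : x a ∈ S.CPen γ a) (hya : y a ∈ closedBall (S.ybar a) (S.rhoBar γ)) :
    ∀ t ∈ Icc a b, x t ∈ S.CPen γ t ∧ y t ∈ closedBall (S.ybar t) (S.rhoBar γ) := by
  have hIsub : Icc a b ⊆ Icc 0 S.T := Icc_subset_Icc ha hb
  have hxc : ContinuousOn x (Icc a b) := by simpa [uIcc_of_le hab] using hx.continuousOn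
  have hyc : ContinuousOn y (Icc a b) := by simpa [uIcc_of_le hab] using hy.continuousOn
  have hWc : ContinuousOn (fun t => S.expSum γ t (x t)) (Icc a b) :=
    continuousOn_finsetSum _ fun i _ =>
      ((H.continuousOn_psiBar_comp i hIsub hxc).const_smul γ).rexp
  have hφc : ContinuousOn (fun t => S.phi t (y t)) (Icc a b) :=
    (((hyc.sub (H.continuousOn_ybar.mono hIsub)).norm.pow 2).sub continuousOn_const).div_const 2
  set s : Set ℝ := {t | S.expSum γ t (x t) ≤ S.level γ ∧ S.phi t (y t) ≤ -S.alphaBar γ}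
  have hsc : IsClosed (s ∩ Icc a b) := by
    have : s ∩ Icc a b = (Icc a b ∩ (fun t => S.expSum γ t (x t)) ⁻¹' Iic (S.level γ)) ∩
        (Icc a b ∩ (fun t => S.phi t (y t)) ⁻¹' Iic (-S.alphaBar γ)) := by
      ext t; simp only [s, mem_inter_iff, mem_ofPred_eq, mem_preimage, mem_Iic]; tauto
    rw [this]
    exact (hWc.preimage_isClosed_of_isClosed isClosed_Icc isClosed_Iic).inter
      (hφc.preimage_isClosed_of_isClosed isClosed_Icc isClosed_Iic)
  -- Continuous induction: the good times form a closed set, and since level < 1 and −ᾱ < 0 a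
  -- trajectory at a good time remains for a while in the region where the short-time statement
  -- applies.
  have hsub : Icc a b ⊆ s := by
    refine hsc.Icc_subset_of_forall_exists_gt ⟨hxa, (phi_le_iff hγ).1 hya⟩ ?_
    rintro t ⟨hts, ht⟩ τ hτ
    have htI : t ∈ Icc a b := Ico_subset_Icc_self ht
    have e1 : ∀ᶠ q in 𝓝[Icc a b] t, S.expSum γ q (x q) < 1 :=
      (hWc t htI).eventually (gt_mem_nhds (hts.1.trans_lt hγ.level_lt))
    have e2 : ∀ᶠ q in 𝓝[Icc a b] t, S.phi q (y q) < 0 :=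
      (hφc t htI).eventually (gt_mem_nhds (hts.2.trans_lt (by linarith [H.alphaBar_pos hγ])))
    obtain ⟨ρ, hρ, hb2⟩ := Metric.mem_nhdsWithin_iff.1 (e1.and e2)
    set c := min (t + ρ / 2) (min τ b)
    have htc : t < c := lt_min (by linarith) (lt_min hτ ht.2)
    have hcb : c ≤ b := (min_le_right _ _).trans (min_le_right _ _)
    have hreg : ∀ q ∈ Icc t c, S.expSum γ q (x q) < 1 ∧ S.phi q (y q) < 0 := fun q hq =>
      hb2 ⟨by
        rw [mem_ball, Real.dist_eq, abs_of_nonneg (by linarith [hq.1])]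
        have : c ≤ t + ρ / 2 := min_le_left _ _
        linarith [hq.2], htI.1.trans hq.1, hq.2.trans hcb⟩
    refine ⟨c, ?_, htc, (min_le_right _ _).trans (min_le_left _ _)⟩
    exact H.invariant_step hγ hu (ha.trans htI.1) htc.le (hcb.trans hb)
      (mono_uIcc hx htI.1 htc.le hcb) (mono_uIcc hy htI.1 htc.le hcb)
      (by
        filter_upwards [hode] with q hq hqI
        exact hq ⟨htI.1.trans_lt hqI.1, hqI.2.trans_le hcb⟩)
      (fun q hq => (hreg q hq).1) (fun q hq => (hreg q hq).2) hts.1 hts.2 c ⟨htc.le, le_rfl⟩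
  exact fun t ht => ⟨(hsub ht).1, (phi_le_iff hγ).2 (hsub ht).2⟩

end StandingHyp
end Data
end SweepingProcess

/-! ### Uniqueness, measurability and uniform estimates -/

namespace SweepingProcess

theorem ae_leb_of_forall_Ioo {T : ℝ} {P : ℝ → Prop} (h : ∀ᵐ t, t ∈ Ioo 0 T → P t) :
    ∀ᵐ t ∂(leb T), P t := by
  unfold leb
  rw [← Measure.restrict_congr_set Ioo_ae_eq_Icc]
  exact (ae_restrict_iff' measurableSet_Ioo).2 h

theorem forall_Ioo_of_ae_leb {T : ℝ} {P : ℝ → Prop} (h : ∀ᵐ t ∂(leb T), P t) :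
    ∀ᵐ t, t ∈ Ioo 0 T → P t := by
  filter_upwards [(ae_restrict_iff' measurableSet_Icc).1 h] with t ht htI
  exact ht (Ioo_subset_Icc_self htI)

theorem absolutelyContinuousOnInterval_half_norm_sq {E : Type*} [NormedAddCommGroup E]
    [NormedSpace ℝ E] {z : ℝ → E} {a b : ℝ} (hz : AbsolutelyContinuousOnInterval z a b) :
    AbsolutelyContinuousOnInterval (fun t => (‖z t‖ ^ 2 - 0) / 2) a b := by
  obtain ⟨R, hR⟩ := hz.exists_bound
  refine absolutelyContinuousOnInterval_of_dist_le (C := R) hz hz fun s hs t ht => ?_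
  rw [Real.dist_eq, dist_eq_norm]
  have h1 := abs_half_norm_sq_sub_le (c := 0) (hR s hs) (hR t ht)
  have h2 : 0 ≤ R * ‖z s - z t‖ := (abs_nonneg _).trans h1
  linarith

/-- Uniqueness for systems with a one-sided Lipschitz condition. -/
theorem eqOn_of_ae_inner_le {E F : Type*} [NormedAddCommGroup E] [InnerProductSpace ℝ E]
    [NormedAddCommGroup F] [InnerProductSpace ℝ F] {T : ℝ} (hT : 0 ≤ T) {x x' : ℝ → E}
    {y y' : ℝ → F} {a : ℝ → ℝ}
    (hx : AbsolutelyContinuousOnInterval x 0 T) (hx' : AbsolutelyContinuousOnInterval x' 0 T)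
    (hy : AbsolutelyContinuousOnInterval y 0 T) (hy' : AbsolutelyContinuousOnInterval y' 0 T)
    (ha : IntervalIntegrable a volume 0 T) (hx0 : x 0 = x' 0) (hy0 : y 0 = y' 0)
    (h : ∀ᵐ t, t ∈ Ioo 0 T → ∃ v v' w w', HasDerivAt x v t ∧ HasDerivAt x' v' t ∧
      HasDerivAt y w t ∧ HasDerivAt y' w' t ∧
      inner ℝ (x t - x' t) (v - v') + inner ℝ (y t - y' t) (w - w')
        ≤ a t * (‖x t - x' t‖ ^ 2 + ‖y t - y' t‖ ^ 2)) :
    EqOn x x' (Icc 0 T) ∧ EqOn y y' (Icc 0 T) := by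
  -- Half the squared distance satisfies D' ≤ 2aD with D(0) = 0, so it vanishes by Gronwall.
  set D : ℝ → ℝ := fun t => (‖(x - x') t‖ ^ 2 - 0) / 2 + (‖(y - y') t‖ ^ 2 - 0) / 2 with hDdef
  have hD : AbsolutelyContinuousOnInterval D 0 T :=
    (absolutelyContinuousOnInterval_half_norm_sq (hx.sub hx')).add
      (absolutelyContinuousOnInterval_half_norm_sq (hy.sub hy'))
  have hle := nonpos_of_ae_deriv_le_mul hT hD (ha.const_mul 2) (by simp [D, hx0, hy0]) (by
    filter_upwards [h] with t ht htI
    obtain ⟨v, v', w, w', h1, h2, h3, h4, hin⟩ := ht htI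
    have e1 := ((h1.sub h2).norm_sq.sub_const 0).div_const 2
    have e2 := ((h3.sub h4).norm_sq.sub_const 0).div_const 2
    have e3 : HasDerivAt D _ t := e1.add e2
    rw [e3.deriv]
    simp only [Pi.sub_apply, hDdef]
    linarith)
  have hz : ∀ t ∈ Icc 0 T, ‖x t - x' t‖ = 0 ∧ ‖y t - y' t‖ = 0 := by
    intro t ht
    have := hle t ht
    simp only [D, Pi.sub_apply] at this
    constructor <;> nlinarith [sq_nonneg ‖x t - x' t‖, sq_nonneg ‖y t - y' t‖]
  exact ⟨fun t ht => sub_eq_zero.1 (norm_eq_zero.1 (hz t ht).1),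
    fun t ht => sub_eq_zero.1 (norm_eq_zero.1 (hz t ht).2)⟩

/-- Measurability of the composition of a Carathéodory function with a measurable curve. -/
theorem aemeasurable_comp_of_continuousAt {E V : Type*} [PseudoMetricSpace E]
    [SecondCountableTopology E] [MeasurableSpace E] [BorelSpace E] [PseudoMetricSpace V]
    [MeasurableSpace V] [BorelSpace V] {μ : Measure ℝ} {k : ℝ → E → V} {D : Set E}
    (hm : ∀ x ∈ D, AEMeasurable (fun t => k t x) μ) {z : ℝ → E} (hz : Measurable z)
    (hzD : ∀ t, z t ∈ D) (hcont : ∀ᵐ t ∂μ, ContinuousAt (k t) (z t)) :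
    AEMeasurable (fun t => k t (z t)) μ := by
  -- Simple approximations take values in D, so each composition is measurable piece by piece;
  -- continuity at z t passes to the limit.
  let s : ℕ → SimpleFunc ℝ E := SimpleFunc.approxOn z hz D (z 0) (hzD 0)
  have hs : ∀ n t, s n t ∈ D := fun n t => SimpleFunc.approxOn_mem hz (hzD 0) n t
  refine aemeasurable_of_tendsto_metrizable_ae atTop (f := fun n t => k t (s n t)) (fun n => ?_) ?_
  · have hcover : (⋃ x : (s n).range, s n ⁻¹' {x.1}) = univ := by
      ext t
      simp
    rw [← Measure.restrict_univ (μ := μ), ← hcover, aemeasurable_iUnion_iff]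
    rintro ⟨x, hx⟩
    obtain ⟨t₀, rfl⟩ := SimpleFunc.mem_range.1 hx
    refine ((hm _ (hs n t₀)).restrict).congr ?_
    filter_upwards [ae_restrict_mem ((s n).measurableSet_fiber (s n t₀))] with t ht
    rw [show s n t = s n t₀ from ht]
  · filter_upwards [hcont] with t ht
    exact ht.tendsto.comp (SimpleFunc.tendsto_approxOn hz (hzD 0) (subset_closure (hzD t)))

namespace Data
namespace StandingHyp

variable {n l m r : ℕ} {S : Data n l m r}

/-- The simple approximations of the curve need not lie in the set N at the time in question. The
neighbourhood hypothesis makes the drift continuous at the curve in the full space. Extending the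
curve constantly beyond [a,b] keeps its values where measurability in t is assumed. -/
theorem aemeasurable_comp (H : S.StandingHyp) {u : ℝ → Euc m} (hu : S.IsControl u) {a b : ℝ}
    (ha : 0 ≤ a) (hab : a ≤ b) (hb : b ≤ S.T) {x : ℝ → Euc n} {y : ℝ → Euc l}
    (hx : ContinuousOn x (Icc a b)) (hy : ContinuousOn y (Icc a b))
    (hN : ∀ t ∈ Icc a b, S.N S.delta S.delta t ∈ 𝓝 (x t, y t)) :
    AEMeasurable (fun t => S.f t (x t) (y t) (u t)) (volume.restrict (Icc a b)) ∧
      AEMeasurable (fun t => S.g t (x t) (y t) (u t)) (volume.restrict (Icc a b)) := by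
  have hsub : Icc a b ⊆ Icc 0 S.T := Icc_subset_Icc ha hb
  have hle : volume.restrict (Icc a b) ≤ leb S.T := Measure.restrict_mono hsub le_rfl
  let D : Set (Euc n × Euc l) := {p |
    p.1 ∈ (⋃ t ∈ Icc 0 S.T, S.C t ∩ closedBall (S.xbar t) S.delta) ∧
    p.2 ∈ ⋃ t ∈ Icc 0 S.T, closedBall (S.ybar t) S.delta}
  let z : ℝ → Euc n × Euc l := IccExtend hab ((Icc a b).domRestrict fun t => (x t, y t))
  have hzc : Continuous z :=
    (continuousOn_iff_continuous_domRestrict.1 (hx.prodMk hy)).Icc_extend'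
  have hzN : ∀ t, ∃ s ∈ Icc a b, z t = (x s, y s) := fun t =>
    ⟨projIcc a b hab t, (projIcc a b hab t).2, rfl⟩
  have hzeq : ∀ t ∈ Icc a b, z t = (x t, y t) := fun t ht => IccExtend_of_mem hab _ ht
  have hzD : ∀ t, z t ∈ D := by
    intro t
    obtain ⟨s, hs, e⟩ := hzN t
    rw [e]
    have h1 := mem_of_mem_nhds (hN s hs)
    exact ⟨mem_biUnion (hsub hs) h1.1, mem_biUnion (hsub hs) h1.2⟩
  have hcont : ∀ᵐ t ∂(volume.restrict (Icc a b)),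
      ContinuousAt (fun p : Euc n × Euc l => S.f t p.1 p.2 (u t)) (z t) ∧
      ContinuousAt (fun p : Euc n × Euc l => S.g t p.1 p.2 (u t)) (z t) := by
    filter_upwards [ae_mono hle H.a41.2.1, ae_mono hle hu.2,
      ae_restrict_mem measurableSet_Icc] with t h1 h2 ht
    rw [hzeq t ht]
    have hmap : ∀ p ∈ S.N S.delta S.delta t,
        ((p, u t) : (Euc n × Euc l) × Euc m) ∈ S.N S.delta S.delta t ×ˢ S.U t :=
      fun p hp => ⟨hp, h2⟩
    have hpc : ContinuousOn (fun p : Euc n × Euc l => ((p, u t) : (Euc n × Euc l) × Euc m))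
        (S.N S.delta S.delta t) := by fun_prop
    exact ⟨(h1.1.comp hpc hmap).continuousAt (hN t ht), (h1.2.comp hpc hmap).continuousAt (hN t ht)⟩
  have hm := fun (p : Euc n × Euc l) (hp : p ∈ D) => (H.a41.1 p.1 hp.1 p.2 hp.2).2 u hu
  have h1 := aemeasurable_comp_of_continuousAt (k := fun t (p : Euc n × Euc l) =>
    S.f t p.1 p.2 (u t)) (μ := volume.restrict (Icc a b)) (D := D)
    (fun p hp => (hm p hp).1.mono_measure hle) hzc.measurable hzD (hcont.mono fun _ h => h.1)
  have h2 := aemeasurable_comp_of_continuousAt (k := fun t (p : Euc n × Euc l) =>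
    S.g t p.1 p.2 (u t)) (μ := volume.restrict (Icc a b)) (D := D)
    (fun p hp => (hm p hp).2.mono_measure hle) hzc.measurable hzD (hcont.mono fun _ h => h.2)
  constructor
  · refine h1.congr ?_
    filter_upwards [ae_restrict_mem measurableSet_Icc] with t ht
    rw [hzeq t ht]
  · refine h2.congr ?_
    filter_upwards [ae_restrict_mem measurableSet_Icc] with t ht
    rw [hzeq t ht]

/-- Bounds and Lipschitz estimates for the penalty terms. -/
theorem exists_penalty_lip (H : S.StandingHyp) {γ : ℝ} (hγ : 0 < γ) : ∃ Λ, 0 ≤ Λ ∧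
    (∀ t ∈ Icc 0 S.T, ∀ x ∈ S.CTrunc t, ∀ x' ∈ S.CTrunc t,
      ‖(∑ i, (γ * Real.exp (γ * S.psiBar i t x)) • gradient (S.psiBar i t) x)
        - ∑ i, (γ * Real.exp (γ * S.psiBar i t x')) • gradient (S.psiBar i t) x'‖
        ≤ Λ * ‖x - x'‖) ∧
    (∀ t ∈ Icc 0 S.T, ∀ y ∈ closedBall (S.ybar t) S.delta, ∀ y' ∈ closedBall (S.ybar t) S.delta,
      ‖(γ * Real.exp (γ * S.phi t y)) • gradient (S.phi t) y
        - (γ * Real.exp (γ * S.phi t y')) • gradient (S.phi t) y'‖ ≤ Λ * ‖y - y'‖) := by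
  obtain ⟨G, hG, hlip⟩ := H.exists_gradient_lip
  have hL := H.LBar_pos
  have hδ := H.delta_pos
  have hρ : 0 ≤ S.rho0 / 2 := by linarith [H.rho0_pos]
  -- One product estimate serves both penalties: at nonpositive arguments the exponential is at most
  -- 1 and 1-Lipschitz.
  have key : ∀ {E : Type} [NormedAddCommGroup E] [NormedSpace ℝ E] {p p' : ℝ} {g g' : E} {d K : ℝ},
      p ≤ 0 → p' ≤ 0 → |p - p'| ≤ S.LBar * d → ‖g‖ ≤ S.LBar → ‖g - g'‖ ≤ K * d → 0 ≤ d →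
      ‖(γ * Real.exp (γ * p)) • g - (γ * Real.exp (γ * p')) • g'‖
        ≤ (γ * γ * S.LBar * S.LBar + γ * K) * d := by
    intro E _ _ p p' g g' d K hp hp' hpp hg hgg hd
    have e : (γ * Real.exp (γ * p)) • g - (γ * Real.exp (γ * p')) • g'
        = (γ * (Real.exp (γ * p) - Real.exp (γ * p'))) • g
          + (γ * Real.exp (γ * p')) • (g - g') := by
      rw [smul_sub, mul_sub, sub_smul]; abel
    rw [e]
    have h1 : |Real.exp (γ * p) - Real.exp (γ * p')| ≤ γ * (S.LBar * d) := by
      refine (abs_exp_sub_exp_le (by nlinarith) (by nlinarith)).trans ?_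
      rw [← mul_sub, abs_mul, abs_of_pos hγ]
      exact mul_le_mul_of_nonneg_left hpp hγ.le
    have h2 : Real.exp (γ * p') ≤ 1 := Real.exp_le_one_iff.2 (by nlinarith)
    refine (norm_add_le _ _).trans ?_
    rw [norm_smul, norm_smul, Real.norm_eq_abs, Real.norm_eq_abs, abs_mul, abs_of_pos hγ,
      abs_of_pos (mul_pos hγ (Real.exp_pos _))]
    have h3 : γ * |Real.exp (γ * p) - Real.exp (γ * p')| * ‖g‖
        ≤ γ * (γ * (S.LBar * d)) * S.LBar :=
      mul_le_mul (mul_le_mul_of_nonneg_left h1 hγ.le) hg (norm_nonneg _) (by positivity)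
    have h4 : γ * Real.exp (γ * p') * ‖g - g'‖ ≤ γ * 1 * (K * d) :=
      mul_le_mul (mul_le_mul_of_nonneg_left h2 hγ.le) hgg (norm_nonneg _) (by positivity)
    linarith
  set c := γ * γ * S.LBar * S.LBar
  have hc : 0 ≤ c := by positivity
  refine ⟨(r + 1) * (c + γ * (G + 1)), by positivity, fun t ht x hx x' hx' => ?_,
    fun t ht y hy y' hy' => ?_⟩
  · rw [← Finset.sum_sub_distrib]
    have hterm : ∀ i ∈ (Finset.univ : Finset (Fin (r + 1))),
        ‖(γ * Real.exp (γ * S.psiBar i t x)) • gradient (S.psiBar i t) x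
          - (γ * Real.exp (γ * S.psiBar i t x')) • gradient (S.psiBar i t) x'‖
          ≤ (c + γ * G) * ‖x - x'‖ := by
      intro i _
      have hx0 : x' ∈ closedBall x' (S.rho0 / 2) := mem_closedBall_self hρ
      have h1 := hlip i t ht t ht x hx x' hx' x (mem_closedBall_self hρ) x' hx0
      have h2 := H.abs_psiBar_sub_le i ht ht hx hx'
      rw [sub_self, abs_zero, zero_add] at h1 h2
      exact key (H.mem_CTrunc_iff.1 hx i) (H.mem_CTrunc_iff.1 hx' i) h2
        (H.norm_gradient_le i ht hx) h1 (norm_nonneg _)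
    refine (norm_sum_le _ _).trans ((Finset.sum_le_sum hterm).trans ?_)
    rw [Finset.sum_const, Finset.card_univ, Fintype.card_fin, nsmul_eq_mul, ← mul_assoc]
    push_cast
    refine mul_le_mul_of_nonneg_right ?_ (norm_nonneg _)
    exact mul_le_mul_of_nonneg_left (by linarith [hγ]) (by positivity)
  · rw [mem_closedBall, dist_eq_norm] at hy hy'
    have hφ : ∀ y : Euc l, ‖y - S.ybar t‖ ≤ S.delta → S.phi t y ≤ 0 := fun y hy => by
      have := pow_le_pow_left₀ (norm_nonneg _) hy 2
      unfold phi; linarith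
    have h1 := key (E := Euc l) (K := 1) (hφ y hy) (hφ y' hy')
      (by simpa using abs_phi_sub_le hy hy' H ht ht)
      (g := gradient (S.phi t) y) (g' := gradient (S.phi t) y')
      (by rw [gradient_phi]; exact hy.trans H.delta_le)
      (by rw [gradient_phi, gradient_phi, sub_sub_sub_cancel_right, one_mul]) (norm_nonneg _)
    refine h1.trans (mul_le_mul_of_nonneg_right ?_ (norm_nonneg _))
    have h2 : c + γ * 1 ≤ c + γ * (G + 1) := by nlinarith
    have h3 : 0 ≤ c + γ * (G + 1) := by positivity
    have h4 : (0 : ℝ) ≤ r := Nat.cast_nonneg r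
    nlinarith

theorem norm_penalty_le (H : S.StandingHyp) {γ : ℝ} (hγ : 0 < γ) {t : ℝ} (ht : t ∈ Icc 0 S.T)
    {x : Euc n} (hx : x ∈ S.CTrunc t) :
    ‖∑ i, (γ * Real.exp (γ * S.psiBar i t x)) • gradient (S.psiBar i t) x‖
      ≤ γ * S.expSum γ t x * S.LBar := by
  refine (norm_sum_le _ _).trans ?_
  rw [expSum, Finset.mul_sum, Finset.sum_mul]
  refine Finset.sum_le_sum fun i _ => ?_
  rw [norm_smul, Real.norm_of_nonneg (by positivity)]
  exact mul_le_mul_of_nonneg_left (H.norm_gradient_le i ht hx) (by positivity)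

theorem norm_penalty_phi_le (H : S.StandingHyp) {γ : ℝ} (hγ : 0 < γ) {t : ℝ}
    {y : Euc l} (hy : y ∈ closedBall (S.ybar t) S.delta) :
    ‖(γ * Real.exp (γ * S.phi t y)) • gradient (S.phi t) y‖
      ≤ γ * Real.exp (γ * S.phi t y) * S.LBar := by
  rw [mem_closedBall, dist_eq_norm] at hy
  rw [norm_smul, Real.norm_of_nonneg (by positivity), gradient_phi]
  exact mul_le_mul_of_nonneg_left (hy.trans H.delta_le) (by positivity)

/-- The sets that are invariant under the penalized system lie uniformly inside the region in which
the data are controlled. -/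
theorem exists_uniform_ball_subset (H : S.StandingHyp) {γ : ℝ} (hγ : S.Admissible γ) :
    ∃ κ > 0, ∃ τ > 0, ∀ t₀ ∈ Icc 0 S.T,
      ∀ z₀ ∈ S.CPen γ t₀ ×ˢ closedBall (S.ybar t₀) (S.rhoBar γ),
      ∀ t ∈ Icc 0 S.T, |t - t₀| ≤ τ →
      closedBall z₀ κ ⊆ S.CTrunc t ×ˢ closedBall (S.ybar t) S.delta := by
  have hα := H.alphaBar_pos hγ
  obtain ⟨R, hR⟩ :=
    (isCompact_Icc.image_of_continuousOn H.continuousOn_xbar).isBounded.subset_closedBall 0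
  have hK : IsCompact (Icc 0 S.T ×ˢ closedBall (0 : Euc n) (R + S.eps + 1)) :=
    isCompact_Icc.prod (isCompact_closedBall _ _)
  have hΨ : ContinuousOn (fun (p : ℝ × Euc n) (i : Fin (r + 1)) => S.psiBar i p.1 p.2)
      (Icc 0 S.T ×ˢ closedBall (0 : Euc n) (R + S.eps + 1)) :=
    continuousOn_pi.2 fun i => (H.continuousOn_psiBar i).mono (prod_mono_right (subset_univ _))
  -- On C̄^γ all generators are at most −ᾱ, so a displacement changing them by less than ᾱ keeps
  -- them nonpositive. The extra 1 in the radius leaves room for the displacement κ ≤ 1.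
  obtain ⟨ρ, hρ, hu⟩ := Metric.uniformContinuousOn_iff.1
    (hK.uniformContinuousOn_of_continuous hΨ) _ hα
  have hrho : S.rhoBar γ < S.delta := by
    rw [rhoBar, Real.sqrt_lt' H.delta_pos]; linarith
  -- Half of the gap between the radii is spent on the displacement of y, the other half on the
  -- motion of ȳ.
  set σ := (S.delta - S.rhoBar γ) / 2
  have hσ : 0 < σ := by simp only [σ]; linarith
  have hLxy : 0 < S.Lxy := by linarith [H.one_le_Lxy]
  refine ⟨min (ρ / 2) (min 1 σ), by positivity, min (ρ / 2) (σ / S.Lxy), by positivity, ?_⟩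
  rintro t₀ ht₀ ⟨x₀, y₀⟩ ⟨hx₀, hy₀⟩ t ht htt ⟨x, y⟩ hz
  simp only at hx₀ hy₀
  rw [← closedBall_prod_same] at hz
  obtain ⟨hzx, hzy⟩ := hz
  simp only [mem_closedBall, dist_eq_norm] at hzx hzy
  have hκ1 : min (ρ / 2) (min 1 σ) ≤ ρ / 2 := min_le_left _ _
  have hκ2 : min (ρ / 2) (min 1 σ) ≤ 1 := (min_le_right _ _).trans (min_le_left _ _)
  have hκ3 : min (ρ / 2) (min 1 σ) ≤ σ := (min_le_right _ _).trans (min_le_right _ _)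
  have hτ1 : |t - t₀| ≤ ρ / 2 := htt.trans (min_le_left _ _)
  have hτ2 : |t - t₀| ≤ σ / S.Lxy := htt.trans (min_le_right _ _)
  have hx₀C := H.CPen_subset hγ t₀ hx₀
  have hnx₀ : ‖x₀‖ ≤ R + S.eps := by
    have h1 : ‖S.xbar t₀‖ ≤ R := by simpa using hR ⟨t₀, ht₀, rfl⟩
    calc ‖x₀‖ = ‖S.xbar t₀ + (x₀ - S.xbar t₀)‖ := by congr 1; abel
      _ ≤ _ := norm_add_le_of_le h1 (norm_sub_xbar_le hx₀C)
  have hnx : ‖x‖ ≤ R + S.eps + 1 := by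
    calc ‖x‖ = ‖x₀ + (x - x₀)‖ := by congr 1; abel
      _ ≤ _ := norm_add_le_of_le hnx₀ (hzx.trans hκ2)
  constructor
  · refine H.mem_CTrunc_iff.2 fun i => ?_
    have h1 := hu (t, x) ⟨ht, by simpa using hnx⟩ (t₀, x₀)
      ⟨ht₀, by simp only [mem_closedBall_zero_iff]; linarith⟩ (by
        rw [Prod.dist_eq]
        refine max_lt ?_ ?_
        · rw [Real.dist_eq]; linarith
        · rw [dist_eq_norm]; linarith)
    have h2 := (dist_le_pi_dist _ _ i).trans_lt h1
    rw [Real.dist_eq] at h2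
    have h3 := H.psiBar_le_of_mem_CPen hγ hx₀ i
    have h4 := (abs_lt.1 h2).2
    change S.psiBar i t x ≤ 0
    linarith
  · simp only [mem_closedBall, dist_eq_norm] at hy₀ ⊢
    have h1 := H.norm_ybar_sub_le ht ht₀
    have h2 : S.Lxy * |t - t₀| ≤ σ := by
      rw [le_div_iff₀ hLxy] at hτ2; linarith
    have e : y - S.ybar t = (y - y₀) + (y₀ - S.ybar t₀) - (S.ybar t - S.ybar t₀) := by abel
    rw [e]
    refine (norm_sub_le_of_le (norm_add_le_of_le hzy hy₀) h1).trans ?_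
    simp only [σ] at *
    linarith

end StandingHyp
end Data
end SweepingProcess

/-! ### Existence, uniqueness and bounds for the penalized system -/

namespace SweepingProcess
namespace Data
namespace StandingHyp

variable {n l m r : ℕ} {S : Data n l m r}

/-- The level tends to 0, ᾱ tends to 0 as log γ/γ does, and η̄ < ε̄/2 < δ̄ leaves a positive gap δ̄²
− η̄². -/
theorem eventually_admissible (H : S.StandingHyp) : ∀ᶠ γ in atTop, S.Admissible γ := by
  have hμ := H.muBar_pos
  have hη := H.eta_pos
  have hc : 0 < S.eta ^ 2 / (2 * S.muBar) := by positivity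
  obtain ⟨Γ, hΓ⟩ := H.exists_forall_le_norm_sum
  have hα : Tendsto S.alphaBar atTop (𝓝 0) := by
    have h1 := (Real.isLittleO_log_id_atTop.tendsto_div_nhds_zero.comp
      (tendsto_id.const_mul_atTop hc)).mul_const (S.eta ^ 2 / (2 * S.muBar))
    rw [zero_mul] at h1
    refine h1.congr' ?_
    filter_upwards [eventually_gt_atTop 0] with γ hγ
    simp only [Function.comp_apply, id, alphaBar]
    rw [show S.eta ^ 2 / (2 * S.muBar) * γ = S.eta ^ 2 * γ / (2 * S.muBar) by ring]
    field_simp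
  have hgap : 0 < (S.delta ^ 2 - S.eta ^ 2) / 2 := by
    nlinarith [H.eta_lt, H.eps_lt_delta, H.eps_pos]
  filter_upwards [eventually_gt_atTop 0, eventually_gt_atTop (2 * S.muBar / S.eta ^ 2),
    hα.eventually_lt_const hgap, eventually_ge_atTop Γ] with γ h1 h2 h3 h4
  refine ⟨h1, ?_, by linarith, fun t ht x hx h => hΓ γ h4 t ht x hx h⟩
  unfold level
  rw [← div_div, div_lt_one h1]
  exact h2

theorem intervalIntegrable_Lh (H : S.StandingHyp) : IntervalIntegrable S.Lh volume 0 S.T :=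
  (intervalIntegrable_iff_integrableOn_Icc_of_le H.T_pos.le).2
    (H.a41.2.2.2.2.1.integrable one_le_two)

theorem continuousOn_xiPen (H : S.StandingHyp) (γ : ℝ) (i : Fin (r + 1)) {x : ℝ → Euc n}
    {I : Set ℝ} (hI : I ⊆ Icc 0 S.T) (hx : ContinuousOn x I) :
    ContinuousOn (S.xiPen γ x i) I :=
  continuousOn_const.mul (Real.continuous_exp.comp_continuousOn
    (continuousOn_const.mul (H.continuousOn_psiBar_comp i hI hx)))

theorem continuousOn_phi_comp (H : S.StandingHyp) {y : ℝ → Euc l}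
    {I : Set ℝ} (hI : I ⊆ Icc 0 S.T) (hy : ContinuousOn y I) :
    ContinuousOn (fun t => S.phi t (y t)) I :=
  (((hy.sub (H.continuousOn_ybar.mono hI)).norm.pow 2).sub continuousOn_const).div_const 2

theorem continuousOn_zetaPen (H : S.StandingHyp) (γ : ℝ) {y : ℝ → Euc l}
    {I : Set ℝ} (hI : I ⊆ Icc 0 S.T) (hy : ContinuousOn y I) :
    ContinuousOn (S.zetaPen γ y) I :=
  continuousOn_const.mul (Real.continuous_exp.comp_continuousOn
    (continuousOn_const.mul (H.continuousOn_phi_comp hI hy)))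

theorem expSum_le_card (H : S.StandingHyp) {γ : ℝ} (hγ : 0 < γ) {t : ℝ} {x : Euc n}
    (hx : x ∈ S.CTrunc t) : S.expSum γ t x ≤ r + 1 := by
  have : S.expSum γ t x ≤ ∑ _i : Fin (r + 1), (1 : ℝ) :=
    Finset.sum_le_sum fun i _ => Real.exp_le_one_iff.2
      (mul_nonpos_of_nonneg_of_nonpos hγ.le (H.mem_CTrunc_iff.1 hx i))
  simpa using this

theorem phi_le_zero {t : ℝ} {y : Euc l}
    (hy : y ∈ closedBall (S.ybar t) S.delta) : S.phi t y ≤ 0 := by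
  rw [mem_closedBall, dist_eq_norm] at hy
  have := pow_le_pow_left₀ (norm_nonneg _) hy 2
  unfold phi; linarith

/-- Bounds and moduli of Lipschitz continuity of the right-hand sides of the penalized system. -/
theorem exists_penRhs_modulus (H : S.StandingHyp) {γ : ℝ} (hγ : 0 < γ) {u : ℝ → Euc m}
    (hu : S.IsControl u) : ∃ (M : ℝ) (ℓ : ℝ → ℝ), 0 ≤ M ∧ IntervalIntegrable ℓ volume 0 S.T ∧
    ∀ᵐ t, t ∈ Icc 0 S.T →
      (∀ x ∈ S.CTrunc t, ∀ y ∈ closedBall (S.ybar t) S.delta,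
        ‖S.penRhsX γ u t x y‖ ≤ M ∧ ‖S.penRhsY γ u t x y‖ ≤ M) ∧
      0 ≤ ℓ t ∧
      ∀ x ∈ S.CTrunc t, ∀ y ∈ closedBall (S.ybar t) S.delta,
      ∀ x' ∈ S.CTrunc t, ∀ y' ∈ closedBall (S.ybar t) S.delta,
        ‖S.penRhsX γ u t x y - S.penRhsX γ u t x' y'‖ ≤ ℓ t * (‖x - x'‖ + ‖y - y'‖) ∧
        ‖S.penRhsY γ u t x y - S.penRhsY γ u t x' y'‖ ≤ ℓ t * (‖x - x'‖ + ‖y - y'‖) := by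
  obtain ⟨Λ, hΛ, hΛx, hΛy⟩ := H.exists_penalty_lip hγ
  have hL := H.LBar_pos
  have hM := H.Mh_pos
  have hr : (0 : ℝ) ≤ r := Nat.cast_nonneg r
  refine ⟨S.Mh + γ * (r + 1) * S.LBar, fun t => S.Lh t + Λ, by positivity,
    H.intervalIntegrable_Lh.add intervalIntegrable_const, ?_⟩
  filter_upwards [H.ae_bounds, ae_mem_of_isControl hu] with t hb hut ht
  obtain ⟨hb1, hb2⟩ := hb ht
  have hut := hut ht
  have hLh := H.a41.2.2.2.1 t ht
  refine ⟨fun x hx y hy => ?_, by positivity, fun x hx y hy x' hx' y' hy' => ?_⟩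
  · have h1 := hb1 x y (H.CTrunc_prod_subset hx hy) _ hut
    constructor
    · refine norm_sub_le_of_le h1.1 ((H.norm_penalty_le hγ ht hx).trans ?_)
      gcongr
      exact H.expSum_le_card hγ hx
    · refine norm_sub_le_of_le h1.2 ((H.norm_penalty_phi_le hγ hy).trans ?_)
      gcongr
      have : Real.exp (γ * S.phi t y) ≤ 1 := Real.exp_le_one_iff.2
        (mul_nonpos_of_nonneg_of_nonpos hγ.le (phi_le_zero hy))
      linarith
  · have h1 := hb2 x y x' y' (H.CTrunc_prod_subset hx hy) (H.CTrunc_prod_subset hx' hy') _ hut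
    have h2 := hΛx t ht x hx x' hx'
    have h3 := hΛy t ht y hy y' hy'
    have h4 := norm_nonneg (x - x')
    have h5 := norm_nonneg (y - y')
    constructor
    · unfold penRhsX
      rw [sub_sub_sub_comm]
      refine (norm_sub_le_of_le h1.1 h2).trans ?_
      nlinarith
    · unfold penRhsY
      rw [sub_sub_sub_comm]
      refine (norm_sub_le_of_le h1.2 h3).trans ?_
      nlinarith

theorem aestronglyMeasurable_penRhs (H : S.StandingHyp) (γ : ℝ) {u : ℝ → Euc m}
    (hu : S.IsControl u) {a b : ℝ} (ha : 0 ≤ a) (hab : a ≤ b) (hb : b ≤ S.T) {x : ℝ → Euc n}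
    {y : ℝ → Euc l} (hx : ContinuousOn x (Icc a b)) (hy : ContinuousOn y (Icc a b))
    (hN : ∀ t ∈ Icc a b, S.CTrunc t ×ˢ closedBall (S.ybar t) S.delta ∈ 𝓝 (x t, y t)) :
    AEStronglyMeasurable (fun t => S.penRhsX γ u t (x t) (y t)) (volume.restrict (Icc a b)) ∧
    AEStronglyMeasurable (fun t => S.penRhsY γ u t (x t) (y t)) (volume.restrict (Icc a b)) := by
  have hI : Icc a b ⊆ Icc 0 S.T := Icc_subset_Icc ha hb
  obtain ⟨h1, h2⟩ := H.aemeasurable_comp hu ha hab hb hx hy fun t ht =>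
    mem_of_superset (hN t ht) fun p hp => H.CTrunc_prod_subset hp.1 hp.2
  have hxC : ∀ t ∈ Icc a b, x t ∈ S.CTrunc t := fun t ht => (mem_of_mem_nhds (hN t ht)).1
  constructor
  · refine h1.aestronglyMeasurable.sub (ContinuousOn.aestronglyMeasurable ?_ measurableSet_Icc)
    exact continuousOn_finsetSum _ fun i _ => (H.continuousOn_xiPen γ i hI hx).smul
      (H.continuousOn_gradient_comp i hI hx hxC)
  · refine h2.aestronglyMeasurable.sub (ContinuousOn.aestronglyMeasurable ?_ measurableSet_Icc)
    simp_rw [gradient_phi]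
    exact (H.continuousOn_zetaPen γ hI hy).smul (hy.sub (H.continuousOn_ybar.mono hI))

theorem exists_isPenSolution (H : S.StandingHyp) {γ : ℝ} (hγ : S.Admissible γ) {u : ℝ → Euc m}
    (hu : S.IsControl u) {c : Euc n} {d : Euc l} (hc : c ∈ S.CPen γ 0)
    (hd : d ∈ closedBall (S.ybar 0) (S.rhoBar γ)) : ∃ x y, S.IsPenSolution γ u c d x y := by
  obtain ⟨M, ℓ, hM, hℓ, hmod⟩ := H.exists_penRhs_modulus hγ.pos hu
  obtain ⟨κ, hκ, τ, hτ, hball⟩ := H.exists_uniform_ball_subset hγ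
  let F : ℝ → Euc n × Euc l → Euc n × Euc l := fun t z =>
    (S.penRhsX γ u t z.1 z.2, S.penRhsY γ u t z.1 z.2)
  have hAC : ∀ {a b : ℝ} {z : ℝ → Euc n × Euc l}, a ≤ b → IsLipSolution F M a b z →
      AbsolutelyContinuousOnInterval (fun t => (z t).1) a b ∧
      AbsolutelyContinuousOnInterval (fun t => (z t).2) a b := by
    intro a b z hab hz
    constructor
    · refine absolutelyContinuousOnInterval_of_norm_sub_le (M := M) fun s hs t ht => ?_
      rw [uIcc_of_le hab] at hs ht
      exact (norm_fst_le (z s - z t)).trans (hz.1 s hs t ht)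
    · refine absolutelyContinuousOnInterval_of_norm_sub_le (M := M) fun s hs t ht => ?_
      rw [uIcc_of_le hab] at hs ht
      exact (norm_snd_le (z s - z t)).trans (hz.1 s hs t ht)
  have hode : ∀ {a b : ℝ} {z : ℝ → Euc n × Euc l}, IsLipSolution F M a b z →
      ∀ᵐ t, t ∈ Ioo a b →
      HasDerivAt (fun t => (z t).1) (S.penRhsX γ u t (z t).1 (z t).2) t ∧
      HasDerivAt (fun t => (z t).2) (S.penRhsY γ u t (z t).1 (z t).2) t := by
    intro a b z hz
    filter_upwards [hz.2] with t ht htI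
    have h := ht htI
    exact ⟨h.fst, h.snd⟩
  -- The product carries the maximum norm, so the sum of the two component norms costs a factor 2 in
  -- the modulus.
  obtain ⟨z, hz0, hz, -⟩ := exists_lipSolution_of_invariant (F := F) H.T_pos.le
    (A := fun t => S.CPen γ t ×ˢ closedBall (S.ybar t) (S.rhoBar γ))
    (N := fun t => S.CTrunc t ×ˢ closedBall (S.ybar t) S.delta) (ℓ := fun t => 2 * ℓ t)
    (z₀ := (c, d)) hκ hτ hM hball
    (by
      filter_upwards [hmod] with t ht htI z hz
      have h := (ht htI).1 z.1 hz.1 z.2 hz.2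
      exact max_le h.1 h.2)
    (by
      filter_upwards [hmod] with t ht htI z hz z' hz'
      have h := (ht htI).2.2 z.1 hz.1 z.2 hz.2 z'.1 hz'.1 z'.2 hz'.2
      have h0 := (ht htI).2.1
      have h1 : ‖z.1 - z'.1‖ + ‖z.2 - z'.2‖ ≤ 2 * ‖z - z'‖ := by
        linarith [norm_fst_le (z - z'), norm_snd_le (z - z'), Prod.fst_sub z z', Prod.snd_sub z z',
          show ‖z.1 - z'.1‖ ≤ ‖z - z'‖ from norm_fst_le (z - z'),
          show ‖z.2 - z'.2‖ ≤ ‖z - z'‖ from norm_snd_le (z - z')]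
      have h2 := mul_le_mul_of_nonneg_left h1 h0
      exact max_le (by simp only [F]; exact h.1.trans (by linarith))
        (by simp only [F]; exact h.2.trans (by linarith)))
    (hℓ.const_mul 2)
    (fun a b ha hab hb z hz hN => by
      have h := H.aestronglyMeasurable_penRhs γ hu ha hab hb (x := fun t => (z t).1)
        (y := fun t => (z t).2) (by fun_prop) (by fun_prop) hN
      exact h.1.prodMk h.2)
    (fun a b ha hab hb z hza hz => by
      have h := H.invariant hγ hu ha hab hb (hAC hab hz).1 (hAC hab hz).2 (hode hz) hza.1 hza.2 b
        (right_mem_Icc.2 hab)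
      exact ⟨h.1, h.2⟩)
    ⟨hc, hd⟩
  refine ⟨fun t => (z t).1, fun t => (z t).2, (hAC H.T_pos.le hz).1, (hAC H.T_pos.le hz).2,
    by simp [hz0], by simp [hz0], ae_leb_of_forall_Ioo ?_⟩
  exact hode hz

/-- Nothing is assumed on the location of the solution after time 0. This makes the uniqueness
statement valid in the whole class W^{1,1}. -/
theorem mem_of_isPenSolution (H : S.StandingHyp) {γ : ℝ} (hγ : S.Admissible γ) {u : ℝ → Euc m}
    (hu : S.IsControl u) {c : Euc n} {d : Euc l} (hc : c ∈ S.CPen γ 0)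
    (hd : d ∈ closedBall (S.ybar 0) (S.rhoBar γ)) {x : ℝ → Euc n} {y : ℝ → Euc l}
    (h : S.IsPenSolution γ u c d x y) :
    ∀ t ∈ Icc 0 S.T, x t ∈ S.CPen γ t ∧ y t ∈ closedBall (S.ybar t) (S.rhoBar γ) :=
  H.invariant hγ hu le_rfl H.T_pos.le le_rfl h.1 h.2.1 (forall_Ioo_of_ae_leb h.2.2.2.2)
    (h.2.2.1 ▸ hc) (h.2.2.2.1 ▸ hd)

theorem closedBall_rhoBar_subset (H : S.StandingHyp) {γ : ℝ} (hγ : S.Admissible γ) (t : ℝ) :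
    closedBall (S.ybar t) (S.rhoBar γ) ⊆ closedBall (S.ybar t) S.delta := fun _ hy =>
  H.mem_closedBall_of_phi_le (((phi_le_iff hγ).1 hy).trans (by linarith [H.alphaBar_pos hγ]))

/-- Both solutions remain in the invariant sets, where the right-hand side is Lipschitz with an
integrable modulus. -/
theorem isPenSolution_unique (H : S.StandingHyp) {γ : ℝ} (hγ : S.Admissible γ) {u : ℝ → Euc m}
    (hu : S.IsControl u) {c : Euc n} {d : Euc l} (hc : c ∈ S.CPen γ 0)
    (hd : d ∈ closedBall (S.ybar 0) (S.rhoBar γ)) {x x' : ℝ → Euc n} {y y' : ℝ → Euc l}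
    (h : S.IsPenSolution γ u c d x y) (h' : S.IsPenSolution γ u c d x' y') :
    EqOn x' x (Icc 0 S.T) ∧ EqOn y' y (Icc 0 S.T) := by
  obtain ⟨M, ℓ, hM, hℓ, hmod⟩ := H.exists_penRhs_modulus hγ.pos hu
  have hm := H.mem_of_isPenSolution hγ hu hc hd h
  have hm' := H.mem_of_isPenSolution hγ hu hc hd h'
  refine eqOn_of_ae_inner_le (a := fun t => 2 * ℓ t) H.T_pos.le h'.1 h.1 h'.2.1 h.2.1
    (hℓ.const_mul 2) (by rw [h.2.2.1, h'.2.2.1]) (by rw [h.2.2.2.1, h'.2.2.2.1]) ?_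
  filter_upwards [hmod, forall_Ioo_of_ae_leb h.2.2.2.2, forall_Ioo_of_ae_leb h'.2.2.2.2]
    with t h1 h2 h3 htI
  have ht := Ioo_subset_Icc_self htI
  refine ⟨_, _, _, _, (h3 htI).1, (h2 htI).1, (h3 htI).2, (h2 htI).2, ?_⟩
  obtain ⟨h4, h5⟩ := (h1 ht).2.2 (x' t) (H.CPen_subset hγ t (hm' t ht).1) (y' t)
    (H.closedBall_rhoBar_subset hγ t (hm' t ht).2) (x t) (H.CPen_subset hγ t (hm t ht).1) (y t)
    (H.closedBall_rhoBar_subset hγ t (hm t ht).2)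
  have hℓ0 := (h1 ht).2.1
  have h6 := (real_inner_le_norm (x' t - x t) _).trans
    (mul_le_mul_of_nonneg_left h4 (norm_nonneg _))
  have h7 := (real_inner_le_norm (y' t - y t) _).trans
    (mul_le_mul_of_nonneg_left h5 (norm_nonneg _))
  refine (add_le_add h6 h7).trans ?_
  have h8 := mul_nonneg hℓ0 (sq_nonneg (‖x' t - x t‖ - ‖y' t - y t‖))
  linarith

/-- The product does not depend on γ, whence the uniform bound on the multipliers. -/
theorem gamma_mul_level {γ : ℝ} (hγ : 0 < γ) : γ * S.level γ = 2 * S.muBar / S.eta ^ 2 := by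
  unfold level
  rw [← div_div]
  field_simp

theorem exists_penConclusion (H : S.StandingHyp) {γ : ℝ} (hγ : S.Admissible γ) {u : ℝ → Euc m}
    (hu : S.IsControl u) {c : Euc n} {d : Euc l} (hc : c ∈ S.CPen γ 0)
    (hd : d ∈ closedBall (S.ybar 0) (S.rhoBar γ)) : ∃ x y, S.PenConclusion γ u c d x y := by
  obtain ⟨x, y, hxy⟩ := H.exists_isPenSolution hγ hu hc hd
  have hm := H.mem_of_isPenSolution hγ hu hc hd hxy
  have hγ0 := hγ.pos
  have hL := H.LBar_pos
  have hξ : ∀ t ∈ Icc 0 S.T, γ * S.expSum γ t (x t) ≤ 2 * S.muBar / S.eta ^ 2 := fun t ht => by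
    rw [← gamma_mul_level hγ0]
    exact mul_le_mul_of_nonneg_left (hm t ht).1 hγ0.le
  have hζ : ∀ t ∈ Icc 0 S.T, γ * Real.exp (γ * S.phi t (y t)) ≤ 2 * S.muBar / S.eta ^ 2 :=
    fun t ht => by
      rw [← gamma_mul_level hγ0, ← H.exp_neg_alphaBar hγ0]
      have := (phi_le_iff hγ).1 (hm t ht).2
      gcongr
  have hbd : ∀ᵐ t ∂(leb S.T), ‖deriv x t‖ ≤ S.Mh + 2 * S.muBar / S.eta ^ 2 * S.LBar ∧
      ‖deriv y t‖ ≤ S.Mh + 2 * S.muBar / S.eta ^ 2 * S.LBar := by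
    filter_upwards [hxy.2.2.2.2, ae_restrict_mem measurableSet_Icc, hu.2,
      ae_restrict_of_ae H.ae_bounds] with t h1 ht h2 h3
    have hx := H.CPen_subset hγ t (hm t ht).1
    have hy := H.closedBall_rhoBar_subset hγ t (hm t ht).2
    have h4 := (h3 ht).1 (x t) (y t) (H.CTrunc_prod_subset hx hy) _ h2
    rw [h1.1.deriv, h1.2.deriv]
    constructor
    · refine norm_sub_le_of_le h4.1 ((H.norm_penalty_le hγ0 ht hx).trans ?_)
      exact mul_le_mul_of_nonneg_right (hξ t ht) hL.le
    · refine norm_sub_le_of_le h4.2 ((H.norm_penalty_phi_le hγ0 hy).trans ?_)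
      exact mul_le_mul_of_nonneg_right (hζ t ht) hL.le
  have hxc : ContinuousOn x (Icc 0 S.T) := by simpa [uIcc_of_le H.T_pos.le] using hxy.1.continuousOn
  have hyc : ContinuousOn y (Icc 0 S.T) := by
    simpa [uIcc_of_le H.T_pos.le] using hxy.2.1.continuousOn
  refine ⟨x, y, hxy,
    ⟨hxy.1, EssBdd.memLp ⟨aestronglyMeasurable_deriv _ _, hbd.mono fun _ h => h.1⟩ ⊤⟩,
    ⟨hxy.2.1, EssBdd.memLp ⟨aestronglyMeasurable_deriv _ _, hbd.mono fun _ h => h.2⟩ ⊤⟩,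
    fun x' y' h' => H.isPenSolution_unique hγ hu hc hd hxy h', hm,
    fun i => H.continuousOn_xiPen γ i subset_rfl hxc, H.continuousOn_zetaPen γ subset_rfl hyc,
    fun t _ => ⟨fun i => mul_pos hγ0 (Real.exp_pos _), mul_pos hγ0 (Real.exp_pos _)⟩,
    fun t ht => ⟨?_, hζ t ht⟩, hbd⟩
  simp only [xiPen]
  rw [← Finset.mul_sum]
  exact hξ t ht

end StandingHyp
end Data
end SweepingProcess

/-! ### Uniform limits of equi-Lipschitz curves -/

namespace SweepingProcess

theorem tendstoUniformlyOn_of_lipschitz {E : Type*} [NormedAddCommGroup E] {X : ℕ → ℝ → E}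
    {x : ℝ → E} {a b M : ℝ} (hM : 0 ≤ M)
    (hX : ∀ k, ∀ s ∈ Icc a b, ∀ t ∈ Icc a b, ‖X k s - X k t‖ ≤ M * |s - t|)
    (hx : ∀ s ∈ Icc a b, ∀ t ∈ Icc a b, ‖x s - x t‖ ≤ M * |s - t|)
    (h : ∀ t ∈ Icc a b, Tendsto (fun k => X k t) atTop (𝓝 (x t))) :
    TendstoUniformlyOn X x atTop (Icc a b) := by
  rw [← tendstoLocallyUniformlyOn_iff_tendstoUniformlyOn_of_compact isCompact_Icc,
    Metric.tendstoLocallyUniformlyOn_iff]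
  intro ε hε t ht
  -- On this ball each curve, and the limit, moves by at most ε/3; the last third is the convergence
  -- at the centre.
  refine ⟨ball t (ε / (3 * (M + 1))) ∩ Icc a b, ?_, ?_⟩
  · exact inter_comm (Icc a b) _ ▸ inter_mem_nhdsWithin _ (ball_mem_nhds _ (by positivity))
  · filter_upwards [(Metric.tendsto_nhds.1 (h t ht)) (ε / 3) (by positivity)] with k hk s hs
    have h1 : M * |s - t| ≤ ε / 3 := by
      have h2 : |s - t| < ε / (3 * (M + 1)) := by simpa [Real.dist_eq] using hs.1
      rw [lt_div_iff₀ (by positivity)] at h2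
      nlinarith [abs_nonneg (s - t)]
    rw [dist_eq_norm] at hk ⊢
    have h3 := hX k t ht s hs.2
    have h4 := hx s hs.2 t ht
    rw [abs_sub_comm] at h3
    have e : x s - X k s = (x s - x t) - (X k t - x t) + (X k t - X k s) := by abel
    rw [e]
    refine (norm_add_le_of_le (norm_sub_le_of_le h4 le_rfl) h3).trans_lt ?_
    linarith

/-- Increments of a curve are values of its derivative at the test function 1_{[0,t]}e, so weak*
convergence of derivatives controls the curves pointwise. -/
theorem integral_indicator_inner_deriv {d : ℕ} {T : ℝ} {x : ℝ → Euc d}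
    (hx : AbsolutelyContinuousOnInterval x 0 T)
    (hd : ∀ᵐ s ∂(leb T), DifferentiableAt ℝ x s) (e : Euc d) {t : ℝ} (ht : t ∈ Icc 0 T) :
    ∫ s, inner ℝ ((Icc 0 t).indicator (fun _ => e) s) (deriv x s) ∂(leb T)
      = inner ℝ e (x t - x 0) := by
  have hac : AbsolutelyContinuousOnInterval (fun s => inner ℝ e (x s)) 0 t := by
    refine absolutelyContinuousOnInterval_of_dist_le (C := ‖e‖) (mono_uIcc hx le_rfl ht.1 ht.2)
      (absolutelyContinuousOnInterval_id 0 t) fun s _ s' _ => ?_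
    rw [Real.dist_eq, ← inner_sub_right, dist_eq_norm]
    refine (abs_real_inner_le_norm _ _).trans (mul_le_mul_of_nonneg_left ?_ (norm_nonneg _))
    exact le_add_of_nonneg_right dist_nonneg
  have h1 := hac.integral_deriv_eq_sub
  rw [inner_sub_right, ← h1, intervalIntegral.integral_of_le ht.1, ← integral_Icc_eq_integral_Ioc]
  have h2 : ∀ s, inner ℝ ((Icc 0 t).indicator (fun _ => e) s) (deriv x s)
      = (Icc 0 t).indicator (fun s => inner ℝ e (deriv x s)) s := fun s => by
    by_cases hs : s ∈ Icc 0 t <;> simp [hs]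
  simp_rw [h2]
  rw [integral_indicator measurableSet_Icc, leb, Measure.restrict_restrict measurableSet_Icc,
    inter_eq_left.2 (Icc_subset_Icc_right ht.2)]
  refine integral_congr_ae ?_
  filter_upwards [ae_mono (Measure.restrict_mono (Icc_subset_Icc_right ht.2) le_rfl) hd] with s hs
  exact (((hasDerivAt_const s e).inner ℝ hs.hasDerivAt).deriv.trans (by simp)).symm

/-- Weak* limits of derivatives of equi-Lipschitz curves are derivatives of uniform limits. -/
theorem exists_uniform_limit_of_weakStarTendsto_deriv {d : ℕ} {T M : ℝ} (hT : 0 < T) (hM : 0 ≤ M)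
    {X : ℕ → ℝ → Euc d} (hX : ∀ k, AbsolutelyContinuousOnInterval (X k) 0 T)
    (hd : ∀ k, ∀ᵐ s ∂(leb T), DifferentiableAt ℝ (X k) s)
    (hb : ∀ k, EssBdd T M (deriv (X k))) {x₀ : Euc d}
    (h0 : Tendsto (fun k => X k 0) atTop (𝓝 x₀)) {w : ℝ → Euc d} (hw : EssBdd T M w)
    (hlim : WeakStarTendsto T (fun k => deriv (X k)) w) :
    ∃ x : ℝ → Euc d, AbsolutelyContinuousOnInterval x 0 T ∧ x 0 = x₀ ∧
      (∀ᵐ s ∂(leb T), HasDerivAt x (w s) s) ∧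
      TendstoUniformlyOn X x atTop (Icc 0 T) ∧ deriv x =ᵐ[leb T] w := by
  have hwi : IntervalIntegrable w volume 0 T :=
    (intervalIntegrable_iff_integrableOn_Icc_of_le hT.le).2 ((hw.memLp 1).integrable le_rfl)
  -- The limit curve is defined as the primitive of the weak* limit, which settles its derivative at
  -- once and leaves only the convergence to be shown.
  set x : ℝ → Euc d := fun t => x₀ + ∫ s in (0 : ℝ)..t, w s with hxdef
  have hxac : AbsolutelyContinuousOnInterval x 0 T := by
    refine absolutelyContinuousOnInterval_of_norm_sub_le (M := M) fun s hs t ht => ?_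
    have hi : ∀ s ∈ uIcc 0 T, IntervalIntegrable w volume 0 s := fun s hs =>
      hwi.mono_set (uIcc_subset_uIcc left_mem_uIcc hs)
    simp only [hxdef, add_sub_add_left_eq_sub]
    rw [intervalIntegral.integral_interval_sub_left (hi s hs) (hi t ht)]
    refine intervalIntegral.norm_integral_le_of_norm_le_const_ae ?_
    have hb := (ae_restrict_iff' measurableSet_Icc).1 hw.2
    filter_upwards [hb] with τ hτ hτI
    refine hτ ?_
    rw [← uIcc_of_le hT.le]
    exact uIcc_subset_uIcc ht hs (uIoc_subset_uIcc hτI)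
  have hxd : ∀ᵐ s ∂(leb T), HasDerivAt x (w s) s := by
    refine ae_leb_of_forall_Ioo ?_
    filter_upwards [hwi.ae_hasDerivAt_integral] with s hs hsI
    have := hs (by rw [uIcc_of_le hT.le]; exact Ioo_subset_Icc_self hsI) 0 (by simp)
    exact this.const_add x₀
  have hxlip := norm_sub_le_of_ae_deriv_le (M := M) hxac (by
    filter_upwards [forall_Ioo_of_ae_leb hxd, forall_Ioo_of_ae_leb hw.2] with s h1 h2 hs
    exact ⟨_, h1 hs, h2 hs⟩)
  have hXlip := fun k => norm_sub_le_of_ae_deriv_le (M := M) (hX k) (by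
    filter_upwards [forall_Ioo_of_ae_leb (hd k), forall_Ioo_of_ae_leb (hb k).2] with s h1 h2 hs
    exact ⟨_, (h1 hs).hasDerivAt, h2 hs⟩)
  have hx0 : x 0 = x₀ := by simp [hxdef]
  have hderiv : deriv x =ᵐ[leb T] w := hxd.mono fun s hs => hs.deriv
  refine ⟨x, hxac, hx0, hxd, tendstoUniformlyOn_of_lipschitz hM hXlip hxlip fun t ht => ?_, hderiv⟩
  have hin : ∀ e : Euc d, Tendsto (fun k => inner ℝ e (X k t)) atTop (𝓝 (inner ℝ e (x t))) := by
    intro e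
    have hp : Integrable ((Icc 0 t).indicator fun _ => e) (leb T) :=
      (integrable_const e).indicator measurableSet_Icc
    have h1 := hlim _ hp
    have h2 : ∫ s, inner ℝ ((Icc 0 t).indicator (fun _ => e) s) (w s) ∂(leb T)
        = inner ℝ e (x t - x 0) := by
      rw [← integral_indicator_inner_deriv hxac (hxd.mono fun s hs => hs.differentiableAt) e ht]
      refine integral_congr_ae ?_
      filter_upwards [hderiv] with s hs
      rw [hs]
    rw [h2] at h1
    simp_rw [integral_indicator_inner_deriv (hX _) (hd _) e ht] at h1
    have h3 := h1.add ((tendsto_const_nhds (x := e)).inner (𝕜 := ℝ) h0)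
    rw [← hx0, ← inner_add_right, sub_add_cancel] at h3
    refine h3.congr fun k => ?_
    rw [← inner_add_right, sub_add_cancel]
  have hcoord : Tendsto (fun k => (WithLp.ofLp (X k t) : Fin d → ℝ)) atTop
      (𝓝 (WithLp.ofLp (x t))) := by
    refine tendsto_pi_nhds.2 fun i => ?_
    have := hin (EuclideanSpace.single i 1)
    simpa [EuclideanSpace.inner_single_left] using this
  have := ((PiLp.continuous_toLp 2 (fun _ : Fin d => ℝ)).tendsto _).comp hcoord
  simpa [Function.comp_def] using this

end SweepingProcess

/-! ### Extraction of a limit and support of the multipliers -/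

namespace SweepingProcess

theorem EssBdd.congr {T M : ℝ} {F : Type*} [NormedAddCommGroup F] {v w : ℝ → F}
    (h : EssBdd T M v) (hvw : v =ᵐ[leb T] w) : EssBdd T M w :=
  ⟨h.1.congr hvw, by filter_upwards [h.2, hvw] with t h1 h2; rwa [← h2]⟩

theorem exists_weakStarTendsto_subseq_finset {T M : ℝ} {F : Type*} [NormedAddCommGroup F]
    [InnerProductSpace ℝ F] [CompleteSpace F] [SecondCountableTopology F] {ι : Type*}
    (hM : 0 ≤ M) (s : Finset ι) {v : ι → ℕ → ℝ → F} (hv : ∀ i k, EssBdd T M (v i k)) :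
    ∃ (σ : ℕ → ℕ) (w : ι → ℝ → F), StrictMono σ ∧
      ∀ i ∈ s, EssBdd T M (w i) ∧ WeakStarTendsto T (fun k => v i (σ k)) (w i) := by
  classical
  induction s using Finset.induction_on with
  | empty => exact ⟨id, fun _ _ => 0, strictMono_id, by simp⟩
  | insert a s ha ih =>
    obtain ⟨σ, w, hσ, hw⟩ := ih
    obtain ⟨τ, z, hτ, hz, hlim⟩ := exists_weakStarTendsto_subseq hM fun k => hv a (σ k)
    refine ⟨σ ∘ τ, Function.update w a z, hσ.comp hτ, fun i hi => ?_⟩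
    by_cases hia : i = a
    · subst hia
      simpa using ⟨hz, hlim⟩
    · have his : i ∈ s := (Finset.mem_insert.1 hi).resolve_left hia
      rw [Function.update_of_ne hia]
      exact ⟨(hw i his).1, (hw i his).2.comp hτ⟩

/-- Multiplied by the indicator of A, the sequence tends to zero boundedly a.e., and weak* limits
are unique. -/
theorem WeakStarTendsto.ae_eq_zero {T M : ℝ} (hM : 0 ≤ M) {v : ℕ → ℝ → ℝ} {w : ℝ → ℝ}
    (h : WeakStarTendsto T v w) (hv : ∀ k, EssBdd T M (v k)) (hw : EssBdd T M w) {A : Set ℝ}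
    (hA : MeasurableSet A)
    (hlim : ∀ᵐ t ∂(leb T), t ∈ A → Tendsto (fun k => v k t) atTop (𝓝 0)) :
    ∀ᵐ t ∂(leb T), t ∈ A → w t = 0 := by
  have hG : EssBdd T 1 (A.indicator fun _ => (1 : ℝ)) := by
    refine ⟨(measurable_const.indicator hA).aestronglyMeasurable, Eventually.of_forall fun t => ?_⟩
    exact (norm_indicator_le_norm_self _ _).trans (by simp)
  have h1 : WeakStarTendsto T (fun k t => v k t • A.indicator (fun _ => (1 : ℝ)) t)
      (fun t => w t • A.indicator (fun _ => (1 : ℝ)) t) :=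
    h.smul hM hv (fun _ => hG) hG (Eventually.of_forall fun _ => tendsto_const_nhds)
  have h0 : EssBdd T (M * 1) fun _ => (0 : ℝ) :=
    ⟨aestronglyMeasurable_const, Eventually.of_forall fun _ => by simpa using hM⟩
  have h2 : WeakStarTendsto T (fun k t => v k t • A.indicator (fun _ => (1 : ℝ)) t)
      (fun _ => 0) := by
    refine (weakStarTendsto_const (fun _ => (0 : ℝ))).perturb (M := M * 1) (fun _ => h0)
      (fun k => EssBdd.smul hM (hv k) hG) ?_
    filter_upwards [hlim] with t ht
    by_cases htA : t ∈ A
    · simpa [htA] using ht htA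
    · simp [htA]
  filter_upwards [h1.unique h2 (EssBdd.smul hM hw hG) h0] with t ht htA
  simpa [htA] using ht

/-- This is why multipliers disappear at strictly satisfied constraints: once a k < α/2, exponential
decay beats the factor g k. -/
theorem tendsto_mul_exp_mul {g a : ℕ → ℝ} {α : ℝ} (hg : Tendsto g atTop atTop)
    (ha : Tendsto a atTop (𝓝 α)) (hα : α < 0) :
    Tendsto (fun k => g k * Real.exp (g k * a k)) atTop (𝓝 0) := by
  have hc : 0 < -(α / 2) := by linarith
  have h1 := ((Real.tendsto_pow_mul_exp_neg_atTop_nhds_zero 1).comp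
    (hg.const_mul_atTop hc)).const_mul (-(α / 2))⁻¹
  rw [mul_zero] at h1
  refine tendsto_of_tendsto_of_tendsto_of_le_of_le' tendsto_const_nhds h1 ?_ ?_
  · filter_upwards [hg.eventually_gt_atTop 0] with k hk
    positivity
  · filter_upwards [hg.eventually_gt_atTop 0,
      ha.eventually_lt_const (show α < α / 2 by linarith)] with k hk hak
    simp only [Function.comp_apply, pow_one]
    rw [← mul_assoc, ← mul_assoc, inv_mul_cancel₀ hc.ne', one_mul]
    refine mul_le_mul_of_nonneg_left (Real.exp_le_exp.2 ?_) hk.le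
    nlinarith

namespace Data
namespace StandingHyp

variable {n l m r : ℕ} {S : Data n l m r}

/-- At an interior zero the generator would have a local maximum, hence zero gradient, while the
qualification with all weight on that index requires a nonzero one. -/
theorem psiBar_neg_of_mem_interior (H : S.StandingHyp) {i : Fin (r + 1)} {t : ℝ}
    (ht : t ∈ Icc 0 S.T) {x : Euc n} (hx : x ∈ S.CTrunc t)
    (h : x ∈ interior {z | S.psiBar i t z ≤ 0}) : S.psiBar i t x < 0 := by
  by_contra! hge
  have h0 : S.psiBar i t x = 0 := le_antisymm (H.mem_CTrunc_iff.1 hx i) hge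
  have hmax : IsLocalMax (S.psiBar i t) x := by
    filter_upwards [mem_interior_iff_mem_nhds.1 h] with z hz
    rw [h0]; exact hz
  have hgrad : gradient (S.psiBar i t) x = 0 := by
    rw [gradient, hmax.fderiv_eq_zero, map_zero]
  have hi : i ∈ S.active t x := by simp [active, h0]
  have := H.param.2.2.2.2.2.2 t ht x hx ⟨i, hi⟩ (Pi.single i 1)
    (fun j => by by_cases hj : j = i <;> simp [hj])
    (by simp [Pi.single_apply, hi])
  have h2 : ∑ j ∈ S.active t x, (Pi.single i (1 : ℝ) : Fin (r + 1) → ℝ) j •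
      gradient (S.psiBar j t) x = 0 := by
    refine Finset.sum_eq_zero fun j _ => ?_
    by_cases hj : j = i
    · rw [hj, hgrad, smul_zero]
    · rw [Pi.single_eq_of_ne hj, zero_smul]
  rw [h2, norm_zero] at this
  linarith [H.eta_pos]

theorem psiBar_neg_of_mem_interior_C (H : S.StandingHyp) (i : Fin (r + 1)) {t : ℝ}
    (ht : t ∈ Icc 0 S.T) {x : Euc n} (hx : x ∈ S.CTrunc t)
    (h : x ∈ interior (S.C t) ∩ ball (S.xbar t) S.eps) : S.psiBar i t x < 0 := by
  refine Fin.lastCases ?_ (fun i => ?_) i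
  · rw [psiBar_last]
    have h1 := h.2
    rw [mem_ball, dist_eq_norm] at h1
    have := pow_lt_pow_left₀ h1 (norm_nonneg _) two_ne_zero
    simp only
    linarith
  · refine H.psiBar_neg_of_mem_interior ht hx (interior_mono (fun z hz => ?_) h.1)
    change S.psiBar i.castSucc t z ≤ 0
    rw [psiBar_castSucc]
    exact hz i

/-- The sign cut-off of a multiplier outside the active region. -/
theorem exists_multiplier {T : ℝ} {ξ a : ℝ → ℝ} (h0 : ∀ᵐ t ∂(leb T), 0 ≤ ξ t)
    (ha : ∀ᵐ t ∂(leb T), a t < 0 → ξ t = 0) :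
    ∃ ξ' : ℝ → ℝ, ξ =ᵐ[leb T] ξ' ∧ (∀ t, 0 ≤ ξ' t) ∧ ∀ t, a t < 0 → ξ' t = 0 := by
  classical
  refine ⟨fun t => if a t < 0 then 0 else max (ξ t) 0, ?_, fun t => ?_, fun t ht => if_pos ht⟩
  · filter_upwards [h0, ha] with t h1 h2
    split_ifs with h
    · exact h2 h
    · exact (max_eq_left h1).symm
  · dsimp only
    split_ifs
    · exact le_rfl
    · exact le_max_right _ _

/-- Compactness: a subsequence of the penalized trajectories and multipliers converges. -/
theorem exists_limit (H : S.StandingHyp) {γ : ℕ → ℝ} (hγ : ∀ k, S.Admissible (γ k))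
    (hγlim : Tendsto γ atTop atTop) {c : ℕ → Euc n} {d : ℕ → Euc l} {x₀ : Euc n} {y₀ : Euc l}
    (hc : Tendsto c atTop (𝓝 x₀)) (hd : Tendsto d atTop (𝓝 y₀)) {u : ℕ → ℝ → Euc m}
    {X : ℕ → ℝ → Euc n} {Y : ℕ → ℝ → Euc l}
    (hP : ∀ k, S.PenConclusion (γ k) (u k) (c k) (d k) (X k) (Y k)) :
    ∃ (σ : ℕ → ℕ) (x : ℝ → Euc n) (y : ℝ → Euc l) (ξ : Fin (r + 1) → ℝ → ℝ) (ζ : ℝ → ℝ),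
      StrictMono σ ∧ S.LimitConvergence (γ ∘ σ) (X ∘ σ) (Y ∘ σ) x y ξ ζ ∧
      S.LimitProperties x y ξ ζ ∧ x 0 = x₀ ∧ y 0 = y₀ ∧
      (∀ t ∈ Icc 0 S.T, ∀ i, S.psiBar i t (x t) < 0 → ξ i t = 0) ∧
      ∀ᵐ t ∂(leb S.T), HasDerivAt x (deriv x t) t ∧ HasDerivAt y (deriv y t) t := by
  have hT := H.T_pos
  have hμ := H.muBar_pos
  have hη := H.eta_pos
  have hL := H.LBar_pos
  have hMh := H.Mh_pos
  set B : ℝ := 2 * S.muBar / S.eta ^ 2 with hB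
  have hB0 : 0 ≤ B := by positivity
  set D : ℝ := S.Mh + B * S.LBar with hD
  have hD0 : 0 ≤ D := by positivity
  have hmem : ∀ k, ∀ t ∈ Icc 0 S.T, X k t ∈ S.CTrunc t ∧ Y k t ∈ closedBall (S.ybar t) S.delta :=
    fun k t ht => ⟨H.CPen_subset (hγ k) t ((hP k).2.2.2.2.1 t ht).1,
      H.closedBall_rhoBar_subset (hγ k) t ((hP k).2.2.2.2.1 t ht).2⟩
  have hbX : ∀ k, EssBdd S.T D (deriv (X k)) := fun k =>
    ⟨aestronglyMeasurable_deriv _ _, (hP k).2.2.2.2.2.2.2.2.2.mono fun _ h => h.1⟩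
  have hbY : ∀ k, EssBdd S.T D (deriv (Y k)) := fun k =>
    ⟨aestronglyMeasurable_deriv _ _, (hP k).2.2.2.2.2.2.2.2.2.mono fun _ h => h.2⟩
  have hpos := fun k => (hP k).2.2.2.2.2.2.2.1
  have hle := fun k => (hP k).2.2.2.2.2.2.2.2.1
  have hbξ : ∀ i k, EssBdd S.T B (S.xiPen (γ k) (X k) i) := fun i k => by
    refine ⟨((hP k).2.2.2.2.2.1 i).aestronglyMeasurable measurableSet_Icc, ?_⟩
    filter_upwards [ae_restrict_mem measurableSet_Icc] with t ht
    rw [Real.norm_of_nonneg ((hpos k t ht).1 i).le]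
    exact (Finset.single_le_sum (f := fun i => S.xiPen (γ k) (X k) i t)
      (fun j _ => ((hpos k t ht).1 j).le) (Finset.mem_univ i)).trans (hle k t ht).1
  have hbζ : ∀ k, EssBdd S.T B (S.zetaPen (γ k) (Y k)) := fun k => by
    refine ⟨(hP k).2.2.2.2.2.2.1.aestronglyMeasurable measurableSet_Icc, ?_⟩
    filter_upwards [ae_restrict_mem measurableSet_Icc] with t ht
    rw [Real.norm_of_nonneg (hpos k t ht).2.le]
    exact (hle k t ht).2
  -- extraction
  obtain ⟨σ₁, wx, hσ₁, hwx, hlx⟩ := exists_weakStarTendsto_subseq hD0 hbX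
  obtain ⟨σ₂, wy, hσ₂, hwy, hly⟩ := exists_weakStarTendsto_subseq hD0 fun k => hbY (σ₁ k)
  obtain ⟨σ₃, wζ, hσ₃, hwζ, hlζ⟩ :=
    exists_weakStarTendsto_subseq hB0 fun k => hbζ (σ₁ (σ₂ k))
  obtain ⟨σ₄, wξ, hσ₄, hwξ⟩ := exists_weakStarTendsto_subseq_finset hB0
    (Finset.univ : Finset (Fin (r + 1))) fun i k => hbξ i (σ₁ (σ₂ (σ₃ k)))
  set σ : ℕ → ℕ := fun k => σ₁ (σ₂ (σ₃ (σ₄ k))) with hσdef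
  have hσ : StrictMono σ := hσ₁.comp (hσ₂.comp (hσ₃.comp hσ₄))
  have hlx : WeakStarTendsto S.T (fun k => deriv (X (σ k))) wx := hlx.comp (hσ₂.comp (hσ₃.comp hσ₄))
  have hly : WeakStarTendsto S.T (fun k => deriv (Y (σ k))) wy := hly.comp (hσ₃.comp hσ₄)
  have hlζ : WeakStarTendsto S.T (fun k => S.zetaPen (γ (σ k)) (Y (σ k))) wζ := hlζ.comp hσ₄
  have hbwξ : ∀ i, EssBdd S.T B (wξ i) := fun i => (hwξ i (Finset.mem_univ i)).1
  have hlξ : ∀ i, WeakStarTendsto S.T (fun k => S.xiPen (γ (σ k)) (X (σ k)) i) (wξ i) :=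
    fun i => (hwξ i (Finset.mem_univ i)).2
  obtain ⟨x, hxac, hx0, hxd, hxu, hxw⟩ := exists_uniform_limit_of_weakStarTendsto_deriv hT hD0
    (fun k => (hP (σ k)).1.1)
    (fun k => (hP (σ k)).1.2.2.2.2.mono fun t h => h.1.differentiableAt) (fun k => hbX (σ k))
    (x₀ := x₀) ((hc.comp hσ.tendsto_atTop).congr fun k => (hP (σ k)).1.2.2.1.symm) hwx hlx
  obtain ⟨y, hyac, hy0, hyd, hyu, hyw⟩ := exists_uniform_limit_of_weakStarTendsto_deriv hT hD0
    (fun k => (hP (σ k)).1.2.1)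
    (fun k => (hP (σ k)).1.2.2.2.2.mono fun t h => h.2.differentiableAt) (fun k => hbY (σ k))
    (x₀ := y₀) ((hd.comp hσ.tendsto_atTop).congr fun k => (hP (σ k)).1.2.2.2.1.symm) hwy hly
  have hxc : ContinuousOn x (Icc 0 S.T) := by simpa [uIcc_of_le hT.le] using hxac.continuousOn
  have hyc : ContinuousOn y (Icc 0 S.T) := by simpa [uIcc_of_le hT.le] using hyac.continuousOn
  have hN : ∀ t ∈ Icc 0 S.T, x t ∈ S.CTrunc t ∧ y t ∈ closedBall (S.ybar t) S.delta := by
    intro t ht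
    exact ⟨(H.isClosed_CTrunc ht).mem_of_tendsto (hxu.tendsto_at ht)
        (Eventually.of_forall fun k => (hmem (σ k) t ht).1),
      isClosed_closedBall.mem_of_tendsto (hyu.tendsto_at ht)
        (Eventually.of_forall fun k => (hmem (σ k) t ht).2)⟩
  have hγσ : Tendsto (fun k => γ (σ k)) atTop atTop := hγlim.comp hσ.tendsto_atTop
  have hmeas : ∀ {a : ℝ → ℝ}, ContinuousOn a (Icc 0 S.T) →
      MeasurableSet {t | t ∈ Icc 0 S.T ∧ a t < 0} := by
    intro a ha
    obtain ⟨O, hO, he⟩ := continuousOn_iff'.1 ha (Iio 0) isOpen_Iio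
    have : {t | t ∈ Icc 0 S.T ∧ a t < 0} = O ∩ Icc 0 S.T := by
      rw [← he, inter_comm]; rfl
    rw [this]
    exact hO.measurableSet.inter measurableSet_Icc
  -- At each such time the penalized multipliers tend to zero pointwise, and the weak* limit
  -- inherits this almost everywhere.
  have hξ0 : ∀ i, ∀ᵐ t ∂(leb S.T), S.psiBar i t (x t) < 0 → wξ i t = 0 := by
    intro i
    have h1 := (hlξ i).ae_eq_zero hB0 (fun k => hbξ i (σ k)) (hbwξ i)
      (hmeas (H.continuousOn_psiBar_comp i subset_rfl hxc)) (by
        refine Eventually.of_forall fun t ht => ?_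
        exact tendsto_mul_exp_mul hγσ (((H.continuous_psiBar i ht.1).tendsto _).comp
          (hxu.tendsto_at ht.1)) ht.2)
    filter_upwards [h1, ae_restrict_mem measurableSet_Icc] with t h ht hlt using h ⟨ht, hlt⟩
  have hζ0 : ∀ᵐ t ∂(leb S.T), S.phi t (y t) < 0 → wζ t = 0 := by
    have h1 := hlζ.ae_eq_zero hB0 (fun k => hbζ (σ k)) hwζ
      (hmeas (H.continuousOn_phi_comp subset_rfl hyc)) (by
        refine Eventually.of_forall fun t ht => ?_
        exact tendsto_mul_exp_mul hγσ
          (((differentiableAt_phi t (y t)).continuousAt.tendsto).comp (hyu.tendsto_at ht.1)) ht.2)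
    filter_upwards [h1, ae_restrict_mem measurableSet_Icc] with t h ht hlt using h ⟨ht, hlt⟩
  have hIci : ∀ᵐ _t ∂(leb S.T), Convex ℝ (Ici (0 : ℝ)) ∧ IsClosed (Ici (0 : ℝ)) :=
    Eventually.of_forall fun _ => ⟨convex_Ici 0, isClosed_Ici⟩
  have hIic : ∀ᵐ _t ∂(leb S.T), Convex ℝ (Iic B) ∧ IsClosed (Iic B) :=
    Eventually.of_forall fun _ => ⟨convex_Iic B, isClosed_Iic⟩
  have hξpos : ∀ i, ∀ᵐ t ∂(leb S.T), 0 ≤ wξ i t := fun i =>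
    (hlξ i).mem_convex (fun k => hbξ i (σ k)) (hbwξ i) hIci fun k => by
      filter_upwards [ae_restrict_mem measurableSet_Icc] with t ht using ((hpos (σ k) t ht).1 i).le
  have hζpos : ∀ᵐ t ∂(leb S.T), 0 ≤ wζ t :=
    hlζ.mem_convex (fun k => hbζ (σ k)) hwζ hIci fun k => by
      filter_upwards [ae_restrict_mem measurableSet_Icc] with t ht using (hpos (σ k) t ht).2.le
  -- The multipliers are changed on null sets so that sign and support conditions hold at every
  -- time, as claimed, and not merely almost everywhere.
  choose ξ hξw hξnn hξneg using fun i => exists_multiplier (hξpos i) (hξ0 i)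
  obtain ⟨ζ, hζw, hζnn, hζneg⟩ := exists_multiplier hζpos hζ0
  have hbξ' : ∀ i, EssBdd S.T B (ξ i) := fun i => EssBdd.congr (hbwξ i) (hξw i)
  have hbζ' : EssBdd S.T B ζ := EssBdd.congr hwζ hζw
  have hlξ' : ∀ i, WeakStarTendsto S.T (fun k => S.xiPen (γ (σ k)) (X (σ k)) i) (ξ i) := fun i =>
    (hlξ i).congr (Eventually.of_forall fun _ => EventuallyEq.rfl) (hξw i)
  have hlζ' : WeakStarTendsto S.T (fun k => S.zetaPen (γ (σ k)) (Y (σ k))) ζ :=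
    hlζ.congr (Eventually.of_forall fun _ => EventuallyEq.rfl) hζw
  have hsum : WeakStarTendsto S.T (fun k t => ∑ i, S.xiPen (γ (σ k)) (X (σ k)) i t)
      (fun t => ∑ i, ξ i t) :=
    WeakStarTendsto.sum Finset.univ hlξ' (fun i k => hbξ i (σ k)) hbξ'
  have hsumle : ∀ᵐ t ∂(leb S.T), ∑ i, ξ i t ≤ B :=
    hsum.mem_convex (fun k => EssBdd.sum _ fun i _ => hbξ i (σ k)) (EssBdd.sum _ fun i _ => hbξ' i)
      hIic fun k => by
        filter_upwards [ae_restrict_mem measurableSet_Icc] with t ht using (hle (σ k) t ht).1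
  have hζle : ∀ᵐ t ∂(leb S.T), ζ t ≤ B :=
    hbζ'.2.mono fun t ht => (le_abs_self _).trans ht
  have hbdx : EssBdd S.T D (deriv x) := EssBdd.congr hwx hxw.symm
  have hbdy : EssBdd S.T D (deriv y) := EssBdd.congr hwy hyw.symm
  refine ⟨σ, x, y, ξ, ζ, hσ, ⟨hxu, hyu, ?_, ?_, hlξ', hlζ', hsum⟩,
    ⟨⟨hxac, hbdx.memLp ⊤⟩, ⟨hyac, hbdy.memLp ⊤⟩, fun i => (hbξ' i).memLp ⊤, hbζ'.memLp ⊤,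
      fun t _ => ⟨fun i => hξnn i t, hζnn t⟩, fun t ht => hN t ht, hsumle.and hζle,
      hbdx.2.and hbdy.2, ?_, ?_, fun t _ => hζneg t⟩, hx0, hy0, fun t _ i => hξneg i t, ?_⟩
  · exact hlx.congr (Eventually.of_forall fun _ => EventuallyEq.rfl) hxw.symm
  · exact hly.congr (Eventually.of_forall fun _ => EventuallyEq.rfl) hyw.symm
  · exact fun i t ht => hξneg i t (H.psiBar_neg_of_mem_interior ht.1 (hN t ht.1).1 ht.2)
  · exact fun t ht h => Finset.sum_eq_zero fun i _ =>
      hξneg i t (H.psiBar_neg_of_mem_interior_C i ht (hN t ht).1 h)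
  · filter_upwards [hxd, hyd] with t h1 h2
    exact ⟨h1.differentiableAt.hasDerivAt, h2.differentiableAt.hasDerivAt⟩

end StandingHyp
end Data
end SweepingProcess

/-! ### The limit of the drifts -/

namespace SweepingProcess

/-- Convexity is assumed for the joint values of (f,g), so the pair is treated as one curve in a
Hilbert space. -/
theorem WeakStarTendsto.toLp_prod {T M : ℝ} {E F : Type*} [NormedAddCommGroup E]
    [InnerProductSpace ℝ E] [NormedAddCommGroup F] [InnerProductSpace ℝ F] {v : ℕ → ℝ → E}
    {w : ℝ → E} {v' : ℕ → ℝ → F} {w' : ℝ → F}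
    (h : WeakStarTendsto T v w) (h' : WeakStarTendsto T v' w') (hv : ∀ k, EssBdd T M (v k))
    (hv' : ∀ k, EssBdd T M (v' k)) (hw : EssBdd T M w) (hw' : EssBdd T M w') :
    WeakStarTendsto T (fun k t => WithLp.toLp 2 (v k t, v' k t))
      (fun t => WithLp.toLp 2 (w t, w' t)) := by
  intro p hp
  have hf : Integrable (fun t => (p t).fst) (leb T) :=
    hp.mono ((WithLp.prod_continuous_ofLp 2 E F).fst.comp_aestronglyMeasurable hp.1)
      (Eventually.of_forall fun t => WithLp.norm_fst_le _ _)
  have hs : Integrable (fun t => (p t).snd) (leb T) :=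
    hp.mono ((WithLp.prod_continuous_ofLp 2 E F).snd.comp_aestronglyMeasurable hp.1)
      (Eventually.of_forall fun t => WithLp.norm_snd_le _ _)
  simp only [WithLp.prod_inner_apply]
  have h1 := (h _ hf).add (h' _ hs)
  rw [← integral_add (hw.integrable_inner hf) (hw'.integrable_inner hs)] at h1
  refine h1.congr fun k => ?_
  rw [← integral_add ((hv k).integrable_inner hf) ((hv' k).integrable_inner hs)]
  rfl

theorem EssBdd.toLp_prod {T M : ℝ} {E F : Type*} [NormedAddCommGroup E]
    [InnerProductSpace ℝ E] [NormedAddCommGroup F] [InnerProductSpace ℝ F]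
    {v : ℝ → E} {w : ℝ → F} (hv : EssBdd T M v) (hw : EssBdd T M w) :
    EssBdd T (M + M) (fun t => WithLp.toLp 2 (v t, w t)) := by
  refine ⟨(WithLp.prod_continuous_toLp 2 E F).comp_aestronglyMeasurable (hv.1.prodMk hw.1), ?_⟩
  filter_upwards [hv.2, hw.2] with t h1 h2
  have e : WithLp.toLp 2 (v t, w t) = WithLp.toLp 2 (v t, (0 : F)) + WithLp.toLp 2 ((0 : E), w t) := by
    rw [← WithLp.toLp_add]; simp
  rw [e]
  exact norm_add_le_of_le (by simpa using h1) (by simpa using h2)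

namespace Data

variable {n l m r : ℕ} {S : Data n l m r}

/-- Penalized trajectories together with their limit and limiting multipliers. -/
structure LimitSetting (S : Data n l m r) (γ : ℕ → ℝ) (u : ℕ → ℝ → Euc m) (c : ℕ → Euc n)
    (d : ℕ → Euc l) (X : ℕ → ℝ → Euc n) (Y : ℕ → ℝ → Euc l) (x : ℝ → Euc n) (y : ℝ → Euc l)
    (ξ : Fin (r + 1) → ℝ → ℝ) (ζ : ℝ → ℝ) : Prop where
  hyp : S.StandingHyp
  adm : ∀ k, S.Admissible (γ k)
  ctrl : ∀ k, S.IsControl (u k)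
  pen : ∀ k, S.PenConclusion (γ k) (u k) (c k) (d k) (X k) (Y k)
  conv : S.LimitConvergence γ X Y x y ξ ζ
  props : S.LimitProperties x y ξ ζ
  xi_zero : ∀ t ∈ Icc 0 S.T, ∀ i, S.psiBar i t (x t) < 0 → ξ i t = 0
  hasDeriv : ∀ᵐ t ∂(leb S.T), HasDerivAt x (deriv x t) t ∧ HasDerivAt y (deriv y t) t

namespace LimitSetting

variable {γ : ℕ → ℝ} {u : ℕ → ℝ → Euc m} {c : ℕ → Euc n}
    {d : ℕ → Euc l} {X : ℕ → ℝ → Euc n} {Y : ℕ → ℝ → Euc l} {x : ℝ → Euc n} {y : ℝ → Euc l}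
    {ξ : Fin (r + 1) → ℝ → ℝ} {ζ : ℝ → ℝ}

theorem mem_seq (L : S.LimitSetting γ u c d X Y x y ξ ζ) (k : ℕ) {t : ℝ} (ht : t ∈ Icc 0 S.T) :
    X k t ∈ S.CTrunc t ∧ Y k t ∈ closedBall (S.ybar t) S.delta :=
  ⟨L.hyp.CPen_subset (L.adm k) t ((L.pen k).2.2.2.2.1 t ht).1,
    L.hyp.closedBall_rhoBar_subset (L.adm k) t ((L.pen k).2.2.2.2.1 t ht).2⟩

theorem mem (L : S.LimitSetting γ u c d X Y x y ξ ζ) {t : ℝ} (ht : t ∈ Icc 0 S.T) :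
    x t ∈ S.CTrunc t ∧ y t ∈ closedBall (S.ybar t) S.delta :=
  L.props.2.2.2.2.2.1 t ht

theorem continuousOn_seq (L : S.LimitSetting γ u c d X Y x y ξ ζ) (k : ℕ) :
    ContinuousOn (X k) (Icc 0 S.T) ∧ ContinuousOn (Y k) (Icc 0 S.T) := by
  have h := L.hyp.T_pos.le
  exact ⟨by simpa [uIcc_of_le h] using (L.pen k).1.1.continuousOn,
    by simpa [uIcc_of_le h] using (L.pen k).1.2.1.continuousOn⟩

theorem continuousOn_limit (L : S.LimitSetting γ u c d X Y x y ξ ζ) :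
    ContinuousOn x (Icc 0 S.T) ∧ ContinuousOn y (Icc 0 S.T) := by
  have h := L.hyp.T_pos.le
  exact ⟨by simpa [uIcc_of_le h] using L.props.1.1.continuousOn,
    by simpa [uIcc_of_le h] using L.props.2.1.1.continuousOn⟩

theorem aemeasurable_seq (L : S.LimitSetting γ u c d X Y x y ξ ζ) (k : ℕ) {v : ℝ → Euc m}
    (hv : S.IsControl v) :
    AEMeasurable (fun t => S.f t (X k t) (Y k t) (v t)) (leb S.T) ∧
      AEMeasurable (fun t => S.g t (X k t) (Y k t) (v t)) (leb S.T) := by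
  obtain ⟨κ, hκ, τ, hτ, hball⟩ := L.hyp.exists_uniform_ball_subset (L.adm k)
  obtain ⟨hXc, hYc⟩ := L.continuousOn_seq k
  refine L.hyp.aemeasurable_comp hv le_rfl L.hyp.T_pos.le le_rfl hXc hYc fun t ht => ?_
  have h1 := hball t ht (X k t, Y k t) ((L.pen k).2.2.2.2.1 t ht) t ht (by simpa using hτ.le)
  exact mem_of_superset (closedBall_mem_nhds _ hκ)
    (h1.trans fun p hp => L.hyp.CTrunc_prod_subset hp.1 hp.2)

/-- The Lipschitz modulus in (x,y) is the same for all control values, so the base point may be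
replaced by its limit even though the controls vary with k. -/
theorem tendsto_sub (L : S.LimitSetting γ u c d X Y x y ξ ζ) {v : ℕ → ℝ → Euc m}
    (hv : ∀ k, S.IsControl (v k)) : ∀ᵐ t ∂(leb S.T),
    Tendsto (fun k => S.f t (x t) (y t) (v k t) - S.f t (X k t) (Y k t) (v k t)) atTop (𝓝 0) ∧
    Tendsto (fun k => S.g t (x t) (y t) (v k t) - S.g t (X k t) (Y k t) (v k t)) atTop (𝓝 0) := by
  filter_upwards [ae_all_iff.2 fun k => (hv k).2, ae_restrict_of_ae L.hyp.ae_bounds,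
    ae_restrict_mem measurableSet_Icc] with t hvt hb ht
  have hlim : Tendsto (fun k => S.Lh t * (‖x t - X k t‖ + ‖y t - Y k t‖)) atTop (𝓝 0) := by
    have h1 := ((L.conv.1.tendsto_at ht).const_sub (x t)).norm
    have h2 := ((L.conv.2.1.tendsto_at ht).const_sub (y t)).norm
    rw [sub_self, norm_zero] at h1 h2
    simpa using (h1.add h2).const_mul (S.Lh t)
  have hle := fun k => (hb ht).2 (x t) (y t) (X k t) (Y k t)
    (L.hyp.CTrunc_prod_subset (L.mem ht).1 (L.mem ht).2)
    (L.hyp.CTrunc_prod_subset (L.mem_seq k ht).1 (L.mem_seq k ht).2) _ (hvt k)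
  exact ⟨squeeze_zero_norm (fun k => (hle k).1) hlim, squeeze_zero_norm (fun k => (hle k).2) hlim⟩

/-- The limit may touch the boundary, where the neighbourhood argument fails. Measurability is
inherited from the penalized trajectories, which stay in the interior. -/
theorem aemeasurable_limit (L : S.LimitSetting γ u c d X Y x y ξ ζ) {v : ℝ → Euc m}
    (hv : S.IsControl v) :
    AEMeasurable (fun t => S.f t (x t) (y t) (v t)) (leb S.T) ∧
      AEMeasurable (fun t => S.g t (x t) (y t) (v t)) (leb S.T) := by
  have h := L.tendsto_sub fun _ => hv
  constructor
  · refine aemeasurable_of_tendsto_metrizable_ae atTop (fun k => (L.aemeasurable_seq k hv).1) ?_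
    filter_upwards [h] with t ht
    simpa using ht.1.const_sub (S.f t (x t) (y t) (v t))
  · refine aemeasurable_of_tendsto_metrizable_ae atTop (fun k => (L.aemeasurable_seq k hv).2) ?_
    filter_upwards [h] with t ht
    simpa using ht.2.const_sub (S.g t (x t) (y t) (v t))

theorem essBdd_seq (L : S.LimitSetting γ u c d X Y x y ξ ζ) (k : ℕ) {v : ℝ → Euc m}
    (hv : S.IsControl v) : EssBdd S.T S.Mh (fun t => S.f t (X k t) (Y k t) (v t)) ∧
      EssBdd S.T S.Mh (fun t => S.g t (X k t) (Y k t) (v t)) := by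
  have hm := L.aemeasurable_seq k hv
  have hb : ∀ᵐ t ∂(leb S.T), ‖S.f t (X k t) (Y k t) (v t)‖ ≤ S.Mh ∧
      ‖S.g t (X k t) (Y k t) (v t)‖ ≤ S.Mh := by
    filter_upwards [hv.2, ae_restrict_of_ae L.hyp.ae_bounds,
      ae_restrict_mem measurableSet_Icc] with t hvt hb ht
    exact (hb ht).1 _ _ (L.hyp.CTrunc_prod_subset (L.mem_seq k ht).1 (L.mem_seq k ht).2) _ hvt
  exact ⟨⟨hm.1.aestronglyMeasurable, hb.mono fun _ h => h.1⟩,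
    ⟨hm.2.aestronglyMeasurable, hb.mono fun _ h => h.2⟩⟩

theorem essBdd_limit (L : S.LimitSetting γ u c d X Y x y ξ ζ) {v : ℝ → Euc m}
    (hv : S.IsControl v) : EssBdd S.T S.Mh (fun t => S.f t (x t) (y t) (v t)) ∧
      EssBdd S.T S.Mh (fun t => S.g t (x t) (y t) (v t)) := by
  have hm := L.aemeasurable_limit hv
  have hb : ∀ᵐ t ∂(leb S.T), ‖S.f t (x t) (y t) (v t)‖ ≤ S.Mh ∧
      ‖S.g t (x t) (y t) (v t)‖ ≤ S.Mh := by
    filter_upwards [hv.2, ae_restrict_of_ae L.hyp.ae_bounds,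
      ae_restrict_mem measurableSet_Icc] with t hvt hb ht
    exact (hb ht).1 _ _ (L.hyp.CTrunc_prod_subset (L.mem ht).1 (L.mem ht).2) _ hvt
  exact ⟨⟨hm.1.aestronglyMeasurable, hb.mono fun _ h => h.1⟩,
    ⟨hm.2.aestronglyMeasurable, hb.mono fun _ h => h.2⟩⟩

/-- The velocity of the limit plus its constraint forces is the weak* limit of the drifts. -/
theorem exists_weakStarTendsto_drift (L : S.LimitSetting γ u c d X Y x y ξ ζ) : ∃ M,
    EssBdd S.T M (fun t => deriv x t + ∑ i, ξ i t • gradient (S.psiBar i t) (x t)) ∧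
    EssBdd S.T M (fun t => deriv y t + ζ t • gradient (S.phi t) (y t)) ∧
    WeakStarTendsto S.T (fun k t => S.f t (x t) (y t) (u k t))
      (fun t => deriv x t + ∑ i, ξ i t • gradient (S.psiBar i t) (x t)) ∧
    WeakStarTendsto S.T (fun k t => S.g t (x t) (y t) (u k t))
      (fun t => deriv y t + ζ t • gradient (S.phi t) (y t)) := by
  have H := L.hyp
  have hL := H.LBar_pos
  have hMh := H.Mh_pos
  have hμ := H.muBar_pos
  have hη := H.eta_pos
  set B : ℝ := 2 * S.muBar / S.eta ^ 2 with hB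
  have hB0 : 0 ≤ B := by positivity
  obtain ⟨hxc, hyc⟩ := L.continuousOn_limit
  have hbξ : ∀ i, EssBdd S.T B (ξ i) := fun i => by
    refine ⟨(L.props.2.2.1 i).1, ?_⟩
    filter_upwards [ae_restrict_mem measurableSet_Icc, L.props.2.2.2.2.2.2.1] with t ht h
    have hp := (L.props.2.2.2.2.1 t ht).1
    rw [Real.norm_of_nonneg (hp i)]
    exact (Finset.single_le_sum (f := fun i => ξ i t) (fun j _ => hp j) (Finset.mem_univ i)).trans
      h.1
  have hbζ : EssBdd S.T B ζ := by
    refine ⟨L.props.2.2.2.1.1, ?_⟩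
    filter_upwards [ae_restrict_mem measurableSet_Icc, L.props.2.2.2.2.2.2.1] with t ht h
    rw [Real.norm_of_nonneg (L.props.2.2.2.2.1 t ht).2]
    exact h.2
  have hbξk : ∀ i k, EssBdd S.T B (S.xiPen (γ k) (X k) i) := fun i k => by
    refine ⟨((L.pen k).2.2.2.2.2.1 i).aestronglyMeasurable measurableSet_Icc, ?_⟩
    filter_upwards [ae_restrict_mem measurableSet_Icc] with t ht
    have hp := ((L.pen k).2.2.2.2.2.2.2.1 t ht).1
    rw [Real.norm_of_nonneg (hp i).le]
    exact (Finset.single_le_sum (f := fun i => S.xiPen (γ k) (X k) i t)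
      (fun j _ => (hp j).le) (Finset.mem_univ i)).trans ((L.pen k).2.2.2.2.2.2.2.2.1 t ht).1
  have hbζk : ∀ k, EssBdd S.T B (S.zetaPen (γ k) (Y k)) := fun k => by
    refine ⟨(L.pen k).2.2.2.2.2.2.1.aestronglyMeasurable measurableSet_Icc, ?_⟩
    filter_upwards [ae_restrict_mem measurableSet_Icc] with t ht
    rw [Real.norm_of_nonneg ((L.pen k).2.2.2.2.2.2.2.1 t ht).2.le]
    exact ((L.pen k).2.2.2.2.2.2.2.2.1 t ht).2
  have hgrad : ∀ i {z : ℝ → Euc n}, ContinuousOn z (Icc 0 S.T) →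
      (∀ t ∈ Icc 0 S.T, z t ∈ S.CTrunc t) →
      EssBdd S.T S.LBar (fun t => gradient (S.psiBar i t) (z t)) := fun i z hz hzC => by
    refine ⟨(H.continuousOn_gradient_comp i subset_rfl hz hzC).aestronglyMeasurable
      measurableSet_Icc, ?_⟩
    filter_upwards [ae_restrict_mem measurableSet_Icc] with t ht
    exact H.norm_gradient_le i ht (hzC t ht)
  have hgradφ : ∀ {z : ℝ → Euc l}, ContinuousOn z (Icc 0 S.T) →
      (∀ t ∈ Icc 0 S.T, z t ∈ closedBall (S.ybar t) S.delta) →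
      EssBdd S.T S.LBar (fun t => gradient (S.phi t) (z t)) := fun {z} hz hzC => by
    simp_rw [StandingHyp.gradient_phi]
    refine ⟨(hz.sub H.continuousOn_ybar).aestronglyMeasurable measurableSet_Icc, ?_⟩
    filter_upwards [ae_restrict_mem measurableSet_Icc] with t ht
    have := hzC t ht
    rw [mem_closedBall, dist_eq_norm] at this
    exact this.trans H.delta_le
  set D : ℝ := S.Mh + B * S.LBar with hD
  set R : ℝ := (Finset.univ : Finset (Fin (r + 1))).card * (B * S.LBar) with hR
  have hBL : 0 ≤ B * S.LBar := by positivity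
  have hD0 : 0 ≤ D := by positivity
  have hR0 : 0 ≤ R := by positivity
  have hBR : B * S.LBar ≤ R := by
    rw [hR, Finset.card_univ, Fintype.card_fin]
    exact le_mul_of_one_le_left hBL (by simp)
  have hbx : EssBdd S.T D (deriv x) :=
    ⟨aestronglyMeasurable_deriv _ _, L.props.2.2.2.2.2.2.2.1.mono fun _ h => h.1⟩
  have hby : EssBdd S.T D (deriv y) :=
    ⟨aestronglyMeasurable_deriv _ _, L.props.2.2.2.2.2.2.2.1.mono fun _ h => h.2⟩
  have hbX : ∀ k, EssBdd S.T D (deriv (X k)) := fun k =>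
    ⟨aestronglyMeasurable_deriv _ _, (L.pen k).2.2.2.2.2.2.2.2.2.mono fun _ h => h.1⟩
  have hbY : ∀ k, EssBdd S.T D (deriv (Y k)) := fun k =>
    ⟨aestronglyMeasurable_deriv _ _, (L.pen k).2.2.2.2.2.2.2.2.2.mono fun _ h => h.2⟩
  have hgx := fun i => hgrad i hxc fun t ht => (L.mem ht).1
  have hgX := fun i k => hgrad i (L.continuousOn_seq k).1 fun t ht => (L.mem_seq k ht).1
  have hgy := hgradφ hyc fun t ht => (L.mem ht).2
  have hgY := fun k => hgradφ (L.continuousOn_seq k).2 fun t ht => (L.mem_seq k ht).2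
  have hfx : EssBdd S.T R (fun t => ∑ i, ξ i t • gradient (S.psiBar i t) (x t)) :=
    EssBdd.sum _ fun i _ => EssBdd.smul hB0 (hbξ i) (hgx i)
  have hfX : ∀ k, EssBdd S.T R
      (fun t => ∑ i, S.xiPen (γ k) (X k) i t • gradient (S.psiBar i t) (X k t)) := fun k =>
    EssBdd.sum _ fun i _ => EssBdd.smul hB0 (hbξk i k) (hgX i k)
  have hfy : EssBdd S.T R (fun t => ζ t • gradient (S.phi t) (y t)) :=
    (EssBdd.smul hB0 hbζ hgy).mono hBR
  have hfY : ∀ k, EssBdd S.T R (fun t => S.zetaPen (γ k) (Y k) t • gradient (S.phi t) (Y k t)) :=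
    fun k => (EssBdd.smul hB0 (hbζk k) (hgY k)).mono hBR
  have hDR : D ≤ D + R := by linarith
  have hRD : R ≤ D + R := by linarith
  -- The multipliers converge only weakly*, but the gradients converge at every time along the
  -- uniformly convergent trajectories.
  have hwf : WeakStarTendsto S.T
      (fun k t => ∑ i, S.xiPen (γ k) (X k) i t • gradient (S.psiBar i t) (X k t))
      (fun t => ∑ i, ξ i t • gradient (S.psiBar i t) (x t)) := by
    refine WeakStarTendsto.sum Finset.univ (fun i => ?_)
      (fun i k => EssBdd.smul hB0 (hbξk i k) (hgX i k))
      (fun i => EssBdd.smul hB0 (hbξ i) (hgx i))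
    refine (L.conv.2.2.2.2.1 i).smul hB0 (hbξk i) (hgX i) (hgx i) ?_
    filter_upwards [ae_restrict_mem measurableSet_Icc] with t ht
    have h1 := (H.continuousOn_gradient i) (t, x t) ⟨ht, (L.mem ht).1⟩
    have h2 : Tendsto (fun k => ((t, X k t) : ℝ × Euc n)) atTop
        (𝓝[{p : ℝ × Euc n | p.1 ∈ Icc 0 S.T ∧ p.2 ∈ S.CTrunc p.1}] (t, x t)) :=
      tendsto_nhdsWithin_iff.2 ⟨tendsto_const_nhds.prodMk_nhds (L.conv.1.tendsto_at ht),
        Eventually.of_forall fun k => ⟨ht, (L.mem_seq k ht).1⟩⟩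
    have h3 := h1.tendsto.comp h2
    simp only [Function.comp_def] at h3
    exact h3
  have hwg : WeakStarTendsto S.T
      (fun k t => S.zetaPen (γ k) (Y k) t • gradient (S.phi t) (Y k t))
      (fun t => ζ t • gradient (S.phi t) (y t)) := by
    refine L.conv.2.2.2.2.2.1.smul hB0 hbζk hgY hgy ?_
    filter_upwards [ae_restrict_mem measurableSet_Icc] with t ht
    simp_rw [StandingHyp.gradient_phi]
    exact (L.conv.2.1.tendsto_at ht).sub_const _
  have hsx := L.conv.2.2.1.add hwf (fun k => (hbX k).mono hDR) (fun k => (hfX k).mono hRD)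
    (hbx.mono hDR) (hfx.mono hRD)
  have hsy := L.conv.2.2.2.1.add hwg (fun k => (hbY k).mono hDR) (fun k => (hfY k).mono hRD)
    (hby.mono hDR) (hfy.mono hRD)
  -- By the penalized equation, velocity plus penalty is the drift itself.
  have hsx' : WeakStarTendsto S.T (fun k t => S.f t (X k t) (Y k t) (u k t))
      (fun t => deriv x t + ∑ i, ξ i t • gradient (S.psiBar i t) (x t)) := by
    refine hsx.congr (Eventually.of_forall fun k => ?_) EventuallyEq.rfl
    filter_upwards [(L.pen k).1.2.2.2.2] with t ht
    simp only [ht.1.deriv, xiPen, sub_add_cancel]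
  have hsy' : WeakStarTendsto S.T (fun k t => S.g t (X k t) (Y k t) (u k t))
      (fun t => deriv y t + ζ t • gradient (S.phi t) (y t)) := by
    refine hsy.congr (Eventually.of_forall fun k => ?_) EventuallyEq.rfl
    filter_upwards [(L.pen k).1.2.2.2.2] with t ht
    simp only [ht.2.deriv, zetaPen, sub_add_cancel]
  have hsub := L.tendsto_sub L.ctrl
  exact ⟨D + R, hbx.add hfx, hby.add hfy,
    hsx'.perturb (fun k => (L.essBdd_seq k (L.ctrl k)).1) (fun k => (L.essBdd_limit (L.ctrl k)).1)
      (hsub.mono fun _ h => h.1),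
    hsy'.perturb (fun k => (L.essBdd_seq k (L.ctrl k)).2) (fun k => (L.essBdd_limit (L.ctrl k)).2)
      (hsub.mono fun _ h => h.2)⟩

end LimitSetting
end Data
end SweepingProcess

/-! ### Identification and uniqueness of the limit solution -/

namespace SweepingProcess
namespace Data

variable {n l m r : ℕ} {S : Data n l m r}

namespace StandingHyp

/-- The normal p = f − ẋ satisfies ‖p‖ ≤ M_h + ‖ẋ‖, so hypomonotonicity yields a one-sided Lipschitz
estimate. Competing solutions are only W^{1,1}, hence the Gronwall coefficient is merely integrable.
The y-normals belong to a convex ball and are monotone. -/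
theorem isTruncSolution_unique (H : S.StandingHyp) {v : ℝ → Euc m} (hv : S.IsControl v)
    {x₀ : Euc n} {y₀ : Euc l} {x x' : ℝ → Euc n} {y y' : ℝ → Euc l}
    (h : S.IsTruncSolution v x₀ y₀ x y) (h' : S.IsTruncSolution v x₀ y₀ x' y') :
    EqOn x' x (Icc 0 S.T) ∧ EqOn y' y (Icc 0 S.T) := by
  obtain ⟨κ, hκ, hmono⟩ := H.exists_inner_le_of_mem_clarkeNormalCone
  have hint : ∀ {z : ℝ → Euc n} {w : ℝ → Euc l}, S.IsTruncSolution v x₀ y₀ z w →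
      IntervalIntegrable (fun t => ‖deriv z t‖) volume 0 S.T := by
    intro z w hz
    refine intervalIntegrable_norm_deriv hz.1 ?_
    rw [uIcc_of_le H.T_pos.le]
    filter_upwards [(ae_restrict_iff' measurableSet_Icc).1 hz.2.2.2.2] with t ht htI
    obtain ⟨⟨_, _, hd⟩, _⟩ := ht htI
    exact hd.differentiableAt
  refine eqOn_of_ae_inner_le H.T_pos.le h'.1 h.1 h'.2.1 h.2.1
    (a := fun t => 2 * S.Lh t + κ * (2 * S.Mh + ‖deriv x t‖ + ‖deriv x' t‖))
    ((H.intervalIntegrable_Lh.const_mul 2).add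
      (((intervalIntegrable_const.add (hint h)).add (hint h')).const_mul κ))
    (by rw [h.2.2.1, h'.2.2.1]) (by rw [h.2.2.2.1, h'.2.2.2.1]) ?_
  filter_upwards [H.ae_bounds, ae_mem_of_isControl hv, forall_Ioo_of_ae_leb h.2.2.2.2,
    forall_Ioo_of_ae_leb h'.2.2.2.2] with t hb hvt h1 h2 htI
  have ht := Ioo_subset_Icc_self htI
  obtain ⟨⟨p, hp, hxp⟩, ⟨q, hq, hyq⟩⟩ := h1 htI
  obtain ⟨⟨p', hp', hxp'⟩, ⟨q', hq', hyq'⟩⟩ := h2 htI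
  refine ⟨_, _, _, _, hxp', hxp, hyq', hyq, ?_⟩
  have hN := H.CTrunc_prod_subset hp.1 hq.1
  have hN' := H.CTrunc_prod_subset hp'.1 hq'.1
  obtain ⟨hb1, hb2⟩ := hb ht
  have hvt := hvt ht
  obtain ⟨hf, hg⟩ := hb2 _ _ _ _ hN' hN _ hvt
  have hpn : ‖p‖ ≤ S.Mh + ‖deriv x t‖ := by
    rw [hxp.deriv]
    have := norm_sub_le (S.f t (x t) (y t) (v t)) (S.f t (x t) (y t) (v t) - p)
    rw [sub_sub_cancel] at this
    linarith [(hb1 _ _ hN _ hvt).1]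
  have hpn' : ‖p'‖ ≤ S.Mh + ‖deriv x' t‖ := by
    rw [hxp'.deriv]
    have := norm_sub_le (S.f t (x' t) (y' t) (v t)) (S.f t (x' t) (y' t) (v t) - p')
    rw [sub_sub_cancel] at this
    linarith [(hb1 _ _ hN' _ hvt).1]
  have e1 : inner ℝ p (x' t - x t) ≤ κ * (S.Mh + ‖deriv x t‖) * ‖x' t - x t‖ ^ 2 :=
    (hmono t ht _ hp.1 _ hp'.1 p hp).trans (by gcongr)
  have e2 : inner ℝ p' (x t - x' t) ≤ κ * (S.Mh + ‖deriv x' t‖) * ‖x' t - x t‖ ^ 2 := by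
    rw [norm_sub_rev (x' t)]
    exact (hmono t ht _ hp'.1 _ hp.1 p' hp').trans (by gcongr)
  have e3 := inner_le_zero_of_mem_clarkeNormalCone_of_convex (convex_closedBall _ _) hq hq'.1
  have e4 := inner_le_zero_of_mem_clarkeNormalCone_of_convex (convex_closedBall _ _) hq' hq.1
  have e5 := (real_inner_le_norm (x' t - x t) _).trans
    (mul_le_mul_of_nonneg_left hf (norm_nonneg _))
  have e6 := (real_inner_le_norm (y' t - y t) _).trans
    (mul_le_mul_of_nonneg_left hg (norm_nonneg _))
  have hLh := H.a41.2.2.2.1 t ht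
  have e7 := mul_nonneg hLh (sq_nonneg (‖x' t - x t‖ - ‖y' t - y t‖))
  have e8 : 0 ≤ κ * (2 * S.Mh + ‖deriv x t‖ + ‖deriv x' t‖) * ‖y' t - y t‖ ^ 2 := by
    have := H.Mh_pos
    positivity
  have s1 : inner ℝ (x' t - x t) (S.f t (x' t) (y' t) (v t) - p' - (S.f t (x t) (y t) (v t) - p))
      = inner ℝ (x' t - x t) (S.f t (x' t) (y' t) (v t) - S.f t (x t) (y t) (v t))
        + inner ℝ p (x' t - x t) + inner ℝ p' (x t - x' t) := by
    rw [sub_sub_sub_comm, inner_sub_right, inner_sub_right (x' t - x t) p', real_inner_comm p',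
      real_inner_comm p, ← neg_sub (x' t) (x t), inner_neg_right]
    ring
  have s2 : inner ℝ (y' t - y t) (S.g t (x' t) (y' t) (v t) - q' - (S.g t (x t) (y t) (v t) - q))
      = inner ℝ (y' t - y t) (S.g t (x' t) (y' t) (v t) - S.g t (x t) (y t) (v t))
        + inner ℝ q (y' t - y t) + inner ℝ q' (y t - y' t) := by
    rw [sub_sub_sub_comm, inner_sub_right, inner_sub_right (y' t - y t) q', real_inner_comm q',
      real_inner_comm q, ← neg_sub (y' t) (y t), inner_neg_right]
    ring
  rw [s1, s2]
  nlinarith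

theorem smul_gradient_phi_mem_clarkeNormalCone {t z : ℝ} {y : Euc l}
    (hy : y ∈ closedBall (S.ybar t) S.delta) (hz : 0 ≤ z)
    (h : S.phi t y < 0 → z = 0) :
    z • gradient (S.phi t) y ∈ clarkeNormalCone (closedBall (S.ybar t) S.delta) y := by
  refine ⟨hy, fun v hv => ?_⟩
  rcases (phi_le_zero hy).lt_or_eq with hlt | heq
  · simp [h hlt]
  · rw [inner_smul_left]
    exact mul_nonpos_of_nonneg_of_nonpos hz
      (inner_gradient_le_zero_of_mem_clarkeTangentCone hy (fun w hw => phi_le_zero hw) heq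
        (differentiableAt_phi t y) hv)

end StandingHyp

namespace LimitSetting

variable {γ : ℕ → ℝ} {u : ℕ → ℝ → Euc m} {c : ℕ → Euc n}
    {d : ℕ → Euc l} {X : ℕ → ℝ → Euc n} {Y : ℕ → ℝ → Euc l} {x : ℝ → Euc n} {y : ℝ → Euc l}
    {ξ : Fin (r + 1) → ℝ → ℝ} {ζ : ℝ → ℝ}

/-- Once the drift limits are realised by a control, the inclusions hold because the surviving
multipliers sit on active generators. -/
theorem isUniqueTruncSolutionWith (L : S.LimitSetting γ u c d X Y x y ξ ζ) {v : ℝ → Euc m}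
    (hv : S.IsControl v)
    (hf : ∀ᵐ t ∂(leb S.T), S.f t (x t) (y t) (v t)
      = deriv x t + ∑ i, ξ i t • gradient (S.psiBar i t) (x t))
    (hg : ∀ᵐ t ∂(leb S.T), S.g t (x t) (y t) (v t)
      = deriv y t + ζ t • gradient (S.phi t) (y t)) :
    S.IsUniqueTruncSolutionWith v (x 0) (y 0) x y ξ ζ := by
  have hode : ∀ᵐ t ∂(leb S.T),
      HasDerivAt x (S.f t (x t) (y t) (v t)
        - ∑ i, ξ i t • gradient (S.psiBar i t) (x t)) t ∧
      HasDerivAt x (S.f t (x t) (y t) (v t)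
        - ∑ i ∈ S.active t (x t), ξ i t • gradient (S.psiBar i t) (x t)) t ∧
      HasDerivAt y (S.g t (x t) (y t) (v t) - ζ t • gradient (S.phi t) (y t)) t := by
    filter_upwards [hf, hg, L.hasDeriv, ae_restrict_mem measurableSet_Icc] with t h1 h2 h3 ht
    have hsum : ∑ i ∈ S.active t (x t), ξ i t • gradient (S.psiBar i t) (x t)
        = ∑ i, ξ i t • gradient (S.psiBar i t) (x t) := by
      refine Finset.sum_subset (Finset.subset_univ _) fun i _ hi => ?_
      rw [L.xi_zero t ht i (lt_of_le_of_ne (L.hyp.mem_CTrunc_iff.1 (L.mem ht).1 i)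
        fun h0 => hi (StandingHyp.mem_active.2 h0)), zero_smul]
    rw [hsum, h1, h2, add_sub_cancel_right, add_sub_cancel_right]
    exact ⟨h3.1, h3.1, h3.2⟩
  have hsol : S.IsTruncSolution v (x 0) (y 0) x y := by
    refine ⟨L.props.1.1, L.props.2.1.1, rfl, rfl, ?_⟩
    filter_upwards [hode, ae_restrict_mem measurableSet_Icc] with t h ht
    have hp := L.props.2.2.2.2.1 t ht
    exact ⟨⟨_, L.hyp.sum_smul_gradient_mem_clarkeNormalCone ht (L.mem ht).1 hp.1, h.2.1⟩,
      ⟨_, StandingHyp.smul_gradient_phi_mem_clarkeNormalCone (L.mem ht).2 hp.2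
        (L.props.2.2.2.2.2.2.2.2.2.2 t ht), h.2.2⟩⟩
  exact ⟨hsol, fun x' y' h' => L.hyp.isTruncSolution_unique hv hsol h', hode⟩

/-- Continuity of h in the control gives pointwise, bounded convergence of the drifts, so their
weak* limit is the drift for the limit control. -/
theorem isUniqueTruncSolutionWith_of_tendsto (L : S.LimitSetting γ u c d X Y x y ξ ζ)
    {v : ℝ → Euc m} (hv : S.IsControl v)
    (hlim : ∀ᵐ t ∂(leb S.T), Tendsto (fun k => u k t) atTop (𝓝 (v t))) :
    S.IsUniqueTruncSolutionWith v (x 0) (y 0) x y ξ ζ := by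
  obtain ⟨M, hbf, hbg, hf, hg⟩ := L.exists_weakStarTendsto_drift
  have hconv : ∀ᵐ t ∂(leb S.T),
      Tendsto (fun k => S.f t (x t) (y t) (u k t) - S.f t (x t) (y t) (v t)) atTop (𝓝 0) ∧
      Tendsto (fun k => S.g t (x t) (y t) (u k t) - S.g t (x t) (y t) (v t)) atTop (𝓝 0) := by
    filter_upwards [hlim, hv.2, ae_all_iff.2 fun k => (L.ctrl k).2, L.hyp.a41.2.1,
      ae_restrict_mem measurableSet_Icc] with t h1 h2 h3 h4 ht
    have hN := L.hyp.CTrunc_prod_subset (L.mem ht).1 (L.mem ht).2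
    have hw : Tendsto (fun k => (((x t, y t), u k t) : (Euc n × Euc l) × Euc m)) atTop
        (𝓝[S.N S.delta S.delta t ×ˢ S.U t] ((x t, y t), v t)) :=
      tendsto_nhdsWithin_iff.2 ⟨tendsto_const_nhds.prodMk_nhds h1,
        Eventually.of_forall fun k => ⟨hN, h3 k⟩⟩
    exact ⟨tendsto_sub_nhds_zero_iff.2 ((h4.1 _ ⟨hN, h2⟩).tendsto.comp hw),
      tendsto_sub_nhds_zero_iff.2 ((h4.2 _ ⟨hN, h2⟩).tendsto.comp hw)⟩
  have hbv := L.essBdd_limit hv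
  have hf' := (weakStarTendsto_const (T := S.T) fun t => S.f t (x t) (y t) (v t)).perturb
    (fun _ => hbv.1) (fun k => (L.essBdd_limit (L.ctrl k)).1) (hconv.mono fun _ h => h.1)
  have hg' := (weakStarTendsto_const (T := S.T) fun t => S.g t (x t) (y t) (v t)).perturb
    (fun _ => hbv.2) (fun k => (L.essBdd_limit (L.ctrl k)).2) (hconv.mono fun _ h => h.2)
  exact L.isUniqueTruncSolutionWith hv (hf'.unique hf hbv.1 hbf) (hg'.unique hg hbv.2 hbg)

/-- All drifts lie in the compact convex sets h(t,x(t),y(t),U(t)), hence so does their weak* limit,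
and a measurable control realises it. -/
theorem exists_isUniqueTruncSolutionWith (L : S.LimitSetting γ u c d X Y x y ξ ζ) (hU : S.HypU)
    (hA1 : S.HypA1) (hA42 : S.HypA42) :
    ∃ v, S.IsControl v ∧ S.IsUniqueTruncSolutionWith v (x 0) (y 0) x y ξ ζ := by
  obtain ⟨M, hbf, hbg, hf, hg⟩ := L.exists_weakStarTendsto_drift
  have hcont : ∀ᵐ t ∂(leb S.T), ContinuousOn
      (fun w => (S.f t (x t) (y t) w, S.g t (x t) (y t) w)) (S.U t) := by
    filter_upwards [L.hyp.a41.2.1, ae_restrict_mem measurableSet_Icc] with t h4 ht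
    have hN := L.hyp.CTrunc_prod_subset (L.mem ht).1 (L.mem ht).2
    have hmap : MapsTo (fun w => (((x t, y t), w) : (Euc n × Euc l) × Euc m)) (S.U t)
        (S.N S.delta S.delta t ×ˢ S.U t) := fun w hw => ⟨hN, hw⟩
    have hc : ContinuousOn (fun w => (((x t, y t), w) : (Euc n × Euc l) × Euc m)) (S.U t) := by
      fun_prop
    exact (h4.1.comp hc hmap).prodMk (h4.2.comp hc hmap)
  set Q : ℝ → Set (WithLp 2 (Euc n × Euc l)) := fun t =>
    WithLp.toLp 2 '' ((fun w => (S.f t (x t) (y t) w, S.g t (x t) (y t) w)) '' S.U t) with hQdef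
  have hQ : ∀ᵐ t ∂(leb S.T), Convex ℝ (Q t) ∧ IsClosed (Q t) := by
    filter_upwards [hcont, hA42, ae_restrict_mem measurableSet_Icc] with t h1 h2 ht
    have hN := L.hyp.CTrunc_prod_subset (L.mem ht).1 (L.mem ht).2
    refine ⟨(h2 _ hN).linear_image (WithLp.linearEquiv 2 ℝ (Euc n × Euc l)).symm.toLinearMap, ?_⟩
    exact (((hA1 t ht).image_of_continuousOn h1).image
      (WithLp.prod_continuous_toLp 2 (Euc n) (Euc l))).isClosed
  have hMM : M ≤ max M S.Mh := le_max_left _ _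
  have hMM' : S.Mh ≤ max M S.Mh := le_max_right _ _
  have hbk := fun k => L.essBdd_limit (L.ctrl k)
  have hw := (hf.toLp_prod hg (fun k => (hbk k).1.mono hMM') (fun k => (hbk k).2.mono hMM')
    (hbf.mono hMM) (hbg.mono hMM)).mem_convex (fun k => EssBdd.toLp_prod (hbk k).1 (hbk k).2)
    (EssBdd.toLp_prod hbf hbg) hQ (fun k => by
      filter_upwards [(L.ctrl k).2] with t ht
      exact ⟨_, ⟨_, ht, rfl⟩, rfl⟩)
  obtain ⟨v, hvm, hv⟩ := exists_measurable_implicit_selection (μ := leb S.T) (U := S.U)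
    (H := fun t w => (S.f t (x t) (y t) w, S.g t (x t) (y t) w))
    (w := fun t => (deriv x t + ∑ i, ξ i t • gradient (S.psiBar i t) (x t),
      deriv y t + ζ t • gradient (S.phi t) (y t)))
    (by
      filter_upwards [ae_restrict_mem measurableSet_Icc] with t ht
      exact ⟨(hU.1 t ht).1, hA1 t ht⟩)
    (fun O hO => by
      have h1 := (hU.2 O hO).mono (Measure.restrict_le_self (s := Icc 0 S.T))
      refine h1.congr ?_
      filter_upwards [ae_restrict_mem measurableSet_Icc] with t ht
      exact propext ⟨fun h => h.2, fun h => ⟨ht, h⟩⟩)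
    hcont
    (fun v hv hvU => by
      have h := L.aemeasurable_limit ⟨hv, hvU⟩
      exact h.1.prodMk h.2)
    (hbf.1.aemeasurable.prodMk hbg.1.aemeasurable)
    (by
      filter_upwards [hw] with t ht
      obtain ⟨p, hp, he⟩ := ht
      rwa [← WithLp.toLp_injective 2 he])
  have hvc : S.IsControl v := ⟨hvm, hv.mono fun _ h => h.1⟩
  exact ⟨v, hvc, L.isUniqueTruncSolutionWith hvc (hv.mono fun _ h => (Prod.ext_iff.1 h.2).1)
    (hv.mono fun _ h => (Prod.ext_iff.1 h.2).2)⟩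

end LimitSetting
end Data
end SweepingProcess

/-! ### The main theorem -/

theorem theorem3p1 {n l m r : ℕ} (S : Data n l m r)
    (hT : 0 < S.T) (hU : S.HypU) (hA2 : S.HypA2) (hRef : S.HypRef) (hdelta : 0 < S.delta)
    (hA31 : S.HypA31) (hA32 : S.HypA32) (hA41 : S.HypA41) (hParam : S.HypParam)
    (γ : ℕ → ℝ) (hγ : ∀ k, 2 * S.muBar / S.eta ^ 2 * Real.exp 1 < γ k)
    (hγlim : Tendsto γ atTop atTop)
    (c : ℕ → Euc n) (d : ℕ → Euc l)
    (hcd : ∀ᶠ k in atTop, c k ∈ S.CPen (γ k) 0 ∧ d k ∈ closedBall (S.ybar 0) (S.rhoBar (γ k)))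
    (x₀ : Euc n) (y₀ : Euc l) (hxy₀ : (x₀, y₀) ∈ S.N S.eps S.delta 0)
    (hc : Tendsto c atTop (𝓝 x₀)) (hd : Tendsto d atTop (𝓝 y₀))
    (u : ℕ → ℝ → Euc m) (hu : ∀ k, S.IsControl (u k)) :
    ∃ (K : ℕ) (X : ℕ → ℝ → Euc n) (Y : ℕ → ℝ → Euc l),
      (∀ k ≥ K, S.PenConclusion (γ k) (u k) (c k) (d k) (X k) (Y k)) ∧
      ∃ (σ : ℕ → ℕ) (x : ℝ → Euc n) (y : ℝ → Euc l) (ξ : Fin (r + 1) → ℝ → ℝ) (ζ : ℝ → ℝ),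
        StrictMono σ ∧
        S.LimitConvergence (γ ∘ σ) (X ∘ σ) (Y ∘ σ) x y ξ ζ ∧
        S.LimitProperties x y ξ ζ ∧
        ((∃ (τ : ℕ → ℕ) (v : ℝ → Euc m), StrictMono τ ∧ S.IsControl v ∧
            ∀ᵐ t ∂(leb S.T), Tendsto (fun k => u (τ k) t) atTop (𝓝 (v t))) →
          ∃ v : ℝ → Euc m, S.IsControl v ∧
            (∀ᵐ t ∂(leb S.T), Tendsto (fun k => u (σ k) t) atTop (𝓝 (v t))) ∧
            S.IsUniqueTruncSolutionWith v x₀ y₀ x y ξ ζ) ∧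
        (S.HypA1 → S.HypA42 →
          ∃ v : ℝ → Euc m, S.IsControl v ∧ S.IsUniqueTruncSolutionWith v x₀ y₀ x y ξ ζ) := by
  have H : S.StandingHyp := ⟨hT, hRef, hdelta, hA2, hA31, hA41, hParam⟩
  obtain ⟨K, hK⟩ := eventually_atTop.1 ((hγlim.eventually H.eventually_admissible).and hcd)
  have hex : ∀ k, ∃ (x : ℝ → Euc n) (y : ℝ → Euc l), K ≤ k →
      S.PenConclusion (γ k) (u k) (c k) (d k) x y := by
    intro k
    -- For the finitely many indices below K the trajectories are set to zero as a default.
    by_cases hk : K ≤ k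
    · obtain ⟨x, y, h⟩ := H.exists_penConclusion (hK k hk).1 (hu k) (hK k hk).2.1 (hK k hk).2.2
      exact ⟨x, y, fun _ => h⟩
    · exact ⟨0, 0, fun h => absurd h hk⟩
  choose X Y hXY using hex
  refine ⟨K, X, Y, hXY, ?_⟩
  -- The subsequence is chosen before the compactness argument: it follows a convergent subsequence
  -- of the controls whenever there is one, and is otherwise just a shift past K. A single
  -- extraction then serves both alternatives.
  obtain ⟨τ, hτ, hτK, hτv⟩ : ∃ τ : ℕ → ℕ, StrictMono τ ∧ (∀ k, K ≤ τ k) ∧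
      ((∃ (τ : ℕ → ℕ) (v : ℝ → Euc m), StrictMono τ ∧ S.IsControl v ∧
          ∀ᵐ t ∂(leb S.T), Tendsto (fun k => u (τ k) t) atTop (𝓝 (v t))) →
        ∃ v, S.IsControl v ∧ ∀ᵐ t ∂(leb S.T), Tendsto (fun k => u (τ k) t) atTop (𝓝 (v t))) := by
    have hshift : StrictMono fun k : ℕ => k + K := fun a b h => Nat.add_lt_add_right h K
    by_cases h : ∃ (τ : ℕ → ℕ) (v : ℝ → Euc m), StrictMono τ ∧ S.IsControl v ∧
        ∀ᵐ t ∂(leb S.T), Tendsto (fun k => u (τ k) t) atTop (𝓝 (v t))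
    · obtain ⟨τ, v, hτ, hv, hlim⟩ := h
      exact ⟨fun k => τ (k + K), hτ.comp hshift,
        fun k => (Nat.le_add_left K k).trans (hτ.id_le _),
        fun _ => ⟨v, hv, hlim.mono fun t ht => ht.comp hshift.tendsto_atTop⟩⟩
    · exact ⟨fun k => k + K, hshift, fun k => Nat.le_add_left K k, fun h' => absurd h' h⟩
  have hadm := fun k => (hK (τ k) (hτK k)).1
  have hpen := fun k => hXY (τ k) (hτK k)
  obtain ⟨σ, x, y, ξ, ζ, hσ, hconv, hprops, rfl, rfl, hξ, hderiv⟩ :=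
    H.exists_limit hadm (hγlim.comp hτ.tendsto_atTop) (hc.comp hτ.tendsto_atTop)
      (hd.comp hτ.tendsto_atTop) hpen
  have L : S.LimitSetting (fun k => γ (τ (σ k))) (fun k => u (τ (σ k))) (fun k => c (τ (σ k)))
      (fun k => d (τ (σ k))) (fun k => X (τ (σ k))) (fun k => Y (τ (σ k))) x y ξ ζ :=
    ⟨H, fun k => hadm (σ k), fun k => hu _, fun k => hpen (σ k), hconv, hprops, hξ, hderiv⟩
  refine ⟨τ ∘ σ, x, y, ξ, ζ, hτ.comp hσ, hconv, hprops, fun h => ?_,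
    fun hA1 hA42 => L.exists_isUniqueTruncSolutionWith hU hA1 hA42⟩
  obtain ⟨v, hv, hlim⟩ := hτv h
  have hlim' : ∀ᵐ t ∂(leb S.T), Tendsto (fun k => u (τ (σ k)) t) atTop (𝓝 (v t)) :=
    hlim.mono fun t ht => ht.comp hσ.tendsto_atTop
  exact ⟨v, hv, hlim', L.isUniqueTruncSolutionWith_of_tendsto hv hlim'⟩
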